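/- **The logic.** Formulas are built from variables $p_0,p_1,p_2,\dots$ and the constants $1,\top,\bot$ by the unary connective $\neg$ and the binary connectives $\otimes,\multimap,/,\wedge,\vee$ (here $A\multimap B$ and $B/ A$ are the two residuals of $\otimes$: $A\otimes(A\multimap B)$ and $(B/ A)\otimes A$ both entail $B$). Bunches are the elements of the algebra freely generated by the formulas with two binary operations, "comma" and "semicolon", and two constants $\epsilon,\delta$, where $\epsilon$ is a two-sided unit for comma, $\delta$ is a two-sided unit for semicolon, and no other laws are imposed. A context $\Gamma[\_]$ is a bunch with one hole, and $\Gamma[\Delta]$ is the result of putting $\Delta$ into the hole. A sequent $\Gamma\Rightarrow C$ consists of a bunch $\Gamma$ and a formula $C$. BFNL (the nonassociative Lambek calculus with Boolean connectives and the constants $1,\top,\bot$) is the following sequent system; $\dfrac{S_1\;\;S_2}{S}$ means that $S$ follows from $S_1$ and $S_2$. Axioms: $A\Rightarrow A$; $\;\Gamma\Rightarrow\top$; $\;\Gamma[\bot]\Rightarrow C$; $\;A\wedge\neg A\Rightarrow\bot$; $\;\top\Rightarrow A\vee\neg A$; $\;\epsilon\Rightarrow 1$. Cut: $\dfrac{\Gamma\Rightarrow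 A\quad\Delta[A]\Rightarrow C}{\Delta[\Gamma]\Rightarrow C}$. Multiplicative rules: $$\frac{\Gamma[(A,B)]\Rightarrow C}{\Gamma[A\otimes B]\Rightarrow C},\qquad \frac{\Gamma\Rightarrow A\quad\Delta\Rightarrow B}{(\Gamma,\Delta)\Rightarrow A\otimes B},$$ $$\frac{\Gamma[B]\Rightarrow C\quad\Theta\Rightarrow A}{\Gamma[(\Theta,A\multimap B)]\Rightarrow C},\qquad \frac{(A,\Gamma)\Rightarrow B}{\Gamma\Rightarrow A\multimap B},\qquad \frac{\Gamma[A]\Rightarrow C\quad\Theta\Rightarrow B}{\Gamma[(A/ B,\Theta)]\Rightarrow C},\qquad \frac{(\Gamma,B)\Rightarrow A}{\Gamma\Rightarrow A/ B},$$ $$\frac{\Gamma[\Delta]\Rightarrow C}{\Gamma[(1,\Delta)]\Rightarrow C},\qquad \frac{\Gamma[\Delta]\Rightarrow C}{\Gamma[(\Delta,1)]\Rightarrow C}.$$ Additive rules: $$\frac{\Gamma[(A;B)]\Rightarrow C}{\Gamma[A\wedge B]\Rightarrow C},\quad \frac{\Gamma\Rightarrow A\quad\Gamma\Rightarrow B}{\Gamma\Rightarrow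 A\wedge B},\quad \frac{\Gamma[A]\Rightarrow C\quad\Gamma[B]\Rightarrow C}{\Gamma[A\vee B]\Rightarrow C},\quad \frac{\Gamma\Rightarrow A}{\Gamma\Rightarrow A\vee B},\quad \frac{\Gamma\Rightarrow B}{\Gamma\Rightarrow A\vee B},$$ $$\frac{\Gamma[\Delta]\Rightarrow C}{\Gamma[(\top;\Delta)]\Rightarrow C},\qquad \frac{\Gamma[\Delta]\Rightarrow C}{\Gamma[(\Delta;\top)]\Rightarrow C}.$$ Structural rules for the semicolon: from $\Gamma[(\Delta_1;(\Delta_2;\Delta_3))]\Rightarrow C$ infer $\Gamma[((\Delta_1;\Delta_2);\Delta_3)]\Rightarrow C$, and conversely; from $\Gamma[(\Delta;\Theta)]\Rightarrow C$ infer $\Gamma[(\Theta;\Delta)]\Rightarrow C$; from $\Gamma[\Delta]\Rightarrow C$ infer $\Gamma[(\Delta;\Theta)]\Rightarrow C$; from $\Gamma[(\Delta;\Delta)]\Rightarrow C$ infer $\Gamma[\Delta]\Rightarrow C$. The finitary consequence relation of BFNL holds between a finite set $\Phi$ of sequents and a sequent $S$, written $\Phi\vdash S$, if $S$ is derivable in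 this system from the sequents of $\Phi$ taken as additional axioms (which are not closed under substitution). **Theorem.** The finitary consequence relation of BFNL is in EXPTIME. That is, write pairs $(\Phi,S)$ as words over a fixed finite alphabet, with formulas and bunches in prefix notation and indices of variables in binary. Then there are a deterministic Turing machine and a polynomial $p$ such that, on every input word $w$, the machine halts after at most $2^{p(|w|)}$ steps and decides whether $w$ is the code of a pair $(\Phi,S)$ with $\Phi\vdash S$. -/

import Mathlib

/-! ### Exponential time -/

/-- A language `L` over a finite alphabet is in EXPTIME: for some polynomial `p`, some
deterministic (multi-stack) Turing machine halts on every word `w` after at most `2 ^ p(|w|)` steps,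
with output `true` if `w ∈ L` and with output `false` otherwise. -/
def InEXPTIME {A : Type} [Fintype A] (L : Language A) : Prop :=
  ∃ (f : List A → Bool)
    (M : Turing.TM2ComputableInTime (id : List A → List A) Computability.encodeBool f)
    (p : Polynomial ℕ),
      (∀ w, f w = true ↔ w ∈ L) ∧ ∀ n, M.time n ≤ 2 ^ p.eval n

namespace BFNL

/-! ### Formulas, bunches, sequents -/

/-- Formulas over the variables `var 0, var 1, …`. `under A B` is `A ⊸ B` (with `A ⊗ (A ⊸ B) ≤ B`)
and `over A B` is `A ⟜ B` (with `(A ⟜ B) ⊗ B ≤ A`). -/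
inductive Formula : Type
  | var (i : ℕ)
  | one
  | top
  | bot
  | neg (A : Formula)
  | tensor (A B : Formula)
  | under (A B : Formula)
  | over (A B : Formula)
  | and (A B : Formula)
  | or (A B : Formula)

/-- Terms denoting bunches: `eps` is the unit `ε` of the comma, `delta` is the unit `δ` of the
semicolon. A bunch is such a term up to `Bunch.Equiv`. -/
inductive Bunch : Type
  | form (A : Formula)
  | eps
  | delta
  | comma (G D : Bunch)
  | semi (G D : Bunch)

/-- Two terms denote the same element of the free biunital bigroupoid generated by the formulas. -/
inductive Bunch.Equiv : Bunch → Bunch → Prop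
  | refl (G : Bunch) : Bunch.Equiv G G
  | symm {G D : Bunch} : Bunch.Equiv G D → Bunch.Equiv D G
  | trans {G D T : Bunch} : Bunch.Equiv G D → Bunch.Equiv D T → Bunch.Equiv G T
  | comma {G G' D D' : Bunch} : Bunch.Equiv G G' → Bunch.Equiv D D' →
      Bunch.Equiv (.comma G D) (.comma G' D')
  | semi {G G' D D' : Bunch} : Bunch.Equiv G G' → Bunch.Equiv D D' →
      Bunch.Equiv (.semi G D) (.semi G' D')
  | eps_comma (G : Bunch) : Bunch.Equiv (.comma .eps G) G
  | comma_eps (G : Bunch) : Bunch.Equiv (.comma G .eps) G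
  | delta_semi (G : Bunch) : Bunch.Equiv (.semi .delta G) G
  | semi_delta (G : Bunch) : Bunch.Equiv (.semi G .delta) G

/-- Contexts: bunches with one hole. -/
inductive Context : Type
  | hole
  | commaLeft (K : Context) (D : Bunch)
  | commaRight (G : Bunch) (K : Context)
  | semiLeft (K : Context) (D : Bunch)
  | semiRight (G : Bunch) (K : Context)

/-- `K.fill D` is `K[D]`. -/
def Context.fill : Context → Bunch → Bunch
  | .hole, T => T
  | .commaLeft K D, T => .comma (K.fill T) D
  | .commaRight G K, T => .comma G (K.fill T)
  | .semiLeft K D, T => .semi (K.fill T) D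
  | .semiRight G K, T => .semi G (K.fill T)

/-- The sequent `ant ⇒ suc`. -/
structure Sequent : Type where
  ant : Bunch
  suc : Formula

/-! ### The sequent system -/

/-- `Derivable Φ s`: the sequent `s` is derivable in BFNL, with cut, from the sequents in `Φ` taken
as additional axioms. The rule `equiv` says that sequents are about bunches and not about the terms
that denote them. -/
inductive Derivable (Φ : Set Sequent) : Sequent → Prop
  | hyp {s : Sequent} : s ∈ Φ → Derivable Φ s
  | equiv {G D : Bunch} {C : Formula} : Bunch.Equiv G D →
      Derivable Φ ⟨G, C⟩ → Derivable Φ ⟨D, C⟩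
  | id (A : Formula) : Derivable Φ ⟨.form A, A⟩
  | cut {G : Bunch} {K : Context} {A C : Formula} :
      Derivable Φ ⟨G, A⟩ → Derivable Φ ⟨K.fill (.form A), C⟩ → Derivable Φ ⟨K.fill G, C⟩
  | tensor_left {K : Context} {A B C : Formula} :
      Derivable Φ ⟨K.fill (.comma (.form A) (.form B)), C⟩ →
      Derivable Φ ⟨K.fill (.form (.tensor A B)), C⟩
  | tensor_right {G D : Bunch} {A B : Formula} :
      Derivable Φ ⟨G, A⟩ → Derivable Φ ⟨D, B⟩ → Derivable Φ ⟨.comma G D, .tensor A B⟩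
  | under_left {K : Context} {T : Bunch} {A B C : Formula} :
      Derivable Φ ⟨K.fill (.form B), C⟩ → Derivable Φ ⟨T, A⟩ →
      Derivable Φ ⟨K.fill (.comma T (.form (.under A B))), C⟩
  | under_right {G : Bunch} {A B : Formula} :
      Derivable Φ ⟨.comma (.form A) G, B⟩ → Derivable Φ ⟨G, .under A B⟩
  | over_left {K : Context} {T : Bunch} {A B C : Formula} :
      Derivable Φ ⟨K.fill (.form A), C⟩ → Derivable Φ ⟨T, B⟩ →
      Derivable Φ ⟨K.fill (.comma (.form (.over A B)) T), C⟩
  | over_right {G : Bunch} {A B : Formula} :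
      Derivable Φ ⟨.comma G (.form B), A⟩ → Derivable Φ ⟨G, .over A B⟩
  | and_left {K : Context} {A B C : Formula} :
      Derivable Φ ⟨K.fill (.semi (.form A) (.form B)), C⟩ →
      Derivable Φ ⟨K.fill (.form (.and A B)), C⟩
  | and_right {G : Bunch} {A B : Formula} :
      Derivable Φ ⟨G, A⟩ → Derivable Φ ⟨G, B⟩ → Derivable Φ ⟨G, .and A B⟩
  | or_left {K : Context} {A B C : Formula} :
      Derivable Φ ⟨K.fill (.form A), C⟩ → Derivable Φ ⟨K.fill (.form B), C⟩ →
      Derivable Φ ⟨K.fill (.form (.or A B)), C⟩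
  | or_right_left {G : Bunch} {A B : Formula} :
      Derivable Φ ⟨G, A⟩ → Derivable Φ ⟨G, .or A B⟩
  | or_right_right {G : Bunch} {A B : Formula} :
      Derivable Φ ⟨G, B⟩ → Derivable Φ ⟨G, .or A B⟩
  | top_semi {K : Context} {D : Bunch} {C : Formula} :
      Derivable Φ ⟨K.fill D, C⟩ → Derivable Φ ⟨K.fill (.semi (.form .top) D), C⟩
  | semi_top {K : Context} {D : Bunch} {C : Formula} :
      Derivable Φ ⟨K.fill D, C⟩ → Derivable Φ ⟨K.fill (.semi D (.form .top)), C⟩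
  | top_right (G : Bunch) : Derivable Φ ⟨G, .top⟩
  | bot_left (K : Context) (C : Formula) : Derivable Φ ⟨K.fill (.form .bot), C⟩
  | semi_assoc {K : Context} {D₁ D₂ D₃ : Bunch} {C : Formula} :
      Derivable Φ ⟨K.fill (.semi D₁ (.semi D₂ D₃)), C⟩ →
      Derivable Φ ⟨K.fill (.semi (.semi D₁ D₂) D₃), C⟩
  | semi_assoc_inv {K : Context} {D₁ D₂ D₃ : Bunch} {C : Formula} :
      Derivable Φ ⟨K.fill (.semi (.semi D₁ D₂) D₃), C⟩ →
      Derivable Φ ⟨K.fill (.semi D₁ (.semi D₂ D₃)), C⟩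
  | semi_exchange {K : Context} {D T : Bunch} {C : Formula} :
      Derivable Φ ⟨K.fill (.semi D T), C⟩ → Derivable Φ ⟨K.fill (.semi T D), C⟩
  | semi_weakening {K : Context} {D T : Bunch} {C : Formula} :
      Derivable Φ ⟨K.fill D, C⟩ → Derivable Φ ⟨K.fill (.semi D T), C⟩
  | semi_contraction {K : Context} {D : Bunch} {C : Formula} :
      Derivable Φ ⟨K.fill (.semi D D), C⟩ → Derivable Φ ⟨K.fill D, C⟩
  | neg_left (A : Formula) : Derivable Φ ⟨.form (.and A (.neg A)), .bot⟩
  | neg_right (A : Formula) : Derivable Φ ⟨.form .top, .or A (.neg A)⟩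
  | one_comma {K : Context} {D : Bunch} {C : Formula} :
      Derivable Φ ⟨K.fill D, C⟩ → Derivable Φ ⟨K.fill (.comma (.form .one) D), C⟩
  | comma_one {K : Context} {D : Bunch} {C : Formula} :
      Derivable Φ ⟨K.fill D, C⟩ → Derivable Φ ⟨K.fill (.comma D (.form .one)), C⟩
  | one_right : Derivable Φ ⟨.eps, .one⟩

/-! ### The decision problem as a language over a finite alphabet -/

/-- The input alphabet. -/
inductive Token : Type
  | bit (b : Bool)
  | var | one | top | bot | neg | tensor | under | over | and | or
  | eps | delta | comma | semi
  | sequent | turnstile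
  deriving DecidableEq, Fintype

/-- Formulas in prefix notation; the variable with index `i` is written as `i` in binary, followed
by the token `var`. -/
def Formula.encode : Formula → List Token
  | .var i => (Computability.encodeNat i).map Token.bit ++ [.var]
  | .one => [.one]
  | .top => [.top]
  | .bot => [.bot]
  | .neg A => .neg :: A.encode
  | .tensor A B => .tensor :: (A.encode ++ B.encode)
  | .under A B => .under :: (A.encode ++ B.encode)
  | .over A B => .over :: (A.encode ++ B.encode)
  | .and A B => .and :: (A.encode ++ B.encode)
  | .or A B => .or :: (A.encode ++ B.encode)

/-- Bunches in prefix notation. -/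
def Bunch.encode : Bunch → List Token
  | .form A => A.encode
  | .eps => [.eps]
  | .delta => [.delta]
  | .comma G D => .comma :: (G.encode ++ D.encode)
  | .semi G D => .semi :: (G.encode ++ D.encode)

/-- A sequent is written as a token `sequent`, its antecedent and its succedent. -/
def Sequent.encode (s : Sequent) : List Token :=
  .sequent :: (s.ant.encode ++ s.suc.encode)

/-- A finite set `Φ` of sequents, given as a list, and a sequent `s`, written one after the other
with a token `turnstile` between them. -/
def encodeInstance (Φ : List Sequent) (s : Sequent) : List Token :=
  Φ.flatMap Sequent.encode ++ .turnstile :: s.encode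

/-- The finitary consequence relation of BFNL, as a language: the codes of all pairs `(Φ, s)` with
`Φ` finite and `s` derivable from `Φ`. -/
def finitaryConsequence : Language Token :=
  {w | ∃ (Φ : List Sequent) (s : Sequent), w = encodeInstance Φ s ∧ Derivable {t | t ∈ Φ} s}

/-! ### Every code is the code of exactly one instance -/

theorem encodeVar_prefix : ∀ (l l' : List Bool) (u v : List Token),
    l.map Token.bit ++ (Token.var :: u) = l'.map Token.bit ++ (Token.var :: v) → l = l' ∧ u = v
  | [], [], u, v, h => by simpa using h
  | [], _ :: _, u, v, h => by simp at h
  | _ :: _, [], u, v, h => by simp at h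
  | a :: l, b :: l', u, v, h => by
    simp only [List.map_cons, List.cons_append, List.cons.injEq, Token.bit.injEq] at h
    obtain ⟨h1, h2⟩ := encodeVar_prefix l l' u v h.2
    exact ⟨by rw [h.1, h1], h2⟩

theorem encodeVar_ne (l : List Bool) (u v : List Token) (t : Token) (h : ∀ b, t ≠ .bit b)
    (h' : t ≠ .var) : l.map Token.bit ++ (Token.var :: u) ≠ t :: v := by
  cases l with
  | nil => intro e; simp at e; exact h' e.1.symm
  | cons b l => intro e; simp at e; exact h b e.1.symm

theorem encodeNat_injective : Function.Injective Computability.encodeNat := fun a b h => by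
  rw [← Computability.decode_encodeNat a, h, Computability.decode_encodeNat]

theorem Formula.encode_prefix (A : Formula) : ∀ (B : Formula) (u v : List Token),
    A.encode ++ u = B.encode ++ v → A = B ∧ u = v := by
  induction A with
  | var i =>
    intro B u v h
    cases B with
    | var j =>
      simp only [Formula.encode, List.append_assoc, List.cons_append, List.nil_append] at h
      obtain ⟨h1, h2⟩ := encodeVar_prefix _ _ _ _ h
      exact ⟨by rw [encodeNat_injective h1], h2⟩
    | _ =>
      simp only [Formula.encode, List.append_assoc, List.cons_append, List.nil_append] at h
      exact absurd h (encodeVar_ne _ _ _ _ (by simp) (by simp))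
  | _ =>
    intro B u v h
    cases B with
    | var j =>
      simp only [Formula.encode, List.append_assoc, List.cons_append, List.nil_append] at h
      exact absurd h.symm (encodeVar_ne _ _ _ _ (by simp) (by simp))
    | _ =>
      simp only [Formula.encode, List.append_assoc, List.cons_append, List.nil_append,
        List.cons.injEq, reduceCtorEq, false_and, true_and] at h <;> grind

theorem Bunch.encode_prefix (G : Bunch) : ∀ (D : Bunch) (u v : List Token),
    G.encode ++ u = D.encode ++ v → G = D ∧ u = v := by
  have key : ∀ (A : Formula) (t : Token) (u v : List Token),
      t ∈ [Token.eps, .delta, .comma, .semi] → A.encode ++ u ≠ t :: v := by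
    intro A t u v ht
    simp only [List.mem_cons, List.not_mem_nil, or_false] at ht
    cases A with
    | var j =>
      simp only [Formula.encode, List.append_assoc, List.cons_append, List.nil_append]
      rcases ht with rfl | rfl | rfl | rfl <;> exact encodeVar_ne _ _ _ _ (by simp) (by simp)
    | _ =>
      rcases ht with rfl | rfl | rfl | rfl <;> simp [Formula.encode]
  induction G with
  | form A =>
    intro D u v h
    cases D with
    | form B =>
      obtain ⟨h1, h2⟩ := Formula.encode_prefix A B u v h
      exact ⟨by rw [h1], h2⟩
    | _ => exact absurd h (key _ _ _ _ (by simp))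
  | _ =>
    intro D u v h
    cases D with
    | form B => exact absurd h.symm (key _ _ _ _ (by simp))
    | _ =>
      simp only [Bunch.encode, List.append_assoc, List.cons_append, List.nil_append,
        List.cons.injEq, reduceCtorEq, false_and, true_and] at h <;> grind

theorem Sequent.encode_prefix (s t : Sequent) (u v : List Token)
    (h : s.encode ++ u = t.encode ++ v) : s = t ∧ u = v := by
  obtain ⟨G, A⟩ := s
  obtain ⟨D, B⟩ := t
  simp only [Sequent.encode, List.append_assoc, List.cons_append, List.cons.injEq, true_and] at h
  obtain ⟨h1, h2⟩ := Bunch.encode_prefix _ _ _ _ h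
  obtain ⟨h3, h4⟩ := Formula.encode_prefix _ _ _ _ h2
  exact ⟨by rw [h1, h3], h4⟩

theorem encodeInstance_injective : ∀ (Φ Ψ : List Sequent) (s t : Sequent),
    encodeInstance Φ s = encodeInstance Ψ t → Φ = Ψ ∧ s = t
  | [], [], s, t, h => by
    simp only [encodeInstance, List.flatMap_nil, List.nil_append, List.cons.injEq, true_and] at h
    have h' : s.encode ++ [] = t.encode ++ [] := by rw [h]
    exact ⟨rfl, (Sequent.encode_prefix s t [] [] h').1⟩
  | [], b :: Ψ, s, t, h => by simp [encodeInstance, Sequent.encode] at h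
  | a :: Φ, [], s, t, h => by simp [encodeInstance, Sequent.encode] at h
  | a :: Φ, b :: Ψ, s, t, h => by
    simp only [encodeInstance, List.flatMap_cons, List.append_assoc] at h
    obtain ⟨h1, h2⟩ := Sequent.encode_prefix a b _ _ h
    obtain ⟨h3, h4⟩ := encodeInstance_injective Φ Ψ s t h2
    exact ⟨by rw [h1, h3], h4⟩

end BFNL

/-! The proof is an elimination of types. Reading the comma as `⊗`, the semicolon as `∧` and the
units as `1` and `⊤` turns every sequent into an inequality between two formulas
(`derivable_iff_le`). For an instance with code `w`, only `1` and the formulas that begin at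
positions of `w` matter. A type over them is a word of `|w| + 1` bits: bit `k` says whether the
formula at position `k`, counted from the right end, holds; bit `0` says whether `1` holds. Start
with all `2 ^ (|w| + 1)` words and discard repeatedly every word that breaks a Boolean clause or a
hypothesis, treats two occurrences of one variable differently, or lacks a witness among the
remaining words: a left and a right unit, two factors for a true `⊗`, a counterexample for a false
residual. The chain of tables is stationary after `2 ^ (|w| + 1)` rounds (`table_stable`). The goal
is derivable if and only if no survivor refutes it (`decideConsequence_iff`).

If the goal is derivable, it holds at all survivors. These form a ternary frame with a set of units
(`typeFrame`) in which truth of a formula at a type is its bit (`mem_eval_typeFrame`); the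
hypotheses are valid there, and BFNL is sound for such frames (`Frame.valid_of_derivable`). As the
comma is not associative, a frame has to satisfy no law beyond those for units, so that finitely
many formulas suffice.

If the goal is not derivable, consider the canonical types: consistent formulas that decide every
formula on the list, where `Z` is related to `X` and `Y` if `Z ∧ (X ⊗ Y)` is consistent.
Distributivity of `⊗` over `∨` allows each of the three places to be refined to a type
(`exists_type_left`, `exists_type_right`, `exists_type_result`), so canonical types supply witnesses
for each other and are never discarded (`kept_typeWord`). One of them refutes the goal
(`exists_type`).

For the time bound, the test for one round is a fixed condition in a small language `Fm` that
quantifies over words of `|w| + 1` bits. A stack program evaluates it: a quantifier is a loop over a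
binary counter, and the table is a stack with one bit per word. The nesting depth is fixed, so the
time is `2 ^ p(|w|)` (`spec_compile`, `spec_decideProg`); programs become Turing machines step by
step (`StackProg.Exec.iterate_step`). One parser serves both sides: it never looks at its
annotations, so the run with formulas, used in the proofs, and the run with bits, done by the
machine, are images of each other (`PState.step_map`). -/

/-! ### Structured programs over finitely many stacks -/

/-- Structured programs that act on a register of type `σ` and on stacks with alphabets `Γ k`. -/
inductive StackProg {K : Type} (Γ : K → Type) (σ : Type) : Type
  | pop (k : K) (f : σ → Option (Γ k) → σ)
  | peek (k : K) (f : σ → Option (Γ k) → σ)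
  | push (k : K) (f : σ → Γ k)
  | load (f : σ → σ)
  | seq (c d : StackProg Γ σ)
  | ite (p : σ → Bool) (c d : StackProg Γ σ)
  | loop (p : σ → Bool) (c : StackProg Γ σ)

namespace StackProg

variable {K : Type} [DecidableEq K] {Γ : K → Type} {σ : Type}

/-- `c.Exec v S v' S' t`: started with register `v` and stacks `S`, the program `c` ends after `t`
steps with register `v'` and stacks `S'`. -/
inductive Exec : StackProg Γ σ → σ → (∀ k, List (Γ k)) → σ → (∀ k, List (Γ k)) → ℕ → Prop
  | pop (k f v S) : Exec (.pop k f) v S (f v (S k).head?) (Function.update S k (S k).tail) 1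
  | peek (k f v S) : Exec (.peek k f) v S (f v (S k).head?) S 1
  | push (k f v S) : Exec (.push k f) v S v (Function.update S k (f v :: S k)) 1
  | load (f v S) : Exec (.load f) v S (f v) S 1
  | seq {c d v₁ S₁ v₂ S₂ v₃ S₃ t u} : Exec c v₁ S₁ v₂ S₂ t → Exec d v₂ S₂ v₃ S₃ u →
      Exec (.seq c d) v₁ S₁ v₃ S₃ (t + u)
  | ite_true {p c d v S v' S' t} : p v = true → Exec c v S v' S' t →
      Exec (.ite p c d) v S v' S' (t + 1)
  | ite_false {p c d v S v' S' t} : p v = false → Exec d v S v' S' t →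
      Exec (.ite p c d) v S v' S' (t + 1)
  | loop_false {p c v S} : p v = false → Exec (.loop p c) v S v S 1
  | loop_true {p c v₁ S₁ v₂ S₂ v₃ S₃ t u} : p v₁ = true → Exec c v₁ S₁ v₂ S₂ t →
      Exec (.loop p c) v₂ S₂ v₃ S₃ u → Exec (.loop p c) v₁ S₁ v₃ S₃ (t + u + 1)

/-- The program points of a program. -/
def Label : StackProg Γ σ → Type
  | .pop _ _ => Unit
  | .peek _ _ => Unit
  | .push _ _ => Unit
  | .load _ => Unit
  | .seq c d => c.Label ⊕ d.Label
  | .ite _ c d => Unit ⊕ (c.Label ⊕ d.Label)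
  | .loop _ c => Unit ⊕ c.Label

/-- There are finitely many program points. -/
@[reducible] def fintypeLabel : (c : StackProg Γ σ) → Fintype c.Label
  | .pop _ _ => inferInstanceAs (Fintype Unit)
  | .peek _ _ => inferInstanceAs (Fintype Unit)
  | .push _ _ => inferInstanceAs (Fintype Unit)
  | .load _ => inferInstanceAs (Fintype Unit)
  | .seq c d =>
    letI := c.fintypeLabel
    letI := d.fintypeLabel
    inferInstanceAs (Fintype (c.Label ⊕ d.Label))
  | .ite _ c d =>
    letI := c.fintypeLabel
    letI := d.fintypeLabel
    inferInstanceAs (Fintype (Unit ⊕ (c.Label ⊕ d.Label)))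
  | .loop _ c =>
    letI := c.fintypeLabel
    inferInstanceAs (Fintype (Unit ⊕ c.Label))

/-- The program point at which the execution starts. -/
def entry : (c : StackProg Γ σ) → c.Label
  | .pop _ _ => ()
  | .peek _ _ => ()
  | .push _ _ => ()
  | .load _ => ()
  | .seq c _ => Sum.inl c.entry
  | .ite _ _ _ => Sum.inl ()
  | .loop _ _ => Sum.inl ()

/-- The machine code of a program whose program points are placed by `e` and that continues at the
label `x`. -/
def code {Λ : Type} : (c : StackProg Γ σ) → (c.Label → Λ) → Λ → c.Label → Turing.TM2.Stmt Γ Λ σ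
  | .pop k f, _, x => fun _ => .pop k f (.goto fun _ => x)
  | .peek k f, _, x => fun _ => .peek k f (.goto fun _ => x)
  | .push k f, _, x => fun _ => .push k f (.goto fun _ => x)
  | .load f, _, x => fun _ => .load f (.goto fun _ => x)
  | .seq c d, e, x => Sum.elim (c.code (fun l => e (Sum.inl l)) (e (Sum.inr d.entry)))
      (d.code (fun l => e (Sum.inr l)) x)
  | .ite p c d, e, x => Sum.elim
      (fun _ => .branch p (.goto fun _ => e (Sum.inr (Sum.inl c.entry)))
        (.goto fun _ => e (Sum.inr (Sum.inr d.entry))))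
      (Sum.elim (c.code (fun l => e (Sum.inr (Sum.inl l))) x)
        (d.code (fun l => e (Sum.inr (Sum.inr l))) x))
  | .loop p c, e, x => Sum.elim
      (fun _ => .branch p (.goto fun _ => e (Sum.inr c.entry)) (.goto fun _ => x))
      (c.code (fun l => e (Sum.inr l)) (e (Sum.inl ())))

theorem iterate_bind_add {α : Type*} (f : α → Option α) {a b c : α} {t u : ℕ}
    (h₁ : (flip bind f)^[t] (some a) = some b) (h₂ : (flip bind f)^[u] (some b) = some c) :
    (flip bind f)^[t + u] (some a) = some c := by
  rw [Nat.add_comm, Function.iterate_add_apply, h₁, h₂]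

/-- Every program point holds one statement that ends in a jump, so program steps and machine steps
correspond one to one; composition costs nothing because the exit of the first part is the entry of
the second. The placement `e` and the exit `x` are arbitrary so that the induction can enter
subprograms. -/
theorem Exec.iterate_step {c : StackProg Γ σ} {v : σ} {S : ∀ k, List (Γ k)} {v' : σ}
    {S' : ∀ k, List (Γ k)} {t : ℕ} (h : c.Exec v S v' S' t) {Λ : Type}
    (M : Λ → Turing.TM2.Stmt Γ Λ σ) (e : c.Label → Λ) (x : Λ) (hM : ∀ l, M (e l) = c.code e x l) :
    (flip bind (Turing.TM2.step M))^[t] (some ⟨some (e c.entry), v, S⟩) =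
      some ⟨some x, v', S'⟩ := by
  have one : ∀ (l : Λ) (v : σ) (S : ∀ k, List (Γ k)) (C : Turing.TM2.Cfg Γ Λ σ),
      Turing.TM2.stepAux (M l) v S = C →
      (flip bind (Turing.TM2.step M))^[1] (some ⟨some l, v, S⟩) = some C := by
    intro l v S C hC
    simp [flip, Turing.TM2.step, hC]
  induction h generalizing x with
  | pop k f v S => exact one _ _ _ _ (by rw [hM]; simp [code])
  | peek k f v S => exact one _ _ _ _ (by rw [hM]; simp [code])
  | push k f v S => exact one _ _ _ _ (by rw [hM]; simp [code])
  | load f v S => exact one _ _ _ _ (by rw [hM]; simp [code])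
  | seq h₁ h₂ ih₁ ih₂ =>
    exact iterate_bind_add _ (ih₁ (fun l => e (Sum.inl l)) _ fun l => hM (Sum.inl l))
      (ih₂ (fun l => e (Sum.inr l)) x fun l => hM (Sum.inr l))
  | @ite_true p c d v S v' S' t hp h ih =>
    rw [Nat.add_comm]
    refine iterate_bind_add _ (one _ _ _ _ ?_)
      (ih (fun l => e (Sum.inr (Sum.inl l))) x fun l => hM (Sum.inr (Sum.inl l)))
    rw [hM]
    simp [code, entry, hp]
  | @ite_false p c d v S v' S' t hp h ih =>
    rw [Nat.add_comm]
    refine iterate_bind_add _ (one _ _ _ _ ?_)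
      (ih (fun l => e (Sum.inr (Sum.inr l))) x fun l => hM (Sum.inr (Sum.inr l)))
    rw [hM]
    simp [code, entry, hp]
  | loop_false hp => exact one _ _ _ _ (by rw [hM]; simp [code, entry, hp])
  | loop_true hp h₁ h₂ ih₁ ih₂ =>
    rw [Nat.add_comm]
    refine iterate_bind_add _ (one _ _ _ _ ?_) (iterate_bind_add _
      (ih₁ (fun l => e (Sum.inr l)) _ fun l => hM (Sum.inr l)) (ih₂ e x hM))
    rw [hM]
    simp [code, entry, hp]

/-- The machine that runs a program and halts. -/
def machine [Fintype K] [Fintype σ] (k₀ k₁ : K) [Fintype (Γ k₀)] (v₀ : σ) (c : StackProg Γ σ) :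
    Turing.FinTM2 :=
  letI := c.fintypeLabel
  { k₀ := k₀, k₁ := k₁, Γ := Γ, Λ := Option c.Label, main := some c.entry, σ := σ
    initialState := v₀
    m := fun l => l.elim .halt (c.code some none) }

/-- The stacks that hold a single word `w` on the stack `k₀`. -/
def single (k₀ : K) (w : List (Γ k₀)) : ∀ k, List (Γ k) := Function.update (fun _ => []) k₀ w

/-- A program that decides a language in exponential time shows that the language is in EXPTIME. -/
theorem inEXPTIME [Fintype K] [Fintype σ] {A : Type} [Fintype A] (L : Language A) (k₀ k₁ : K)
    [Fintype (Γ k₀)] (e₀ : Γ k₀ ≃ A) (e₁ : Γ k₁ ≃ Bool) (v₀ : σ) (c : StackProg Γ σ)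
    (f : List A → Bool) (hf : ∀ w, f w = true ↔ w ∈ L) (p : Polynomial ℕ)
    (hc : ∀ w, ∃ t ≤ 2 ^ p.eval w.length, c.Exec v₀ (single k₀ (w.map e₀.symm))
      v₀ (single k₁ [e₁.symm (f w)]) t) : InEXPTIME L := by
  refine ⟨f, ⟨⟨machine k₀ k₁ v₀ c, e₀, e₁⟩, fun n => 2 ^ p.eval n + 1, fun w => ?_⟩,
    p + 1, hf, fun n => ?_⟩
  · refine Classical.choice ?_
    obtain ⟨t, ht, h⟩ := hc w
    refine ⟨⟨⟨t + 1, ?_⟩, Nat.succ_le_succ ht⟩⟩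
    let _ := c.fintypeLabel
    have hi := h.iterate_step (fun l : Option c.Label => l.elim .halt (c.code some none)) some none
      (fun _ => rfl)
    -- The initial and halting configurations of `FinTM2` are defined by a cast along an equality of
    -- stack indices, which disappears after substitution.
    have key : ∀ (k₀ : K) (w : List (Γ k₀)), (fun k => @dite (List (Γ k)) (k = k₀)
        (inferInstance) (fun h => by rw [h]; exact w) fun _ => []) = single k₀ w := by
      intro k₀ w
      funext k
      by_cases hk : k = k₀
      · subst hk; simp [single]
      · simp [single, hk]
    have h₀ : Turing.initList (machine k₀ k₁ v₀ c) (List.map e₀.invFun (id w)) =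
        (⟨some (some c.entry), v₀, single k₀ (w.map e₀.symm)⟩ :
          Turing.TM2.Cfg Γ (Option c.Label) σ) := by
      rw [← key]; rfl
    have h₁ : Turing.haltList (machine k₀ k₁ v₀ c) (List.map e₁.invFun [f w]) =
        (⟨none, v₀, single k₁ [e₁.symm (f w)]⟩ : Turing.TM2.Cfg Γ (Option c.Label) σ) := by
      rw [← key]; rfl
    -- One additional step: the exit label `none` carries the statement `halt`.
    have h₂ := iterate_bind_add _ hi (c := ⟨none, v₀, single k₁ [e₁.symm (f w)]⟩) (u := 1)
      (by simp [flip, Turing.TM2.step])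
    have h₃ : (flip bind (machine k₀ k₁ v₀ c).step)^[t + 1]
        (some (Turing.initList (machine k₀ k₁ v₀ c) (List.map e₀.invFun (id w)))) =
        some (Turing.haltList (machine k₀ k₁ v₀ c) (List.map e₁.invFun [f w])) := by
      rw [h₀, h₁]
      exact h₂
    exact h₃
  · simp only [Polynomial.eval_add, Polynomial.eval_one, pow_succ]
    have := Nat.one_le_two_pow (n := p.eval n)
    omega

end StackProg

namespace BFNL

/-! ### Parsing words of tokens from right to left -/

/-- The sorts of the items on the stack of the parser. A `fresh` item is the token `var`, a `name`
item is a variable whose index is not `0`. -/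
inductive Srt : Type
  | fresh | name | form | bunch | seq
  deriving DecidableEq

instance : Fintype Srt := ⟨{.fresh, .name, .form, .bunch, .seq}, fun x => by cases x <;> simp⟩

/-- The item is a formula. -/
def Srt.isForm : Option Srt → Bool
  | some .fresh => true
  | some .name => true
  | some .form => true
  | _ => false

/-- The item is a bunch. -/
def Srt.isBunch : Option Srt → Bool
  | some .seq => false
  | none => false
  | _ => true

/-- The number of items that a token takes from the stack. -/
def Token.arity : Token → ℕ
  | .bit _ | .neg | .turnstile => 1
  | .tensor | .under | .over | .and | .or | .comma | .semi | .sequent => 2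
  | _ => 0

/-- The new phase and the sort of the new item (if any) for a token, when the parser is in phase
`ph` (`true` to the left of the turnstile), the arguments have the sorts `x` and `y`, and `e` says
whether the stack below them is empty. -/
def rule (t : Token) (ph : Bool) (x y : Option Srt) (e : Bool) : Option (Bool × Option Srt) :=
  match t with
  | .var => some (ph, some .fresh)
  | .one | .top | .bot => some (ph, some .form)
  | .eps | .delta => some (ph, some .bunch)
  | .bit b => if (x = some .fresh ∧ b = true) ∨ x = some .name then
      some (ph, some .name) else none
  | .neg => if Srt.isForm x then some (ph, some .form) else none
  | .tensor | .under | .over | .and | .or =>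
    if Srt.isForm x ∧ Srt.isForm y then some (ph, some .form) else none
  | .comma | .semi => if Srt.isBunch x ∧ Srt.isBunch y then some (ph, some .bunch) else none
  | .sequent => if Srt.isBunch x ∧ Srt.isForm y ∧ e = true then
      some (ph, if ph then none else some .seq) else none
  | .turnstile => if x = some .seq ∧ ph = false ∧ e = true then some (true, none) else none

/-- A node of a parse tree: its token, its annotation and those of its arguments. For a token
`sequent`, `past` says whether it stands to the left of the turnstile. -/
structure Node (α : Type) : Type where
  kind : Token
  past : Bool
  own : α
  fst : α
  snd : α

/-- Change of annotations. -/
def Node.map {α β : Type} (g : α → β) (n : Node α) : Node β :=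
  ⟨n.kind, n.past, g n.own, g n.fst, g n.snd⟩

/-- The states of the parser. -/
structure PState (α : Type) : Type where
  ok : Bool
  past : Bool
  stack : List (Srt × α)
  nodes : List (Node α)

/-- The initial state of the parser. -/
def PState.init (α : Type) : PState α := ⟨true, false, [], []⟩

/-- Change of annotations. -/
def PState.map {α β : Type} (g : α → β) (s : PState α) : PState β :=
  ⟨s.ok, s.past, s.stack.map fun i => (i.1, g i.2), s.nodes.map (Node.map g)⟩

/-- The effect of a token `t` with annotation `o` that has found the arguments `x` and `y` above the
stack `st`. -/
def PState.reduce {α : Type} (t : Token) (o : α) (s : PState α) (x y : Option (Srt × α))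
    (st : List (Srt × α)) : PState α :=
  match rule t s.past (x.map Prod.fst) (y.map Prod.fst) st.isEmpty with
  | none => ⟨false, s.past, st, s.nodes⟩
  | some (ph, r) => ⟨s.ok, ph, (r.map fun z => (z, o)).toList ++ st,
      ⟨t, s.past, o, (x.map Prod.snd).getD o, (y.map Prod.snd).getD o⟩ :: s.nodes⟩

/-- One step of the parser: the token `t` with annotation `o` is read. -/
def PState.step {α : Type} (t : Token) (o : α) (s : PState α) : PState α :=
  match t.arity with
  | 0 => s.reduce t o none none s.stack
  | 1 => s.reduce t o s.stack.head? none s.stack.tail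
  | _ => s.reduce t o s.stack.head? s.stack.tail.head? s.stack.tail.tail

/-- The parser branches on tokens, sorts and the emptiness of the stack, never on annotations. This
transports the parse by positions and formulas to the parse by bits that the machine performs. -/
theorem PState.step_map {α β : Type} (g : α → β) (t : Token) (o : α) (s : PState α) :
    (s.map g).step t (g o) = (s.step t o).map g := by
  have key : ∀ (x y : Option (Srt × α)) (st : List (Srt × α)),
      (s.map g).reduce t (g o) (x.map fun i => (i.1, g i.2)) (y.map fun i => (i.1, g i.2))
        (st.map fun i => (i.1, g i.2)) = (s.reduce t o x y st).map g := by
    intro x y st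
    have h : ∀ x : Option (Srt × α),
        ((x.map fun i => (i.1, g i.2)).map Prod.fst) = x.map Prod.fst := by
      intro x; cases x <;> rfl
    have h' : ∀ x : Option (Srt × α),
        ((x.map fun i => (i.1, g i.2)).map Prod.snd).getD (g o) = g ((x.map Prod.snd).getD o) := by
      intro x; cases x <;> rfl
    unfold PState.reduce
    rw [h, h, h', h', List.isEmpty_map]
    change (match rule t s.past _ _ _ with | none => _ | some (ph, r) => _) = _
    rcases rule t s.past (x.map Prod.fst) (y.map Prod.fst) st.isEmpty with _ | ⟨ph, _ | r⟩ <;>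
      simp [PState.map, Node.map]
  unfold PState.step
  rcases t.arity with _ | _ | _
  · exact key none none s.stack
  · simpa [PState.map] using key s.stack.head? none s.stack.tail
  · simpa [PState.map] using key s.stack.head? s.stack.tail.head? s.stack.tail.tail

/-- The formula at a node whose arguments are the formulas `A` and `B`. The comma and the semicolon
are read as `tensor` and `and`. -/
def dn : Token → Formula → Formula → Formula
  | .var, _, _ => .var 0
  | .bit b, .var i, _ => .var (Nat.bit b i)
  | .one, _, _ | .eps, _, _ => .one
  | .bot, _, _ => .bot
  | .neg, A, _ => .neg A
  | .tensor, A, B | .comma, A, B => .tensor A B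
  | .under, A, B => .under A B
  | .over, A, B => .over A B
  | .and, A, B | .semi, A, B => .and A B
  | .or, A, B => .or A B
  | _, _, _ => .top

/-- The `k`-th item of a stack as a formula. -/
def itemFormula (st : List (Srt × (ℕ × Formula))) (k : ℕ) : Formula :=
  (st[k]?.map fun i => i.2.2).getD .top

/-- The parser, with every token annotated by its position (the length of the word from there on)
and by the formula that begins there. -/
def parse : List Token → PState (ℕ × Formula)
  | [] => PState.init _
  | t :: w => (parse w).step t
      (w.length + 1, dn t (itemFormula (parse w).stack 0) (itemFormula (parse w).stack 1))

/-- The parser accepts the word. -/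
def PState.accepts {α : Type} (s : PState α) : Bool := s.ok && s.past && s.stack.isEmpty

/-- The formula that corresponds to a bunch. -/
def Bunch.toFormula : Bunch → Formula
  | .form A => A
  | .eps => .one
  | .delta => .top
  | .comma G D => .tensor G.toFormula D.toFormula
  | .semi G D => .and G.toFormula D.toFormula

/-- A numeral for a variable begins at position `k` of the word `w`. -/
def Occ (w : List Token) (k : ℕ) (l : List Bool) : Prop :=
  ∃ u v, w = u ++ (l.map Token.bit ++ Token.var :: v) ∧ k = l.length + 1 + v.length

theorem Occ.cons {w : List Token} {k : ℕ} {l : List Bool} (h : Occ w k l) (t : Token) :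
    Occ (t :: w) k l := by
  obtain ⟨u, v, rfl, rfl⟩ := h
  exact ⟨t :: u, v, by simp, rfl⟩

/-- Numerals have their least significant bit first, so a numeral read from right to left grows at
its low end. The excluded case is a leading zero: the numeral of `0` is empty. -/
theorem encodeNat_bit (b : Bool) (i : ℕ) (h : i ≠ 0 ∨ b = true) :
    Computability.encodeNat (Nat.bit b i) = b :: Computability.encodeNat i := by
  unfold Computability.encodeNat
  rw [← Num.ofNat'_eq, ← Num.ofNat'_eq, Num.ofNat'_bit]
  rcases hn : Num.ofNat' i with _ | n
  · have h0 : i = 0 := by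
      rw [Num.ofNat'_eq] at hn
      have := congrArg (fun n : Num => (n : ℕ)) hn
      simpa using this
    obtain rfl : b = true := by tauto
    rfl
  · cases b <;> rfl

/-! ### The invariant of a successful parse. -/

/-- What is known about the nodes of the parse of `w`. -/
structure Node.Sound (w : List Token) (N : List (Node (ℕ × Formula))) (n : Node (ℕ × Formula)) :
    Prop where
  formula : n.own.2 = dn n.kind n.fst.2 n.snd.2
  fst : 1 ≤ n.kind.arity → n.fst.1 < n.own.1 ∧ ∃ n' ∈ N, n'.own = n.fst
  snd : 2 ≤ n.kind.arity → n.snd.1 < n.own.1 ∧ ∃ n' ∈ N, n'.own = n.snd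
  numeral : (n.kind = .var ∨ ∃ b, n.kind = .bit b) → ∃ i, n.own.2 = .var i ∧
    Occ w n.own.1 (Computability.encodeNat i)
  token : ∃ u v, w = u ++ n.kind :: v ∧ n.own.1 = v.length + 1

theorem Node.Sound.cons {w : List Token} {N : List (Node (ℕ × Formula))} {n : Node (ℕ × Formula)}
    (h : n.Sound w N) (t : Token) (m : Node (ℕ × Formula)) : n.Sound (t :: w) (m :: N) :=
  ⟨h.formula, fun ha => ⟨(h.fst ha).1, by
      obtain ⟨n', h1, h2⟩ := (h.fst ha).2; exact ⟨n', List.mem_cons_of_mem _ h1, h2⟩⟩,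
    fun ha => ⟨(h.snd ha).1, by
      obtain ⟨n', h1, h2⟩ := (h.snd ha).2; exact ⟨n', List.mem_cons_of_mem _ h1, h2⟩⟩,
    fun ha => by obtain ⟨i, h1, h2⟩ := h.numeral ha; exact ⟨i, h1, h2.cons t⟩,
    by obtain ⟨u, v, h1, h2⟩ := h.token; exact ⟨t :: u, v, by rw [h1]; rfl, h2⟩⟩

/-- The numbers `n, n - 1, …, 1`. -/
def countdown : ℕ → List ℕ
  | 0 => []
  | n + 1 => (n + 1) :: countdown n

theorem mem_countdown {n k : ℕ} : k ∈ countdown n ↔ 1 ≤ k ∧ k ≤ n := by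
  induction n with
  | zero => simp [countdown]; omega
  | succ n ih => simp only [countdown, List.mem_cons, ih]; omega

theorem nodup_countdown (n : ℕ) : (countdown n).Nodup := by
  induction n with
  | zero => simp [countdown]
  | succ n ih => simp only [countdown, List.nodup_cons, ih, mem_countdown]; simp

/-- What is known about a successful parse of `w`. -/
structure PState.Sound (w : List Token) (s : PState (ℕ × Formula)) : Prop where
  own : s.nodes.map (fun n => n.own.1) = countdown w.length
  sound : ∀ n ∈ s.nodes, n.Sound w s.nodes
  item : ∀ i ∈ s.stack, ∃ n ∈ s.nodes, n.own = i.2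
  numeral : ∀ i st, s.stack = i :: st → (i.1 = .fresh → i.2 = (w.length, .var 0) ∧ Occ w w.length []) ∧
    (i.1 = .name → ∃ j, j ≠ 0 ∧ i.2 = (w.length, .var j) ∧
      Occ w w.length (Computability.encodeNat j))

theorem PState.step_ok {α : Type} {t : Token} {o : α} {s : PState α} (h : (s.step t o).ok = true) :
    s.ok = true := by
  unfold PState.step PState.reduce at h
  grind

theorem PState.Sound.push {w : List Token} {s : PState (ℕ × Formula)} (h : s.Sound w) {t : Token}
    {n : Node (ℕ × Formula)} (ho : n.own.1 = w.length + 1) (hn : n.Sound (t :: w) (n :: s.nodes))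
    {ok ph : Bool} {z : Srt} {st : List (Srt × (ℕ × Formula))} (hst : ∀ i ∈ st, i ∈ s.stack)
    (h₁ : z = .fresh → n.own.2 = .var 0 ∧ Occ (t :: w) (w.length + 1) [])
    (h₂ : z = .name → ∃ j, j ≠ 0 ∧ n.own.2 = .var j ∧
      Occ (t :: w) (w.length + 1) (Computability.encodeNat j)) :
    PState.Sound (t :: w) ⟨ok, ph, (z, n.own) :: st, n :: s.nodes⟩ := by
  refine ⟨?_, ?_, ?_, ?_⟩
  · simp [h.own, ho, countdown]
  · intro m hm
    rcases List.mem_cons.1 hm with rfl | hm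
    · exact hn
    · exact (h.sound m hm).cons _ _
  · intro i hi
    rcases List.mem_cons.1 hi with rfl | hi
    · exact ⟨n, by simp, rfl⟩
    · obtain ⟨m, hm, e⟩ := h.item i (hst i hi)
      exact ⟨m, List.mem_cons_of_mem _ hm, e⟩
  · rintro i st' e
    obtain ⟨rfl, rfl⟩ := List.cons.inj e
    refine ⟨fun hz => ⟨Prod.ext ho (h₁ hz).1, (h₁ hz).2⟩, fun hz => ?_⟩
    obtain ⟨j, h3, h4, h5⟩ := h₂ hz
    exact ⟨j, h3, Prod.ext ho h4, h5⟩

theorem PState.Sound.drop {w : List Token} {s : PState (ℕ × Formula)} (h : s.Sound w) {t : Token}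
    {n : Node (ℕ × Formula)} (ho : n.own.1 = w.length + 1) (hn : n.Sound (t :: w) (n :: s.nodes))
    {ok ph : Bool} : PState.Sound (t :: w) ⟨ok, ph, [], n :: s.nodes⟩ := by
  refine ⟨?_, ?_, ?_, ?_⟩
  · simp [h.own, ho, countdown]
  · intro m hm
    rcases List.mem_cons.1 hm with rfl | hm
    · exact hn
    · exact (h.sound m hm).cons _ _
  · simp
  · simp

theorem PState.Sound.arg {w : List Token} {s : PState (ℕ × Formula)} (h : s.Sound w)
    {i : Srt × (ℕ × Formula)} (hi : i ∈ s.stack) (n : Node (ℕ × Formula)) :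
    i.2.1 < w.length + 1 ∧ ∃ n' ∈ n :: s.nodes, n'.own = i.2 := by
  obtain ⟨m, hm, e⟩ := h.item i hi
  have : m.own.1 ∈ countdown w.length := by
    rw [← h.own]; exact List.mem_map_of_mem hm
  rw [mem_countdown, e] at this
  exact ⟨by omega, m, List.mem_cons_of_mem _ hm, e⟩

/-- Collects the features of the grammar on which the invariant depends, so that its proof need not
distinguish all tokens. -/
theorem rule_spec {t : Token} {ph ph' e : Bool} {x y r : Option Srt}
    (h : rule t ph x y e = some (ph', r)) :
    (r = none → e = true) ∧ (1 ≤ t.arity → x ≠ none) ∧ (2 ≤ t.arity → y ≠ none) ∧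
    (r = some .fresh → t = .var) ∧ (r = some .name → ∃ b, t = .bit b) ∧
    (∀ b, t = .bit b → x = some .fresh ∧ b = true ∨ x = some .name) := by
  cases t <;> simp only [rule, Token.arity, Option.ite_none_right_eq_some, Option.some.injEq,
    Prod.mk.injEq] at h ⊢ <;>
  grind [Srt.isForm, Srt.isBunch]

/-- Argument slots beyond the arity hold whatever default or stack content happens to be there; the
formula of a node must not depend on them. -/
theorem dn_congr {t : Token} {A A' B B' : Formula} (h₁ : 1 ≤ t.arity → A = A')
    (h₂ : 2 ≤ t.arity → B = B') : dn t A B = dn t A' B' := by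
  cases t <;> simp [Token.arity] at h₁ h₂ <;> subst_vars <;> try rfl
  cases A' <;> rfl

/-- For numerals only the top of the stack has to be tracked: an item that a token leaves on top
begins at that very token, and a token that leaves none requires an empty stack below its arguments.
-/
theorem PState.Sound.reduce {w : List Token} {s : PState (ℕ × Formula)} (h : s.Sound w) {t : Token}
    {o : ℕ × Formula} {x y : Option (Srt × (ℕ × Formula))} {st : List (Srt × (ℕ × Formula))}
    (ho : o.1 = w.length + 1)
    (hx : ∀ i, x = some i → s.stack.head? = some i) (hy : ∀ i, y = some i → i ∈ s.stack)
    (hst : ∀ i ∈ st, i ∈ s.stack)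
    (hd : o.2 = dn t ((x.map fun i => i.2.2).getD .top) ((y.map fun i => i.2.2).getD .top))
    (hok : (s.reduce t o x y st).ok = true) : (s.reduce t o x y st).Sound (t :: w) := by
  unfold PState.reduce at hok ⊢
  rcases hr : rule t s.past (x.map Prod.fst) (y.map Prod.fst) st.isEmpty with _ | ⟨ph, r⟩
  · simp [hr] at hok
  obtain ⟨h1, h2, h3, h4, h5, h6⟩ := rule_spec hr
  have hx' : ∀ i, x = some i → i ∈ s.stack := fun i hi => List.mem_of_mem_head? (hx i hi)
  have hnum : t = .var ∨ (∃ b, t = .bit b) → ∃ j, o.2 = .var j ∧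
      Occ (t :: w) o.1 (Computability.encodeNat j) ∧ (t ≠ .var → j ≠ 0) := by
    rintro (rfl | ⟨b, rfl⟩)
    · exact ⟨0, by rw [hd]; rfl, ⟨[], w, rfl, by rw [ho, Nat.add_comm]; rfl⟩, by simp⟩
    · have key : ∀ i j, x = some i → i.2 = (w.length, .var j) → (j ≠ 0 ∨ b = true) →
          Occ w w.length (Computability.encodeNat j) →
          ∃ j, o.2 = .var j ∧ Occ (.bit b :: w) o.1 (Computability.encodeNat j) ∧
          (Token.bit b ≠ .var → j ≠ 0) := by
        intro i j hi e hb hocc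
        refine ⟨Nat.bit b j, ?_, ?_, ?_⟩
        · rw [hd, hi]; simp [e, dn]
        · obtain ⟨u, v, e1, e2⟩ := hocc
          -- An occurrence at position `w.length` begins with the first token of `w`, so the new bit
          -- can be put directly in front of it.
          have hu : u = [] := by
            have := congrArg List.length e1
            simp at this
            exact List.eq_nil_of_length_eq_zero (by omega)
          subst hu
          rw [encodeNat_bit _ _ hb]
          refine ⟨[], v, ?_, ?_⟩
          · rw [e1]; simp
          · rw [ho, e2]; simp; omega
        · intro _ h0
          rcases hb with hb | rfl
          · cases b <;> simp [Nat.bit] at h0 <;> omega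
          · simp [Nat.bit] at h0
      have hsx : ∀ i, x = some i → ∃ st', s.stack = i :: st' := by
        intro i hi
        have := hx i hi
        rcases hs : s.stack with _ | ⟨i', st'⟩
        · simp [hs] at this
        · simp [hs] at this
          exact ⟨st', by rw [this]⟩
      rcases h6 b rfl with ⟨h7, h8⟩ | h7
      · obtain ⟨i, hi, hi'⟩ := Option.map_eq_some_iff.1 h7
        obtain ⟨st', e⟩ := hsx i hi
        obtain ⟨e1, e2⟩ := (h.numeral i st' e).1 hi'
        exact key i 0 hi e1 (Or.inr h8) e2
      · obtain ⟨i, hi, hi'⟩ := Option.map_eq_some_iff.1 h7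
        obtain ⟨st', e⟩ := hsx i hi
        obtain ⟨j, e0, e1, e2⟩ := (h.numeral i st' e).2 hi'
        exact key i j hi e1 (Or.inl e0) e2
  set n : Node (ℕ × Formula) :=
    ⟨t, s.past, o, (x.map Prod.snd).getD o, (y.map Prod.snd).getD o⟩ with hn
  have hS : n.Sound (t :: w) (n :: s.nodes) := by
    refine ⟨?_, ?_, ?_, ?_, [], w, rfl, ho⟩
    · change o.2 = dn t _ _
      rw [hd]
      refine dn_congr (fun ha => ?_) fun ha => ?_
      · rcases x with _ | i
        · exact absurd rfl (h2 ha)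
        · rfl
      · rcases y with _ | i
        · exact absurd rfl (h3 ha)
        · rfl
    · intro ha
      rcases x with _ | i
      · exact absurd rfl (h2 ha)
      · have := h.arg (hx' i rfl) n
        exact ⟨by change i.2.1 < o.1; rw [ho]; exact this.1, this.2⟩
    · intro ha
      rcases y with _ | i
      · exact absurd rfl (h3 ha)
      · have := h.arg (hy i rfl) n
        exact ⟨by change i.2.1 < o.1; rw [ho]; exact this.1, this.2⟩
    · intro ha
      obtain ⟨j, e1, e2, -⟩ := hnum ha
      exact ⟨j, e1, e2⟩
  rcases r with _ | z
  · have he := List.isEmpty_iff.1 (h1 rfl)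
    subst he
    exact h.drop ho hS
  · refine h.push ho hS hst ?_ ?_
    · rintro rfl
      obtain rfl := h4 rfl
      exact ⟨by change o.2 = _; rw [hd]; rfl, ⟨[], w, rfl, by rw [Nat.add_comm]; rfl⟩⟩
    · rintro rfl
      obtain ⟨j, e1, e2, e3⟩ := hnum (Or.inr (h5 rfl))
      obtain ⟨b, rfl⟩ := h5 rfl
      exact ⟨j, e3 (by simp), e1, ho ▸ e2⟩

theorem parse_sound : ∀ w, (parse w).ok = true → (parse w).Sound w
  | [], _ => ⟨rfl, by simp [parse, PState.init], by simp [parse, PState.init],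
      by simp [parse, PState.init]⟩
  | t :: w, h => by
    have hs := parse_sound w (PState.step_ok h)
    simp only [parse] at h ⊢
    unfold PState.step at h ⊢
    rcases ha : t.arity with _ | _ | _ <;> simp only [ha] at h ⊢ <;>
      refine hs.reduce rfl ?_ ?_ ?_ ?_ h
    all_goals
      first
      | (simp; done)
      | exact fun i hi => hi
      | exact fun i hi => List.mem_of_mem_tail hi
      | exact fun i hi => List.mem_of_mem_tail (List.mem_of_mem_tail hi)
      | exact fun i hi => List.mem_of_mem_tail (List.mem_of_mem_head? hi)
      | refine dn_congr (fun h => ?_) fun h => ?_ <;>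
          first
          | omega
          | (rcases (parse w).stack with _ | ⟨a, _ | ⟨b, l⟩⟩ <;> rfl)

/-! ### The words that the parser accepts -/

/-- Reading the code of a formula or of a bunch puts one item on the stack. -/
def Reads (v : List Token) (p : Option Srt → Bool) (A : Formula) : Prop :=
  ∀ w, ∃ z N, p (some z) = true ∧ (∀ n ∈ N, n.kind ≠ Token.sequent) ∧
    parse (v ++ w) = ⟨(parse w).ok, (parse w).past,
      (z, ((v ++ w).length, A)) :: (parse w).stack, N ++ (parse w).nodes⟩

theorem Reads.leaf {t : Token} {p : Option Srt → Bool} {z : Srt} (hz : p (some z) = true)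
    (ht : t ≠ .sequent) (h0 : t.arity = 0) (hr : ∀ ph x y e, rule t ph x y e = some (ph, some z)) :
    Reads [t] p (dn t .top .top) := by
  intro w
  refine ⟨z, [⟨t, (parse w).past, (w.length + 1, dn t .top .top), (w.length + 1, dn t .top .top),
    (w.length + 1, dn t .top .top)⟩], hz, by simpa using ht, ?_⟩
  simp only [List.cons_append, List.nil_append, parse, PState.step, h0, PState.reduce, hr]
  rw [dn_congr (A' := .top) (B' := .top) (by omega) (by omega)]
  rfl

theorem Reads.unary {t : Token} {p q : Option Srt → Bool} {z : Srt} {v : List Token} {A : Formula}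
    (hv : Reads v p A) (hz : q (some z) = true) (ht : t ≠ .sequent) (h0 : t.arity = 1)
    (hr : ∀ ph x y e, p x = true → rule t ph x y e = some (ph, some z)) :
    Reads (t :: v) q (dn t A .top) := by
  intro w
  obtain ⟨z', N, h1, h2, h3⟩ := hv w
  refine ⟨z, ⟨t, (parse w).past, ((v ++ w).length + 1, dn t A .top), ((v ++ w).length, A),
    ((v ++ w).length + 1, dn t A .top)⟩ :: N, hz, by simpa [ht] using h2, ?_⟩
  simp only [List.cons_append, parse, PState.step, h0, PState.reduce, h3]
  simp only [List.head?_cons, Option.map_some, hr _ _ _ _ h1, itemFormula]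
  rw [dn_congr (A' := A) (B' := .top) (by simp) (by omega)]
  rfl

theorem Reads.binary {t : Token} {p q r : Option Srt → Bool} {z : Srt} {u v : List Token}
    {A B : Formula} (hu : Reads u p A) (hv : Reads v r B) (hz : q (some z) = true)
    (ht : t ≠ .sequent) (h0 : t.arity = 2)
    (hr : ∀ ph x y e, p x = true → r y = true → rule t ph x y e = some (ph, some z)) :
    Reads (t :: (u ++ v)) q (dn t A B) := by
  intro w
  obtain ⟨z', N, h1, h2, h3⟩ := hv w
  obtain ⟨z'', N', h1', h2', h3'⟩ := hu (v ++ w)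
  refine ⟨z, ⟨t, (parse w).past, ((u ++ (v ++ w)).length + 1, dn t A B),
    ((u ++ (v ++ w)).length, A), ((v ++ w).length, B)⟩ :: (N' ++ N), hz, ?_, ?_⟩
  · simpa [ht, or_imp, forall_and] using ⟨h2', h2⟩
  · rw [List.cons_append, List.append_assoc]
    simp only [parse, PState.step, h0, PState.reduce, h3', h3]
    simp only [List.head?_cons, List.tail_cons, Option.map_some, hr _ _ _ _ h1' h1, itemFormula]
    simp

theorem Reads.mono {v : List Token} {p q : Option Srt → Bool} {A : Formula} (h : Reads v p A)
    (hpq : ∀ z, p z = true → q z = true) : Reads v q A := by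
  intro w
  obtain ⟨z, N, h1, h2, h3⟩ := h w
  exact ⟨z, N, hpq _ h1, h2, h3⟩

/-- Induction on the index by removing its lowest bit. The base is the numeral of `1`, since the
highest bit of a nonzero number is `true`, as `rule` demands after a `fresh` item. -/
theorem reads_numeral (i : ℕ) (hi : i ≠ 0) :
    Reads (Formula.encode (.var i)) (fun z => decide (z = some .name)) (.var i) := by
  induction i using Nat.strong_induction_on with
  | _ i ih =>
    obtain ⟨b, j, rfl⟩ : ∃ b j, i = Nat.bit b j := ⟨i.bodd, i.div2, (Nat.bit_bodd_div2 i).symm⟩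
    by_cases hj : j = 0
    · subst hj
      obtain rfl : b = true := by
        cases b
        · simp at hi
        · rfl
      have e : Formula.encode (.var (Nat.bit true 0)) = [.bit true, .var] := rfl
      rw [e]
      exact (Reads.leaf (t := .var) (p := fun z => decide (z = some .fresh)) (z := .fresh) rfl
        (by simp) rfl fun _ _ _ _ => rfl).unary (z := .name) (t := .bit true) rfl (by simp) rfl
        fun ph x y e hx => by simp at hx; simp [rule, hx]
    · have hlt : j < Nat.bit b j := by cases b <;> simp [Nat.bit] <;> omega
      have e : Formula.encode (.var (Nat.bit b j)) = .bit b :: Formula.encode (.var j) := by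
        simp [Formula.encode, encodeNat_bit b j (Or.inl hj)]
      rw [e]
      exact (ih j hlt hj).unary (z := .name) (t := .bit b) rfl (by simp) rfl
        fun ph x y e hx => by simp at hx; simp [rule, hx]

theorem Formula.reads : ∀ A : Formula, Reads A.encode Srt.isForm A
  | .var i => by
    by_cases hi : i = 0
    · subst hi
      exact Reads.leaf (t := .var) (z := .fresh) rfl (by simp) rfl fun _ _ _ _ => rfl
    · refine (reads_numeral i hi).mono fun z hz => ?_
      simp at hz
      rw [hz]; rfl
  | .one => Reads.leaf (t := .one) (z := .form) rfl (by simp) rfl fun _ _ _ _ => rfl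
  | .top => Reads.leaf (t := .top) (z := .form) rfl (by simp) rfl fun _ _ _ _ => rfl
  | .bot => Reads.leaf (t := .bot) (z := .form) rfl (by simp) rfl fun _ _ _ _ => rfl
  | .neg A => (Formula.reads A).unary (t := .neg) (z := .form) rfl (by simp) rfl
      fun _ _ _ _ h => by simp [rule, h]
  | .tensor A B => (Formula.reads A).binary (Formula.reads B) (t := .tensor) (z := .form) rfl
      (by simp) rfl fun _ _ _ _ h h' => by simp [rule, h, h']
  | .under A B => (Formula.reads A).binary (Formula.reads B) (t := .under) (z := .form) rfl
      (by simp) rfl fun _ _ _ _ h h' => by simp [rule, h, h']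
  | .over A B => (Formula.reads A).binary (Formula.reads B) (t := .over) (z := .form) rfl
      (by simp) rfl fun _ _ _ _ h h' => by simp [rule, h, h']
  | .and A B => (Formula.reads A).binary (Formula.reads B) (t := .and) (z := .form) rfl
      (by simp) rfl fun _ _ _ _ h h' => by simp [rule, h, h']
  | .or A B => (Formula.reads A).binary (Formula.reads B) (t := .or) (z := .form) rfl
      (by simp) rfl fun _ _ _ _ h h' => by simp [rule, h, h']

theorem Srt.isBunch_of_isForm (z : Option Srt) (h : Srt.isForm z = true) :
    Srt.isBunch z = true := by
  rcases z with _ | _ | _ <;> simp_all [Srt.isForm, Srt.isBunch]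

theorem Bunch.reads : ∀ G : Bunch, Reads G.encode Srt.isBunch G.toFormula
  | .form A => A.reads.mono Srt.isBunch_of_isForm
  | .eps => Reads.leaf (t := .eps) (z := .bunch) rfl (by simp) rfl fun _ _ _ _ => rfl
  | .delta => Reads.leaf (t := .delta) (z := .bunch) rfl (by simp) rfl fun _ _ _ _ => rfl
  | .comma G D => (Bunch.reads G).binary (Bunch.reads D) (t := .comma) (z := .bunch) rfl
      (by simp) rfl fun _ _ _ _ h h' => by simp [rule, h, h']
  | .semi G D => (Bunch.reads G).binary (Bunch.reads D) (t := .semi) (z := .bunch) rfl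
      (by simp) rfl fun _ _ _ _ h h' => by simp [rule, h, h']

/-- The node `n` comes from the sequent `s`. -/
def Node.IsSequent (n : Node (ℕ × Formula)) (past : Bool) (s : Sequent) : Prop :=
  n.kind = .sequent ∧ n.past = past ∧ n.fst.2 = s.ant.toFormula ∧ n.snd.2 = s.suc

/-- The empty stack is needed because a token `sequent` is admitted only if nothing lies below its
two arguments. -/
theorem Sequent.reads (s : Sequent) (w : List Token) (hok : (parse w).ok = true)
    (hst : (parse w).stack = []) : ∃ n N, n.IsSequent (parse w).past s ∧
      (∀ n ∈ N, n.kind ≠ Token.sequent) ∧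
      (parse (s.encode ++ w)).ok = true ∧ (parse (s.encode ++ w)).past = (parse w).past ∧
      (parse (s.encode ++ w)).stack.map Prod.fst = (if (parse w).past then [] else [.seq]) ∧
      (parse (s.encode ++ w)).nodes = n :: (N ++ (parse w).nodes) := by
  obtain ⟨z, N, h1, h2, h3⟩ := s.suc.reads w
  obtain ⟨z', N', h1', h2', h3'⟩ := s.ant.reads (s.suc.encode ++ w)
  have e : s.encode ++ w = .sequent :: (s.ant.encode ++ (s.suc.encode ++ w)) := by
    simp [Sequent.encode]
  rw [e]
  refine ⟨⟨.sequent, (parse w).past, ((s.ant.encode ++ (s.suc.encode ++ w)).length + 1, .top),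
    ((s.ant.encode ++ (s.suc.encode ++ w)).length, s.ant.toFormula),
    ((s.suc.encode ++ w).length, s.suc)⟩, N' ++ N, ⟨rfl, rfl, rfl, rfl⟩, ?_, ?_⟩
  · simpa [or_imp, forall_and] using ⟨h2', h2⟩
  · simp only [parse, PState.step, Token.arity, PState.reduce, h3', h3]
    simp only [List.head?_cons, List.tail_cons, Option.map_some, hst, rule, h1, h1',
      List.isEmpty_nil, and_self, if_true, hok]
    cases (parse w).past <;> simp [dn]

/-- What is known about the parse of the code of an instance. -/
structure PState.IsInstance (s : PState (ℕ × Formula)) (Φ : List Sequent) (g : Sequent) : Prop where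
  ok : s.ok = true
  past : s.past = true
  stack : s.stack = []
  hyp : ∀ t ∈ Φ, ∃ n ∈ s.nodes, n.IsSequent true t
  hyp' : ∀ n ∈ s.nodes, n.kind = .sequent → n.past = true → ∃ t ∈ Φ, n.IsSequent true t
  goal : ∃ n ∈ s.nodes, n.IsSequent false g
  goal' : ∀ n ∈ s.nodes, n.kind = .sequent → n.past = false → n.IsSequent false g

/-- Reading from the right meets the goal first, then the turnstile, which switches the phase, then
the hypotheses from last to first. Hence an induction on `Φ` with the bare goal as its base. -/
theorem parse_encodeInstance (g : Sequent) :
    ∀ Φ : List Sequent, (parse (encodeInstance Φ g)).IsInstance Φ g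
  | [] => by
    obtain ⟨n, N, h1, h2, h3, h4, h5, h6⟩ := g.reads [] rfl rfl
    rw [List.append_nil] at h3 h4 h5 h6
    change _ = [Srt.seq] at h5
    obtain ⟨i, hi⟩ : ∃ i, (parse g.encode).stack = [(.seq, i)] := by
      rcases hs : (parse g.encode).stack with _ | ⟨⟨z, i⟩, _ | _⟩ <;> simp_all
    have e : ∃ m, m.kind = Token.turnstile ∧ parse (encodeInstance [] g) =
        ⟨true, true, [], m :: n :: (N ++ (parse []).nodes)⟩ := by
      refine ⟨⟨.turnstile, false, (g.encode.length + 1, .top), i, (g.encode.length + 1, .top)⟩,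
        rfl, ?_⟩
      simp only [encodeInstance, List.flatMap_nil, List.nil_append, parse, PState.step, Token.arity,
        PState.reduce, hi]
      simp [rule, h4, h3, h6, dn, parse, PState.init]
    obtain ⟨m, hm, e⟩ := e
    rw [e]
    change (PState.mk true true [] (m :: n :: (N ++ []))).IsInstance [] g
    rw [List.append_nil]
    have hp : n.past = false := h1.2.1
    refine ⟨rfl, rfl, rfl, by simp, ?_, ⟨n, by simp, h1⟩, ?_⟩
    · intro k hk hk1 hk2
      simp only [List.mem_cons] at hk
      rcases hk with rfl | rfl | hk
      · simp [hm] at hk1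
      · simp [hp] at hk2
      · exact absurd hk1 (h2 k hk)
    · intro k hk hk1 hk2
      simp only [List.mem_cons] at hk
      rcases hk with rfl | rfl | hk
      · simp [hm] at hk1
      · exact h1
      · exact absurd hk1 (h2 k hk)
  | t :: Φ => by
    have ih := parse_encodeInstance g Φ
    obtain ⟨n, N, h1, h2, h3, h4, h5, h6⟩ := t.reads (encodeInstance Φ g) ih.ok ih.stack
    have e : encodeInstance (t :: Φ) g = t.encode ++ encodeInstance Φ g := by
      simp [encodeInstance]
    rw [ih.past] at h1 h4 h5
    rw [e]
    refine ⟨h3, h4, by simpa using h5, ?_, ?_, ?_, ?_⟩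
    · intro s hs
      rw [h6]
      rcases List.mem_cons.1 hs with rfl | hs
      · exact ⟨n, by simp, h1⟩
      · obtain ⟨k, hk, hk'⟩ := ih.hyp s hs
        exact ⟨k, by simp [hk], hk'⟩
    · intro k hk hk1 hk2
      rw [h6] at hk
      simp only [List.mem_cons, List.mem_append] at hk
      rcases hk with rfl | hk | hk
      · exact ⟨t, by simp, h1⟩
      · exact absurd hk1 (h2 k hk)
      · obtain ⟨s, hs, hs'⟩ := ih.hyp' k hk hk1 hk2
        exact ⟨s, by simp [hs], hs'⟩
    · obtain ⟨k, hk, hk'⟩ := ih.goal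
      exact ⟨k, by rw [h6]; simp [hk], hk'⟩
    · intro k hk hk1 hk2
      rw [h6] at hk
      simp only [List.mem_cons, List.mem_append] at hk
      rcases hk with rfl | hk | hk
      · have := h1.2.1
        simp [hk2] at this
      · exact absurd hk1 (h2 k hk)
      · exact ih.goal' k hk hk1 hk2

/-- The words that an item of a given sort stands for. -/
def Srt.Codes : Srt → List Token → Prop
  | .fresh, l => l = [.var]
  | .name, l => ∃ i, i ≠ 0 ∧ l = Formula.encode (.var i)
  | .form, l => ∃ A : Formula, l = A.encode
  | .bunch, l => ∃ G : Bunch, l = G.encode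
  | .seq, l => ∃ s : Sequent, l = s.encode

theorem Srt.Codes.formula {z : Srt} {l : List Token} (h : z.Codes l)
    (hz : Srt.isForm (some z) = true) : ∃ A : Formula, l = A.encode := by
  cases z
  · exact ⟨.var 0, h⟩
  · obtain ⟨i, -, h⟩ := h; exact ⟨_, h⟩
  · exact h
  · simp [Srt.isForm] at hz
  · simp [Srt.isForm] at hz

theorem Srt.Codes.toBunch {z : Srt} {l : List Token} (h : z.Codes l)
    (hz : Srt.isBunch (some z) = true) : ∃ G : Bunch, l = G.encode := by
  by_cases hf : Srt.isForm (some z) = true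
  · obtain ⟨A, rfl⟩ := h.formula hf
    exact ⟨.form A, rfl⟩
  · cases z <;> simp_all [Srt.isForm, Srt.isBunch, Srt.Codes]

theorem rule_codes {t : Token} {ph ph' e : Bool} {x y : Option Srt} {z : Srt} {u v : List Token}
    (h : rule t ph x y e = some (ph', some z)) (hu : ∀ x', x = some x' → x'.Codes u)
    (hv : ∀ y', y = some y' → y'.Codes v) : ph' = ph ∧
    z.Codes (t :: ((if 1 ≤ t.arity then u else []) ++ (if 2 ≤ t.arity then v else []))) := by
  have hu' : Srt.isForm x = true → ∃ A : Formula, u = A.encode := by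
    rcases x with _ | x
    · simp [Srt.isForm]
    · exact (hu x rfl).formula
  have hv' : Srt.isForm y = true → ∃ A : Formula, v = A.encode := by
    rcases y with _ | y
    · simp [Srt.isForm]
    · exact (hv y rfl).formula
  have hu'' : Srt.isBunch x = true → ∃ G : Bunch, u = G.encode := by
    rcases x with _ | x
    · simp [Srt.isBunch]
    · exact (hu x rfl).toBunch
  have hv'' : Srt.isBunch y = true → ∃ G : Bunch, v = G.encode := by
    rcases y with _ | y
    · simp [Srt.isBunch]
    · exact (hv y rfl).toBunch
  cases t <;> simp only [rule, Option.ite_none_right_eq_some, Option.some.injEq,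
    Prod.mk.injEq] at h <;> simp [Token.arity]
  case bit b =>
    obtain ⟨h, rfl, rfl⟩ := h
    refine ⟨rfl, ?_⟩
    rcases h with ⟨rfl, rfl⟩ | rfl
    · exact ⟨1, by simp, by rw [show u = [.var] from hu _ rfl]; rfl⟩
    · obtain ⟨i, hi, rfl⟩ := hu _ rfl
      exact ⟨Nat.bit b i, by simp [Nat.bit_eq_zero_iff, hi], by simp [Formula.encode, encodeNat_bit b i (Or.inl hi)]⟩
  case var => obtain ⟨rfl, rfl⟩ := h; exact ⟨rfl, rfl⟩
  case one => obtain ⟨rfl, rfl⟩ := h; exact ⟨rfl, .one, rfl⟩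
  case top => obtain ⟨rfl, rfl⟩ := h; exact ⟨rfl, .top, rfl⟩
  case bot => obtain ⟨rfl, rfl⟩ := h; exact ⟨rfl, .bot, rfl⟩
  case eps => obtain ⟨rfl, rfl⟩ := h; exact ⟨rfl, .eps, rfl⟩
  case delta => obtain ⟨rfl, rfl⟩ := h; exact ⟨rfl, .delta, rfl⟩
  case neg =>
    obtain ⟨h, rfl, rfl⟩ := h
    obtain ⟨A, rfl⟩ := hu' h
    exact ⟨rfl, .neg A, rfl⟩
  case comma =>
    obtain ⟨h, rfl, rfl⟩ := h
    obtain ⟨A, rfl⟩ := hu'' h.1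
    obtain ⟨B, rfl⟩ := hv'' h.2
    exact ⟨rfl, .comma A B, rfl⟩
  case semi =>
    obtain ⟨h, rfl, rfl⟩ := h
    obtain ⟨A, rfl⟩ := hu'' h.1
    obtain ⟨B, rfl⟩ := hv'' h.2
    exact ⟨rfl, .semi A B, rfl⟩
  case sequent =>
    obtain ⟨h, rfl, hz⟩ := h
    obtain ⟨A, rfl⟩ := hu'' h.1
    obtain ⟨B, rfl⟩ := hv' h.2.1
    cases ph <;> simp at hz
    subst hz
    exact ⟨rfl, ⟨A, B⟩, rfl⟩
  case turnstile => simp at h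
  all_goals
    obtain ⟨h, rfl, rfl⟩ := h
    obtain ⟨A, rfl⟩ := hu' h.1
    obtain ⟨B, rfl⟩ := hv' h.2
    refine ⟨rfl, ?_⟩
    first
    | exact ⟨.tensor A B, rfl⟩
    | exact ⟨.under A B, rfl⟩
    | exact ⟨.over A B, rfl⟩
    | exact ⟨.and A B, rfl⟩
    | exact ⟨.or A B, rfl⟩

theorem rule_none {t : Token} {ph ph' e : Bool} {x y : Option Srt}
    (h : rule t ph x y e = some (ph', none)) : ph' = true ∧ e = true ∧
    (t = .sequent ∧ ph = true ∧ Srt.isBunch x = true ∧ Srt.isForm y = true ∨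
      t = .turnstile ∧ ph = false ∧ x = some .seq) := by
  cases t <;> simp only [rule, Option.ite_none_right_eq_some, Option.some.injEq,
    Prod.mk.injEq] at h <;> grind

/-- The converse invariant: the word read so far consists of the words that the stack items stand
for, top item first, followed by a finished instance, or by nothing while the turnstile has not been
met. At acceptance the stack is empty and only the instance remains. -/
theorem parse_codes : ∀ w, (parse w).ok = true → ∃ ls v, w = ls.flatten ++ v ∧
    List.Forall₂ (fun i l => Srt.Codes i.1 l) (parse w).stack ls ∧
    ((parse w).past = false ∧ v = [] ∨
      (parse w).past = true ∧ ∃ Φ s, v = encodeInstance Φ s)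
  | [], _ => ⟨[], [], rfl, .nil, Or.inl ⟨rfl, rfl⟩⟩
  | t :: w, h => by
    obtain ⟨ls, v, hw, hls, hv⟩ := parse_codes w (PState.step_ok h)
    have key : ∀ (o : ℕ × Formula) (x y : Option (Srt × (ℕ × Formula))) st lx ly ls',
        (∀ i, x = some i → i.1.Codes lx) → (∀ i, y = some i → i.1.Codes ly) →
        w = ((if 1 ≤ t.arity then lx else []) ++ (if 2 ≤ t.arity then ly else [])) ++
          (ls'.flatten ++ v) →
        List.Forall₂ (fun i l => Srt.Codes i.1 l) st ls' →
        ((parse w).reduce t o x y st).ok = true → ∃ ls v, t :: w = ls.flatten ++ v ∧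
        List.Forall₂ (fun i l => Srt.Codes i.1 l) ((parse w).reduce t o x y st).stack ls ∧
        (((parse w).reduce t o x y st).past = false ∧ v = [] ∨
          ((parse w).reduce t o x y st).past = true ∧ ∃ Φ s, v = encodeInstance Φ s) := by
      intro o x y st lx ly ls' hx hy hw' hls' hok
      unfold PState.reduce at hok ⊢
      rcases hr : rule t (parse w).past (x.map Prod.fst) (y.map Prod.fst) st.isEmpty with
        _ | ⟨ph, _ | z⟩
      · simp [hr] at hok
      · obtain ⟨rfl, he, h1⟩ := rule_none hr
        obtain rfl := List.isEmpty_iff.1 he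
        obtain rfl : ls' = [] := by cases hls'; rfl
        refine ⟨[], t :: w, rfl, .nil, Or.inr ⟨rfl, ?_⟩⟩
        rcases h1 with ⟨rfl, hp, h2, h3⟩ | ⟨rfl, hp, h2⟩
        · rcases x with _ | x
          · simp [Srt.isBunch] at h2
          rcases y with _ | y
          · simp [Srt.isForm] at h3
          obtain ⟨G, rfl⟩ := (hx x rfl).toBunch h2
          obtain ⟨A, rfl⟩ := (hy y rfl).formula h3
          rcases hv with ⟨hv, -⟩ | ⟨-, Φ, s, rfl⟩
          · simp [hp] at hv
          · exact ⟨⟨G, A⟩ :: Φ, s, by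
              rw [hw']; simp [Token.arity, encodeInstance, Sequent.encode]⟩
        · rcases x with _ | x
          · simp at h2
          have := hx x rfl
          simp at h2
          rw [h2] at this
          obtain ⟨s, rfl⟩ := this
          rcases hv with ⟨-, rfl⟩ | ⟨hv, -⟩
          · exact ⟨[], s, by rw [hw']; simp [Token.arity, encodeInstance]⟩
          · simp [hp] at hv
      · obtain ⟨rfl, h1⟩ := rule_codes hr
          (fun x' e => by obtain ⟨i, hi, rfl⟩ := Option.map_eq_some_iff.1 e; exact hx i hi)
          (fun x' e => by obtain ⟨i, hi, rfl⟩ := Option.map_eq_some_iff.1 e; exact hy i hi)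
        exact ⟨_ :: ls', v, by rw [hw']; simp, .cons h1 hls', hv⟩
    simp only [parse] at h ⊢
    have hn : ∀ i : Srt × (ℕ × Formula), none = some i → i.1.Codes [] := by simp
    unfold PState.step at h ⊢
    rcases ha : t.arity with _ | _ | m <;> simp only [ha] at h ⊢ key
    · exact key _ none none _ [] [] ls hn hn (by simp [hw]) hls h
    · generalize (parse w).stack = S at hls h
      cases hls with
      | nil => exact key _ none none _ [] [] [] hn hn (by simp [hw]) .nil h
      | cons h1 h2 =>
        exact key _ _ none _ _ [] _ (by rintro i ⟨⟩; exact h1) hn (by simp [hw]) h2 h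
    · generalize (parse w).stack = S at hls h
      cases hls with
      | nil => exact key _ none none _ [] [] [] hn hn (by simp [hw]) .nil h
      | cons h1 h2 =>
        cases h2 with
        | nil =>
          exact key _ _ none _ _ [] [] (by rintro i ⟨⟩; exact h1) hn (by simp [hw]) .nil h
        | cons h2 h3 =>
          exact key _ _ _ _ _ _ _ (by rintro i ⟨⟩; exact h1) (by rintro i ⟨⟩; exact h2)
            (by simp [hw]) h3 h

theorem exists_eq_encodeInstance {w : List Token} (h : (parse w).accepts = true) :
    ∃ Φ s, w = encodeInstance Φ s := by
  simp only [PState.accepts, Bool.and_eq_true, List.isEmpty_iff] at h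
  obtain ⟨ls, v, rfl, h1, h2⟩ := parse_codes w h.1.1
  rw [h.2] at h1
  cases h1
  rcases h2 with ⟨h2, -⟩ | ⟨-, h2⟩
  · rw [h.1.2] at h2; simp at h2
  · simpa using h2

/-! ### Soundness of BFNL in ternary frames -/

/-- A ternary relation with a set of units. -/
structure Frame (W : Type) : Type where
  rel : W → W → W → Prop
  unit : Set W
  unit_left : ∀ {e x z}, e ∈ unit → rel z e x → z = x
  unit_right : ∀ {e x z}, e ∈ unit → rel z x e → z = x
  exists_left : ∀ x, ∃ e ∈ unit, rel x e x
  exists_right : ∀ x, ∃ e ∈ unit, rel x x e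

namespace Frame

variable {W : Type} (F : Frame W) (val : ℕ → Set W)

/-- The product of two sets of points. -/
def mul (X Y : Set W) : Set W := {z | ∃ x ∈ X, ∃ y ∈ Y, F.rel z x y}

/-- The points at which a formula is true. -/
def eval : Formula → Set W
  | .var i => val i
  | .one => F.unit
  | .top => Set.univ
  | .bot => ∅
  | .neg A => (eval A)ᶜ
  | .tensor A B => F.mul (eval A) (eval B)
  | .under A B => {y | ∀ x z, x ∈ eval A → F.rel z x y → z ∈ eval B}
  | .over A B => {x | ∀ y z, y ∈ eval B → F.rel z x y → z ∈ eval A}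
  | .and A B => eval A ∩ eval B
  | .or A B => eval A ∪ eval B

/-- The points at which a bunch is true. -/
def evalBunch (G : Bunch) : Set W := F.eval val G.toFormula

theorem unit_mul (X : Set W) : F.mul F.unit X = X := by
  ext z
  constructor
  · rintro ⟨e, he, x, hx, h⟩
    rwa [F.unit_left he h]
  · intro hz
    obtain ⟨e, he, h⟩ := F.exists_left z
    exact ⟨e, he, z, hz, h⟩

theorem mul_unit (X : Set W) : F.mul X F.unit = X := by
  ext z
  constructor
  · rintro ⟨x, hx, e, he, h⟩
    rwa [F.unit_right he h]
  · intro hz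
    obtain ⟨e, he, h⟩ := F.exists_right z
    exact ⟨z, hz, e, he, h⟩

theorem evalBunch_equiv {G D : Bunch} (h : Bunch.Equiv G D) :
    F.evalBunch val G = F.evalBunch val D := by
  induction h with
  | refl => rfl
  | symm _ ih => exact ih.symm
  | trans _ _ ih₁ ih₂ => exact ih₁.trans ih₂
  | comma _ _ ih₁ ih₂ =>
    simp only [evalBunch, Bunch.toFormula, eval] at ih₁ ih₂ ⊢
    rw [ih₁, ih₂]
  | semi _ _ ih₁ ih₂ =>
    simp only [evalBunch, Bunch.toFormula, eval] at ih₁ ih₂ ⊢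
    rw [ih₁, ih₂]
  | eps_comma => exact F.unit_mul _
  | comma_eps => exact F.mul_unit _
  | delta_semi => exact Set.univ_inter _
  | semi_delta => exact Set.inter_univ _

theorem evalBunch_fill {D D' : Bunch} (h : F.evalBunch val D ⊆ F.evalBunch val D') :
    ∀ K : Context, F.evalBunch val (K.fill D) ⊆ F.evalBunch val (K.fill D')
  | .hole => h
  | .commaLeft K T => by
    rintro z ⟨x, hx, y, hy, hz⟩
    exact ⟨x, evalBunch_fill h K hx, y, hy, hz⟩
  | .commaRight T K => by
    rintro z ⟨x, hx, y, hy, hz⟩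
    exact ⟨x, hx, y, evalBunch_fill h K hy, hz⟩
  | .semiLeft K T => fun _ hz => ⟨evalBunch_fill h K hz.1, hz.2⟩
  | .semiRight T K => fun _ hz => ⟨hz.1, evalBunch_fill h K hz.2⟩

/-- Products and intersections of sets distribute over unions in each argument, so a disjunction can
be drawn out of the hole. The rule `or_left` needs this. -/
theorem mem_fill_or {A B : Formula} (K : Context) {z : W}
    (h : z ∈ F.evalBunch val (K.fill (.form (.or A B)))) :
    z ∈ F.evalBunch val (K.fill (.form A)) ∨ z ∈ F.evalBunch val (K.fill (.form B)) := by
  induction K generalizing z with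
  | hole => exact h
  | commaLeft K T ih =>
    obtain ⟨x, hx, y, hy, hz⟩ := h
    exact (ih hx).imp (fun h => ⟨x, h, y, hy, hz⟩) fun h => ⟨x, h, y, hy, hz⟩
  | commaRight T K ih =>
    obtain ⟨x, hx, y, hy, hz⟩ := h
    exact (ih hy).imp (fun h => ⟨x, hx, y, h, hz⟩) fun h => ⟨x, hx, y, h, hz⟩
  | semiLeft K T ih => exact (ih h.1).imp (fun h' => ⟨h', h.2⟩) fun h' => ⟨h', h.2⟩
  | semiRight T K ih => exact (ih h.2).imp (fun h' => ⟨h.1, h'⟩) fun h' => ⟨h.1, h'⟩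

theorem not_mem_fill_bot (K : Context) {z : W} :
    z ∉ F.evalBunch val (K.fill (.form .bot)) := by
  induction K generalizing z with
  | hole => exact fun h => h
  | commaLeft K T ih => rintro ⟨x, hx, -⟩; exact ih hx
  | commaRight T K ih => rintro ⟨-, -, y, hy, -⟩; exact ih hy
  | semiLeft K T ih => exact fun h => ih h.1
  | semiRight T K ih => exact fun h => ih h.2

/-- A sequent that holds at all points. -/
def Valid (s : Sequent) : Prop := F.evalBunch val s.ant ⊆ F.eval val s.suc

/-- Contexts are monotone, so most left rules and the structural rules reduce through `mono` to an
inclusion between the two bunches in the hole. -/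
theorem valid_of_derivable {Φ : Set Sequent} (hΦ : ∀ s ∈ Φ, F.Valid val s) {s : Sequent}
    (h : Derivable Φ s) : F.Valid val s := by
  have mono : ∀ {K D D' C}, F.Valid val ⟨Context.fill K D', C⟩ →
      (∀ z, z ∈ F.evalBunch val D → z ∈ F.evalBunch val D') → F.Valid val ⟨K.fill D, C⟩ :=
    fun h h' => (F.evalBunch_fill val h' _).trans h
  induction h with
  | hyp h => exact hΦ _ h
  | equiv h _ ih => unfold Valid at *; rwa [← F.evalBunch_equiv val h]
  | id A => exact subset_rfl
  | cut _ _ ih₁ ih₂ => exact mono ih₂ ih₁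
  | tensor_left _ ih => exact mono ih fun z hz => hz
  | tensor_right _ _ ih₁ ih₂ =>
    rintro z ⟨x, hx, y, hy, hz⟩
    exact ⟨x, ih₁ hx, y, ih₂ hy, hz⟩
  | under_left _ _ ih₁ ih₂ =>
    refine mono ih₁ ?_
    rintro z ⟨x, hx, y, hy, hz⟩
    exact hy x z (ih₂ hx) hz
  | under_right _ ih => exact fun y hy x z hx hz => ih ⟨x, hx, y, hy, hz⟩
  | over_left _ _ ih₁ ih₂ =>
    refine mono ih₁ ?_
    rintro z ⟨x, hx, y, hy, hz⟩
    exact hx y z (ih₂ hy) hz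
  | over_right _ ih => exact fun x hx y z hy hz => ih ⟨x, hx, y, hy, hz⟩
  | and_left _ ih => exact mono ih fun z hz => hz
  | and_right _ _ ih₁ ih₂ => exact fun z hz => ⟨ih₁ hz, ih₂ hz⟩
  | or_left _ _ ih₁ ih₂ => exact fun z hz => (F.mem_fill_or val _ hz).elim (@ih₁ z) (@ih₂ z)
  | or_right_left _ ih => exact fun z hz => Or.inl (ih hz)
  | or_right_right _ ih => exact fun z hz => Or.inr (ih hz)
  | top_semi _ ih => exact mono ih fun z hz => hz.2
  | semi_top _ ih => exact mono ih fun z hz => hz.1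
  | top_right G => exact fun z _ => trivial
  | bot_left K C => exact fun z hz => (F.not_mem_fill_bot val K hz).elim
  | semi_assoc _ ih => exact mono ih fun z hz => ⟨hz.1.1, hz.1.2, hz.2⟩
  | semi_assoc_inv _ ih => exact mono ih fun z hz => ⟨⟨hz.1, hz.2.1⟩, hz.2.2⟩
  | semi_exchange _ ih => exact mono ih fun z hz => ⟨hz.2, hz.1⟩
  | semi_weakening _ ih => exact mono ih fun z hz => hz.1
  | semi_contraction _ ih => exact mono ih fun z hz => ⟨hz, hz⟩
  | neg_left A => exact fun z hz => hz.2 hz.1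
  | neg_right A => exact fun z _ => em _
  | one_comma _ ih => exact mono ih fun z hz => (F.unit_mul _).subset hz
  | comma_one _ ih => exact mono ih fun z hz => (F.mul_unit _).subset hz
  | one_right => exact subset_rfl

end Frame

/-! ### Derivability as a preorder of formulas -/

/-- The formula `A` entails the formula `B`. -/
def Le (Φ : Set Sequent) (A B : Formula) : Prop := Derivable Φ ⟨.form A, B⟩

namespace Le

variable {Φ : Set Sequent} {A B C D : Formula}

theorem refl : Le Φ A A := .id A

theorem trans (h₁ : Le Φ A B) (h₂ : Le Φ B C) : Le Φ A C := Derivable.cut (K := .hole) h₁ h₂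

theorem and_left : Le Φ (.and A B) A :=
  Derivable.and_left (K := .hole) (.semi_weakening (K := .hole) (.id A))

theorem and_right : Le Φ (.and A B) B :=
  Derivable.and_left (K := .hole) (.semi_exchange (K := .hole) (.semi_weakening (K := .hole) (.id B)))

theorem le_and (h₁ : Le Φ A B) (h₂ : Le Φ A C) : Le Φ A (.and B C) := Derivable.and_right h₁ h₂

theorem le_or_left : Le Φ A (.or A B) := .or_right_left (.id A)

theorem le_or_right : Le Φ B (.or A B) := .or_right_right (.id B)

theorem le_top : Le Φ A .top := .top_right _

theorem bot_le : Le Φ .bot A := .bot_left .hole A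

theorem and_mono (h₁ : Le Φ A B) (h₂ : Le Φ C D) : Le Φ (.and A C) (.and B D) :=
  le_and (and_left.trans h₁) (and_right.trans h₂)

/-- Distributivity comes from the semicolon: the left rule for `∨` may be applied inside the context
`A ; [_]`. -/
theorem and_or (h₁ : Le Φ (.and A B) D) (h₂ : Le Φ (.and A C) D) : Le Φ (.and A (.or B C)) D := by
  have key : ∀ {B}, Le Φ (.and A B) D → Derivable Φ ⟨.semi (.form A) (.form B), D⟩ := fun h =>
    .cut (K := .hole) (Derivable.and_right (.semi_weakening (K := .hole) (.id A))
      (.semi_exchange (K := .hole) (.semi_weakening (K := .hole) (.id _)))) h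
  exact Derivable.and_left (K := .hole) (.or_left (K := .semiRight (.form A) .hole) (key h₁) (key h₂))

theorem and_neg : Le Φ (.and A (.neg A)) .bot := .neg_left A

theorem le_or_neg : Le Φ A (.or B (.neg B)) := le_top.trans (.neg_right B)

/-- Case distinction. -/
theorem cases (B : Formula) (h₁ : Le Φ (.and A B) C) (h₂ : Le Φ (.and A (.neg B)) C) : Le Φ A C :=
  (le_and refl le_or_neg).trans (and_or h₁ h₂)

theorem bot_of_neg (h₁ : Le Φ A B) (h₂ : Le Φ A (.neg B)) : Le Φ A .bot :=
  (le_and h₁ h₂).trans and_neg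

theorem le_of_neg (h : Le Φ (.and A (.neg B)) .bot) : Le Φ A B :=
  cases B and_right (h.trans bot_le)

theorem tensor_mono (h₁ : Le Φ A B) (h₂ : Le Φ C D) : Le Φ (.tensor A C) (.tensor B D) :=
  .tensor_left (K := .hole) (.tensor_right h₁ h₂)

theorem comma_of_tensor (h : Le Φ (.tensor A B) C) : Derivable Φ ⟨.comma (.form A) (.form B), C⟩ :=
  .cut (K := .hole) (.tensor_right (.id A) (.id B)) h

theorem le_under (h : Le Φ (.tensor A B) C) : Le Φ B (.under A C) :=
  .under_right (comma_of_tensor h)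

theorem le_over (h : Le Φ (.tensor A B) C) : Le Φ A (.over C B) :=
  .over_right (comma_of_tensor h)

theorem tensor_under : Le Φ (.tensor A (.under A B)) B :=
  .tensor_left (K := .hole) (.under_left (K := .hole) (.id B) (.id A))

theorem tensor_over : Le Φ (.tensor (.over A B) B) A :=
  .tensor_left (K := .hole) (.over_left (K := .hole) (.id A) (.id B))

theorem or_tensor (h₁ : Le Φ (.tensor A C) D) (h₂ : Le Φ (.tensor B C) D) :
    Le Φ (.tensor (.or A B) C) D :=
  .tensor_left (K := .hole) (.or_left (K := .commaLeft .hole (.form C)) (comma_of_tensor h₁)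
    (comma_of_tensor h₂))

theorem tensor_or (h₁ : Le Φ (.tensor C A) D) (h₂ : Le Φ (.tensor C B) D) :
    Le Φ (.tensor C (.or A B)) D :=
  .tensor_left (K := .hole) (.or_left (K := .commaRight (.form C) .hole) (comma_of_tensor h₁)
    (comma_of_tensor h₂))

theorem one_tensor : Le Φ (.tensor .one A) A :=
  .tensor_left (K := .hole) (.one_comma (K := .hole) (.id A))

theorem tensor_one : Le Φ (.tensor A .one) A :=
  .tensor_left (K := .hole) (.comma_one (K := .hole) (.id A))

theorem le_one_tensor : Le Φ A (.tensor .one A) :=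
  .equiv (.eps_comma _) (.tensor_right .one_right (.id A))

theorem le_tensor_one : Le Φ A (.tensor A .one) :=
  .equiv (.comma_eps _) (.tensor_right (.id A) .one_right)

end Le

/-! ### Sequents as inequalities between formulas. -/

theorem Context.exists_comp : ∀ (K K' : Context), ∃ K'' : Context, ∀ D, K''.fill D = K.fill (K'.fill D)
  | .hole, K' => ⟨K', fun _ => rfl⟩
  | .commaLeft K T, K' => by
    obtain ⟨K'', h⟩ := exists_comp K K'; exact ⟨.commaLeft K'' T, fun D => by simp [fill, h]⟩
  | .commaRight T K, K' => by
    obtain ⟨K'', h⟩ := exists_comp K K'; exact ⟨.commaRight T K'', fun D => by simp [fill, h]⟩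
  | .semiLeft K T, K' => by
    obtain ⟨K'', h⟩ := exists_comp K K'; exact ⟨.semiLeft K'' T, fun D => by simp [fill, h]⟩
  | .semiRight T K, K' => by
    obtain ⟨K'', h⟩ := exists_comp K K'; exact ⟨.semiRight T K'', fun D => by simp [fill, h]⟩

theorem derivable_toFormula {Φ : Set Sequent} : ∀ G : Bunch, Derivable Φ ⟨G, G.toFormula⟩
  | .form A => .id A
  | .eps => .one_right
  | .delta => .top_right _
  | .comma G D => .tensor_right (derivable_toFormula G) (derivable_toFormula D)
  | .semi G D => .and_right (.semi_weakening (K := .hole) (derivable_toFormula G))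
      (.semi_exchange (K := .hole) (.semi_weakening (K := .hole) (derivable_toFormula D)))

/-- Induction on the bunch for all contexts at once: both components of a pair become formulas in
turn, each in the context enlarged by the other, and then the left rule for `⊗` or `∧` joins them.
-/
theorem derivable_fill_toFormula {Φ : Set Sequent} {C : Formula} : ∀ (G : Bunch) (K : Context),
    Derivable Φ ⟨K.fill G, C⟩ → Derivable Φ ⟨K.fill (.form G.toFormula), C⟩
  | .form A, K, h => h
  | .eps, K, h => by
    have h1 := Derivable.one_comma h
    -- There is no left rule that turns `ε` into `1`. Instead `1` is inserted beside `ε`, and `(1,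
    -- ε)` is the same bunch as `1`.
    have e : Bunch.Equiv (K.fill (.comma (.form .one) .eps)) (K.fill (.form .one)) := by
      clear h h1
      induction K with
      | hole => exact .comma_eps _
      | commaLeft K T ih => exact .comma ih (.refl _)
      | commaRight T K ih => exact .comma (.refl _) ih
      | semiLeft K T ih => exact .semi ih (.refl _)
      | semiRight T K ih => exact .semi (.refl _) ih
    exact .equiv e h1
  | .delta, K, h => by
    have h1 := Derivable.top_semi h
    have e : Bunch.Equiv (K.fill (.semi (.form .top) .delta)) (K.fill (.form .top)) := by
      clear h h1
      induction K with
      | hole => exact .semi_delta _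
      | commaLeft K T ih => exact .comma ih (.refl _)
      | commaRight T K ih => exact .comma (.refl _) ih
      | semiLeft K T ih => exact .semi ih (.refl _)
      | semiRight T K ih => exact .semi (.refl _) ih
    exact .equiv e h1
  | .comma G D, K, h => by
    obtain ⟨K₁, h₁⟩ := K.exists_comp (.commaLeft .hole D)
    have h2 := derivable_fill_toFormula G K₁ (by rw [h₁]; exact h)
    rw [h₁] at h2
    obtain ⟨K₂, h₂⟩ := K.exists_comp (.commaRight (.form G.toFormula) .hole)
    have h3 := derivable_fill_toFormula D K₂ (by rw [h₂]; exact h2)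
    rw [h₂] at h3
    exact .tensor_left h3
  | .semi G D, K, h => by
    obtain ⟨K₁, h₁⟩ := K.exists_comp (.semiLeft .hole D)
    have h2 := derivable_fill_toFormula G K₁ (by rw [h₁]; exact h)
    rw [h₁] at h2
    obtain ⟨K₂, h₂⟩ := K.exists_comp (.semiRight (.form G.toFormula) .hole)
    have h3 := derivable_fill_toFormula D K₂ (by rw [h₂]; exact h2)
    rw [h₂] at h3
    exact .and_left h3

theorem derivable_iff_le {Φ : Set Sequent} {s : Sequent} :
    Derivable Φ s ↔ Le Φ s.ant.toFormula s.suc :=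
  ⟨fun h => derivable_fill_toFormula s.ant .hole h,
    fun h => .cut (K := .hole) (derivable_toFormula s.ant) h⟩

/-! ### Types -/

/-- The formula `X` is consistent and decides all formulas in `T`. -/
structure IsType (Φ : Set Sequent) (T : List Formula) (X : Formula) : Prop where
  consistent : ¬ Le Φ X .bot
  decides : ∀ B ∈ T, Le Φ X B ∨ Le Φ X (.neg B)

/-- Lindenbaum's argument for a finite list: add each formula or its negation as a conjunct,
whichever keeps `P`. The property `P` will be "not below `B`" or consistency with a product in one
of its three places. -/
theorem exists_decides {Φ : Set Sequent} {P : Formula → Prop}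
    (hP : ∀ A B, Le Φ A B → P A → P B)
    (hP' : ∀ A B, P A → P (.and A B) ∨ P (.and A (.neg B))) :
    ∀ (T : List Formula) (A : Formula), P A →
      ∃ X, Le Φ X A ∧ P X ∧ ∀ B ∈ T, Le Φ X B ∨ Le Φ X (.neg B)
  | [], A, h => ⟨A, .refl, h, by simp⟩
  | B :: T, A, h => by
    have key : ∀ C, P (.and A C) → (C = B ∨ C = .neg B) → ∃ X, Le Φ X A ∧ P X ∧
        ∀ B' ∈ B :: T, Le Φ X B' ∨ Le Φ X (.neg B') := by
      intro C hC hB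
      obtain ⟨X, h1, h2, h3⟩ := exists_decides hP hP' T _ hC
      refine ⟨X, h1.trans .and_left, h2, fun B' hB' => ?_⟩
      rcases List.mem_cons.1 hB' with rfl | hB'
      · rcases hB with rfl | rfl
        · exact Or.inl (h1.trans .and_right)
        · exact Or.inr (h1.trans .and_right)
      · exact h3 B' hB'
    rcases hP' A B h with h | h
    · exact key _ h (Or.inl rfl)
    · exact key _ h (Or.inr rfl)

variable {Φ : Set Sequent} {T : List Formula}

/-- The canonical ternary relation between types. -/
def TypeRel (Φ : Set Sequent) (Z X Y : Formula) : Prop := ¬ Le Φ (.and Z (.tensor X Y)) .bot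

theorem IsType.le_iff {X : Formula} (hX : IsType Φ T X) {B : Formula} (hB : B ∈ T) :
    Le Φ X (.neg B) ↔ ¬ Le Φ X B :=
  ⟨fun h h' => hX.consistent (h'.bot_of_neg h), fun h => (hX.decides B hB).resolve_left h⟩

/-- If `Z` did not entail `C`, it would entail `¬C` and thus be inconsistent with everything below
`C`, in particular with `X ⊗ Y`. -/
theorem TypeRel.le {Z X Y : Formula} (h : TypeRel Φ Z X Y) (hZ : IsType Φ T Z) {C : Formula}
    (hC : C ∈ T) (hXY : Le Φ (.tensor X Y) C) : Le Φ Z C := by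
  by_contra hn
  exact h (.bot_of_neg (Le.and_right.trans hXY) (Le.and_left.trans ((hZ.le_iff hC).2 hn)))

/-- This is the case of a unit: if `X` is below `1`, then `X ⊗ Y` is below `Y`, and `Z` has to
decide the list exactly as `Y` does. -/
theorem TypeRel.le_iff {Z X Y Y' : Formula} (h : TypeRel Φ Z X Y) (hZ : IsType Φ T Z)
    (hY : IsType Φ T Y') (hXY : Le Φ (.tensor X Y) Y') {C : Formula}
    (hC : C ∈ T) : Le Φ Z C ↔ Le Φ Y' C := by
  refine ⟨fun h' => ?_, fun h' => h.le hZ hC (hXY.trans h')⟩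
  by_contra hn
  exact h (.bot_of_neg (Le.and_left.trans h')
    (Le.and_right.trans (hXY.trans ((hY.le_iff hC).2 hn))))

theorem exists_type {A B : Formula} (T : List Formula) (h : ¬ Le Φ A B) :
    ∃ X, IsType Φ T X ∧ Le Φ X A ∧ ¬ Le Φ X B := by
  obtain ⟨X, h1, h2, h3⟩ := exists_decides (Φ := Φ) (P := fun C => ¬ Le Φ C B)
    (fun _ _ h h' h'' => h' (h.trans h'')) (fun A C h => by
      by_contra hc
      push Not at hc
      exact h (.cases C hc.1 hc.2)) T A h
  exact ⟨X, ⟨fun h => h2 (h.trans .bot_le), h3⟩, h1, h2⟩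

/-- `A` lies below `(A ∧ C) ∨ (A ∧ ¬C)` and `⊗` distributes over `∨`, so one of the two conjunctions
stays related to `Z` and `Y`. -/
theorem exists_type_left {Z A Y : Formula} (T : List Formula)
    (h : TypeRel Φ Z A Y) : ∃ X, IsType Φ T X ∧ Le Φ X A ∧ TypeRel Φ Z X Y := by
  obtain ⟨X, h1, h2, h3⟩ := exists_decides (Φ := Φ) (P := fun C => TypeRel Φ Z C Y)
    (fun _ _ h h' h'' => h' (.trans (.and_mono .refl (.tensor_mono h .refl)) h''))
    (fun A C h => by
      by_contra hc
      simp only [TypeRel, not_or, not_not] at hc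
      exact h (.trans (.and_mono .refl (.trans (.tensor_mono (.cases C .le_or_left .le_or_right)
        .refl) (.or_tensor .le_or_left .le_or_right))) (.and_or hc.1 hc.2))) T A h
  refine ⟨X, ⟨fun h => h2 ?_, h3⟩, h1, h2⟩
  -- An inconsistent factor makes the product inconsistent, by residuation: `⊥` is below `⊥ / Y`.
  exact Le.and_right.trans ((Le.tensor_mono (h.trans (Le.bot_le (A := .over .bot Y))) .refl).trans
    .tensor_over)

theorem exists_type_right {Z X A : Formula} (T : List Formula)
    (h : TypeRel Φ Z X A) : ∃ Y, IsType Φ T Y ∧ Le Φ Y A ∧ TypeRel Φ Z X Y := by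
  obtain ⟨Y, h1, h2, h3⟩ := exists_decides (Φ := Φ) (P := fun C => TypeRel Φ Z X C)
    (fun _ _ h h' h'' => h' (.trans (.and_mono .refl (.tensor_mono .refl h)) h''))
    (fun A C h => by
      by_contra hc
      simp only [TypeRel, not_or, not_not] at hc
      exact h (.trans (.and_mono .refl (.trans (.tensor_mono .refl
        (.cases C .le_or_left .le_or_right)) (.tensor_or .le_or_left .le_or_right)))
        (.and_or hc.1 hc.2))) T A h
  refine ⟨Y, ⟨fun h => h2 ?_, h3⟩, h1, h2⟩
  exact Le.and_right.trans ((Le.tensor_mono .refl (h.trans (Le.bot_le (A := .under X .bot)))).trans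
    .tensor_under)

theorem exists_type_result {A X Y : Formula} (T : List Formula)
    (h : TypeRel Φ A X Y) : ∃ Z, IsType Φ T Z ∧ Le Φ Z A ∧ TypeRel Φ Z X Y := by
  obtain ⟨Z, h1, h2, h3⟩ := exists_decides (Φ := Φ) (P := fun C => TypeRel Φ C X Y)
    (fun _ _ h h' h'' => h' (.trans (.and_mono h .refl) h''))
    (fun A C h => by
      by_contra hc
      simp only [TypeRel, not_or, not_not] at hc
      have sw : ∀ {A B : Formula}, Le Φ (.and A B) (.and B A) := .le_and .and_right .and_left
      exact h (.trans (.and_mono (.cases C .le_or_left .le_or_right) .refl)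
        (sw.trans (.and_or (sw.trans hc.1) (sw.trans hc.2))))) T A h
  exact ⟨Z, ⟨fun h => h2 (Le.and_left.trans h), h3⟩, h1, h2⟩

/-! ### A small language for conditions on tuples of words of bits -/

/-- All words of `n` bits, in the order in which a binary counter runs through them. -/
def enum : ℕ → List (List Bool)
  | 0 => [[]]
  | n + 1 => (enum n).flatMap fun l => [false :: l, true :: l]

theorem mem_enum {n : ℕ} {X : List Bool} : X ∈ enum n ↔ X.length = n := by
  induction n generalizing X with
  | zero => simp [enum]
  | succ n ih =>
    rcases X with _ | ⟨b, X⟩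
    · simp [enum]
    · cases b <;> simp [enum, ih]

theorem length_enum (n : ℕ) : (enum n).length = 2 ^ n := by
  induction n with
  | zero => rfl
  | succ n ih => simp [enum, ih, pow_succ]

/-- The bits that six words have at a given position. -/
abbrev Bits : Type := Fin 6 → Bool

/-- The words in the variables. -/
abbrev Env : Type := Fin 6 → List Bool

/-- The bit of `X` at position `k`. -/
def bit (X : List Bool) (k : ℕ) : Bool := X.getD k false

/-- The bits of all variables at position `k`. -/
def Env.bits (E : Env) (k : ℕ) : Bits := fun i => bit (E i) k

/-- Local conditions: the first argument are the bits at position `0`. -/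
abbrev Cond : Type := Bits → Node Bits → Bool

/-- Conditions on six words `X₀, …, X₅`. `nodes c`: the parser accepts, and `c` holds at all nodes.
`names`: see `SameName`. `tab i`: the word `Xᵢ` is in the table. -/
inductive Fm : Type
  | nodes (c : Cond)
  | names
  | tab (i : Fin 6)
  | not (φ : Fm)
  | and (φ ψ : Fm)
  | all (i : Fin 6) (φ : Fm)

/-- The states of an automaton that extracts a numeral from a word of tokens, from right to left.
The first marked token `var` starts the numeral, and the next marked token or the next token that is
not a bit ends it. -/
structure Extract : Type where
  seen : Bool
  active : Bool
  val : Bool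
  name : List Bool

/-- The token `t` is read, with mark `m` and bit `u`. -/
def Extract.step (t : Token) (m u : Bool) (h : Extract) : Extract :=
  match t with
  | .var => if m && !h.seen then ⟨true, true, u, h.name⟩ else ⟨h.seen, false, h.val, h.name⟩
  | .bit b => if h.active && !m then ⟨h.seen, true, u, b :: h.name⟩ else
      ⟨h.seen, false, h.val, h.name⟩
  | _ => ⟨h.seen, false, h.val, h.name⟩

/-- The numeral extracted from `w` by means of the marks `M`, with the bit of `X` at its beginning. -/
def extract (M X : List Bool) : List Token → Extract
  | [] => ⟨false, false, false, []⟩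
  | t :: w => (extract M X w).step t (bit M (w.length + 1)) (bit X (w.length + 1))

/-- If the marks extract the same numeral twice, then the bits there are the same. -/
def Extract.agree (h₁ h₂ : Extract) : Bool :=
  !(h₁.seen && h₂.seen && decide (h₁.name = h₂.name)) || (h₁.val == h₂.val)

/-- The truth value of a condition. -/
def Fm.eval (w : List Token) (al : List Bool → Bool) : Fm → Env → Bool
  | .nodes c, E => (parse w).accepts &&
      (parse w).nodes.all fun n => c (E.bits 0) (n.map fun a => E.bits a.1)
  | .names, E => (extract (E 1) (E 0) w).agree (extract (E 2) (E 0) w)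
  | .tab i, E => al (E i)
  | .not φ, E => !φ.eval w al E
  | .and φ ψ, E => φ.eval w al E && ψ.eval w al E
  | .all i φ, E => (enum (w.length + 1)).all fun X => φ.eval w al (Function.update E i X)

/-- Existential quantification. -/
def Fm.ex (i : Fin 6) (φ : Fm) : Fm := .not (.all i (.not φ))

/-! ### The elimination of types, written in this language. -/

/-- The comma and `⊗`. -/
def Token.isTensor : Token → Bool
  | .tensor | .comma => true
  | _ => false

/-- The conditions on a single type. -/
def coherent : Cond := fun U n =>
  match n.kind with
  | .one | .eps => n.own 0 == U 0
  | .top | .delta | .turnstile => n.own 0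
  | .bot => !n.own 0
  | .neg => n.own 0 == !n.fst 0
  | .and | .semi => n.own 0 == (n.fst 0 && n.snd 0)
  | .or => n.own 0 == (n.fst 0 || n.snd 0)
  | .sequent => n.own 0 && (!n.past || !n.fst 0 || n.snd 0)
  | _ => true

/-- The conditions on a type `z` in the product of two types `x` and `y`. -/
def related (z x y : Fin 6) : Cond := fun U n =>
  (!(n.kind.isTensor && n.fst x && n.snd y) || n.own z) &&
  (!(decide (n.kind = .under) && n.fst x && n.own y) || n.snd z) &&
  (!(decide (n.kind = .over) && n.own x && n.snd y) || n.fst z) &&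
  (!U x || (n.own z == n.own y && U z == U y)) &&
  (!U y || (n.own z == n.own x && U z == U x))

/-- At marked nodes of the kind `k`, if the bit of the type is `b`, there are types `x` and `y` as
described by `r` and `c`. -/
def witness (k : Token → Bool) (b : Bool) (r c : Cond) : Fm :=
  .all 1 (.not (.and (.not (.nodes fun _ n => !(n.own 1 && k n.kind && n.own 0 == b)))
    (.all 2 (.all 3 (.not (.and (.and (.tab 2) (.tab 3)) (.and (.nodes r)
      (.not (.nodes fun U n => !(n.own 1 && k n.kind && n.own 0 == b && c U n))))))))))

/-- One step of the elimination of types: the type `X₀` is kept. -/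
def keep : Fm :=
  .and (.and (.and (.tab 0) (.nodes coherent)) (.all 1 (.all 2 .names))) (.and (.and
    (.ex 2 (.and (.tab 2) (.nodes fun U n => U 2 && related 0 2 0 U n)))
    (.ex 2 (.and (.tab 2) (.nodes fun U n => U 2 && related 0 0 2 U n)))) (.and
    (witness Token.isTensor true (related 0 2 3) fun _ n => n.fst 2 && n.snd 3) (.and
    (witness (fun t => decide (t = .under)) false (related 3 2 0) fun _ n => n.fst 2 && !n.snd 3)
    (witness (fun t => decide (t = .over)) false (related 3 0 2) fun _ n => n.snd 2 && !n.fst 3))))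

/-- The sequent to the right of the turnstile holds at all types in the table. -/
def final : Fm :=
  .and (.nodes fun _ _ => true) (.all 0 (.not (.and (.tab 0)
    (.not (.nodes fun _ n => !(decide (n.kind = .sequent) && !n.past && n.fst 0 && !n.snd 0))))))

/-- All variables are `0 … 0`. -/
def Env.zero (m : ℕ) : Env := fun _ => List.replicate m false

/-- The table after `k` rounds of elimination. -/
def table (w : List Token) : ℕ → List Bool → Bool
  | 0 => fun X => decide (X.length = w.length + 1)
  | k + 1 => fun X => decide (X.length = w.length + 1) &&
      keep.eval w (table w k) (Function.update (Env.zero (w.length + 1)) 0 X)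

/-- The decision procedure. -/
def decideConsequence (w : List Token) : Bool :=
  final.eval w (table w (2 ^ (w.length + 1))) (Env.zero (w.length + 1))

/-! ### The elimination becomes stationary. -/

theorem table_length {w : List Token} {k : ℕ} {X : List Bool} (h : table w k X = true) :
    X.length = w.length + 1 := by
  cases k <;> simp [table] at h
  · exact h
  · exact h.1

theorem table_succ_le {w : List Token} {k : ℕ} {X : List Bool} (h : table w (k + 1) X = true) :
    table w k X = true := by
  simp [table, keep, Fm.eval] at h
  exact h.2.1.1.1

/-- Tables only shrink. If the last round still changed something, then so did all rounds before it,
and `2 ^ m + 1` rounds would each lose at least one of only `2 ^ m` words. -/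
theorem table_stable (w : List Token) :
    table w (2 ^ (w.length + 1) + 1) = table w (2 ^ (w.length + 1)) := by
  set m := w.length + 1
  by_contra hne
  have hne' : ∀ k ≤ 2 ^ m, table w (k + 1) ≠ table w k := by
    intro k hk he
    -- Each table is determined by the one before, so a single idle round makes all later ones idle.
    have : ∀ j, table w (k + j) = table w k := by
      intro j
      induction j with
      | zero => rfl
      | succ j ih => rw [← Nat.add_assoc, ← he]; simp only [table, ih]
    obtain ⟨j, hj⟩ := Nat.exists_eq_add_of_le hk
    apply hne
    rw [hj, Nat.add_assoc, this (j + 1), this j]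
  have hlt : ∀ k ≤ 2 ^ m, ((enum m).filter (table w (k + 1))).length <
      ((enum m).filter (table w k)).length := by
    intro k hk
    obtain ⟨X, hX⟩ := Function.ne_iff.1 (hne' k hk)
    have hX' : table w (k + 1) X = false ∧ table w k X = true := by
      have := @table_succ_le w k X
      grind
    rw [← List.countP_eq_length_filter, ← List.countP_eq_length_filter]
    obtain ⟨a, b, hab⟩ := List.append_of_mem (mem_enum.2 (table_length hX'.2))
    have h1 := List.countP_mono_left (l := a) (p := table w (k + 1)) (q := table w k)
      fun Y _ => table_succ_le
    have h2 := List.countP_mono_left (l := b) (p := table w (k + 1)) (q := table w k)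
      fun Y _ => table_succ_le
    rw [show enum m = a ++ X :: b from hab]
    simp only [List.countP_append, List.countP_cons, hX'.1, hX'.2]
    simp
    omega
  have hle : ∀ k ≤ 2 ^ m + 1, ((enum m).filter (table w k)).length + k ≤ 2 ^ m := by
    intro k
    induction k with
    | zero =>
      intro _
      have := List.length_filter_le (table w 0) (enum m)
      rw [length_enum] at this
      omega
    | succ k ih =>
      intro hk
      have := ih (by omega)
      have := hlt k (by omega)
      omega
  have := hle (2 ^ m + 1) le_rfl
  omega

/-! ### Extracting numerals -/

/-- For arbitrary marks the extracted word really is a numeral occurring in `w`: while the automaton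
is active, its letters are all the tokens from the marked `var` to the left end of what has been
read. Once it stops, `seen` prevents a restart. -/
theorem extract_occ (M X : List Bool) : ∀ w : List Token,
    ((extract M X w).active = true → (extract M X w).seen = true) ∧
    ((extract M X w).seen = false → (extract M X w).name = []) ∧
    ((extract M X w).seen = true → ∃ k, Occ w k (extract M X w).name ∧
      (extract M X w).val = bit X k ∧ ((extract M X w).active = true → k = w.length))
  | [] => by simp [extract]
  | t :: w => by
    obtain ⟨h1, h2, h3⟩ := extract_occ M X w
    simp only [extract]
    set h := extract M X w
    have keepOcc : h.seen = true → ∃ k, Occ (t :: w) k h.name ∧ h.val = bit X k := fun hs => by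
      obtain ⟨k, h4, h5, -⟩ := h3 hs
      exact ⟨k, h4.cons t, h5⟩
    have idle : (false = true → h.seen = true) ∧ (h.seen = false → h.name = []) ∧
        (h.seen = true → ∃ k, Occ (t :: w) k h.name ∧ h.val = bit X k ∧
          (false = true → k = (t :: w).length)) :=
      ⟨by simp, h2, fun hs => by
        obtain ⟨k, h4, h5⟩ := keepOcc hs
        exact ⟨k, h4, h5, by simp⟩⟩
    unfold Extract.step
    cases t
    case var =>
      simp only
      split_ifs with hc
      · simp at hc
        refine ⟨by simp, by simp, fun _ => ⟨w.length + 1, ⟨[], w, ?_, ?_⟩, rfl, by simp⟩⟩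
        · simp [h2 hc.2]
        · simp [h2 hc.2]; omega
      · simpa using idle
    case bit b =>
      simp only
      split_ifs with hc
      · simp at hc
        refine ⟨fun _ => h1 hc.1, fun hs => by simp [h1 hc.1] at hs, fun hs => ?_⟩
        obtain ⟨k, ⟨u, v, h4, h4'⟩, h5, h6⟩ := h3 hs
        have hk := h6 hc.1
        have hu : u = [] := by
          have := congrArg List.length h4
          simp at this
          exact List.eq_nil_of_length_eq_zero (by omega)
        subst hu
        refine ⟨w.length + 1, ⟨[], v, ?_, ?_⟩, rfl, by simp⟩
        · simp only [List.nil_append, List.map_cons, List.cons_append] at h4 ⊢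
          rw [← h4]
        · simp; omega
      · simpa using idle
    all_goals exact idle

/-- An occurrence may be a proper suffix of a longer numeral, so its left end has to be marked as
well as its `var`. -/
theorem exists_extract {w : List Token} {k : ℕ} {l : List Bool} (X : List Bool) (h : Occ w k l) :
    ∃ M : List Bool, M.length = w.length + 1 ∧ (extract M X w).seen = true ∧
      (extract M X w).name = l ∧ (extract M X w).val = bit X k := by
  obtain ⟨u, v, rfl, rfl⟩ := h
  set w := u ++ (l.map Token.bit ++ Token.var :: v) with hw
  set k := l.length + 1 + v.length
  -- `v.length + 1` is the position of the token `var`, and `k + 1` that of the token just left of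
  -- the occurrence. If there is no such token, `k + 1` lies outside the word of marks and is not
  -- needed.
  refine ⟨(List.range (w.length + 1)).map fun p => decide (p = v.length + 1 ∨ p = k + 1),
    by simp, ?_⟩
  set M := (List.range (w.length + 1)).map fun p => decide (p = v.length + 1 ∨ p = k + 1)
  have hM : ∀ p, p ≤ w.length → bit M p = decide (p = v.length + 1 ∨ p = k + 1) := by
    intro p hp
    simp only [bit, M]
    rw [List.getD_eq_getElem _ _ (by simp; omega)]
    simp
  have hlen : w.length = u.length + k := by simp [hw, k]; omega
  have hv : ∀ v', v' <:+ v → extract M X v' = ⟨false, false, false, []⟩ := by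
    intro v'
    induction v' with
    | nil => intro _; rfl
    | cons t v' ih =>
      intro hs
      have h1 := hs.length_le
      simp at h1
      have h2 : bit M (v'.length + 1) = false := by
        rw [hM _ (by omega)]
        simp
        omega
      simp only [extract, ih ((List.suffix_cons t v').trans hs), h2]
      cases t <;> rfl
  have hl : ∀ l', l' <:+ l → extract M X (l'.map Token.bit ++ Token.var :: v) =
      ⟨true, true, bit X (l'.length + 1 + v.length), l'⟩ := by
    intro l'
    induction l' with
    | nil =>
      intro _
      have h2 : bit M (v.length + 1) = true := by
        rw [hM _ (by omega)]
        simp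
      simp [extract, hv v List.suffix_rfl, Extract.step, h2, Nat.add_comm]
    | cons b l' ih =>
      intro hs
      have h1 := hs.length_le
      simp at h1
      have h3 : (l'.map Token.bit ++ Token.var :: v).length + 1 = (b :: l').length + 1 + v.length := by
        simp; omega
      have h2 : bit M ((b :: l').length + 1 + v.length) = false := by
        rw [hM _ (by simp; omega)]
        simp
        omega
      simp only [List.map_cons, List.cons_append, extract, ih ((List.suffix_cons b l').trans hs), h3,
        h2]
      simp [Extract.step]
  -- To the left of the occurrence nothing more is collected: its first token is marked and stops
  -- the automaton, whether or not it is a bit.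
  have hu : ∀ u', u' <:+ u → ∃ a, (a = true → u' = []) ∧
      extract M X (u' ++ (l.map Token.bit ++ Token.var :: v)) = ⟨true, a, bit X k, l⟩ := by
    intro u'
    induction u' with
    | nil => exact fun _ => ⟨true, by simp, hl l List.suffix_rfl⟩
    | cons t u' ih =>
      intro hs
      obtain ⟨a, h1, h2⟩ := ih ((List.suffix_cons t u').trans hs)
      refine ⟨false, by simp, ?_⟩
      simp only [List.cons_append, extract, h2]
      cases t <;> simp [Extract.step]
      rintro rfl
      obtain rfl := h1 rfl
      rw [hM _ (by simp at hlen ⊢; have := hs.length_le; simp at this; omega)]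
      simp [k]
      omega
  obtain ⟨a, -, h⟩ := hu u List.suffix_rfl
  rw [h]
  exact ⟨rfl, rfl, rfl⟩

/-! ### The decision procedure is correct -/

/-- The ternary relation between words of bits. -/
structure Related (N : List (Node (ℕ × Formula))) (z x y : List Bool) : Prop where
  tensor : ∀ n ∈ N, n.kind.isTensor = true → bit x n.fst.1 = true → bit y n.snd.1 = true →
    bit z n.own.1 = true
  under_imp : ∀ n ∈ N, n.kind = .under → bit x n.fst.1 = true → bit y n.own.1 = true →
    bit z n.snd.1 = true
  over_imp : ∀ n ∈ N, n.kind = .over → bit x n.own.1 = true → bit y n.snd.1 = true →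
    bit z n.fst.1 = true
  left : bit x 0 = true → ∀ n ∈ N, bit z n.own.1 = bit y n.own.1 ∧ bit z 0 = bit y 0
  right : bit y 0 = true → ∀ n ∈ N, bit z n.own.1 = bit x n.own.1 ∧ bit z 0 = bit x 0

theorem all_related {N : List (Node (ℕ × Formula))} {E : Env} {z x y : Fin 6} :
    (N.all fun n => related z x y (E.bits 0) (n.map fun a => E.bits a.1)) = true ↔
      Related N (E z) (E x) (E y) := by
  simp only [List.all_eq_true, related, Node.map, Env.bits, Bool.and_eq_true, Bool.or_eq_true,
    Bool.not_eq_true', Bool.and_eq_false_iff, beq_iff_eq]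
  constructor
  · intro h
    refine ⟨fun n hn => ?_, fun n hn => ?_, fun n hn => ?_, fun hx n hn => ?_, fun hx n hn => ?_⟩ <;>
      have := h n hn <;> grind
  · intro h n hn
    have h1 := h.tensor n hn
    have h2 := h.under_imp n hn
    have h3 := h.over_imp n hn
    have h4 := fun hx => h.left hx n hn
    have h5 := fun hx => h.right hx n hn
    grind

theorem eval_nodes {w : List Token} (hw : (parse w).accepts = true) {al : List Bool → Bool}
    {c : Cond} {E : Env} : (Fm.nodes c).eval w al E =
      (parse w).nodes.all fun n => c (E.bits 0) (n.map fun a => E.bits a.1) := by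
  simp [Fm.eval, hw]

theorem eval_all {w : List Token} {al : List Bool → Bool} {i : Fin 6} {φ : Fm} {E : Env} :
    (Fm.all i φ).eval w al E = true ↔ ∀ X : List Bool, X.length = w.length + 1 →
      φ.eval w al (Function.update E i X) = true := by
  simp [Fm.eval, mem_enum]

theorem eval_ex {w : List Token} {al : List Bool → Bool} {i : Fin 6} {φ : Fm} {E : Env} :
    (Fm.ex i φ).eval w al E = true ↔ ∃ X : List Bool, X.length = w.length + 1 ∧
      φ.eval w al (Function.update E i X) = true := by
  simp [Fm.ex, Fm.eval, mem_enum]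

/-- A type `X` is kept by the elimination with respect to the set `al`. -/
structure Kept (w : List Token) (al : List Bool → Bool) (X : List Bool) : Prop where
  mem : al X = true
  coherent : ∀ n ∈ (parse w).nodes, coherent (fun _ => bit X 0) (n.map fun a _ => bit X a.1) = true
  names : ∀ k k' l, Occ w k l → Occ w k' l → bit X k = bit X k'
  unit_left : ∃ e : List Bool, al e = true ∧ bit e 0 = true ∧ Related (parse w).nodes X e X
  unit_right : ∃ e : List Bool, al e = true ∧ bit e 0 = true ∧ Related (parse w).nodes X X e
  tensor : ∀ n ∈ (parse w).nodes, n.kind.isTensor = true → bit X n.own.1 = true →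
    ∃ x y, al x = true ∧ al y = true ∧ Related (parse w).nodes X x y ∧ bit x n.fst.1 = true ∧
      bit y n.snd.1 = true
  under_imp : ∀ n ∈ (parse w).nodes, n.kind = .under → bit X n.own.1 = false →
    ∃ x z, al x = true ∧ al z = true ∧ Related (parse w).nodes z x X ∧ bit x n.fst.1 = true ∧
      bit z n.snd.1 = false
  over_imp : ∀ n ∈ (parse w).nodes, n.kind = .over → bit X n.own.1 = false →
    ∃ y z, al y = true ∧ al z = true ∧ Related (parse w).nodes z X y ∧ bit y n.snd.1 = true ∧
      bit z n.fst.1 = false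

/-- If several nodes are marked, the witnesses need to serve only one of them. Words with a single
mark recover the condition for each node. -/
theorem eval_witness {w : List Token} (hw : (parse w).accepts = true) {al : List Bool → Bool}
    (hal : ∀ X, al X = true → X.length = w.length + 1)
    {E : Env} {k : Token → Bool} {b : Bool} {r c : Cond} :
    (witness k b r c).eval w al E = true ↔ ∀ M : List Bool, M.length = w.length + 1 →
      (∃ n ∈ (parse w).nodes, bit M n.own.1 = true ∧ k n.kind = true ∧ bit (E 0) n.own.1 = b) →
      ∃ x y, al x = true ∧ al y = true ∧ ∃ E' : Env, E' = ![E 0, M, x, y, E 4, E 5] ∧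
        (∀ n ∈ (parse w).nodes, r (E'.bits 0) (n.map fun a => E'.bits a.1) = true) ∧
        ∃ n ∈ (parse w).nodes, bit M n.own.1 = true ∧ k n.kind = true ∧ bit (E 0) n.own.1 = b ∧
          c (E'.bits 0) (n.map fun a => E'.bits a.1) = true := by
  unfold witness
  rw [eval_all]
  refine forall_congr' fun M => forall_congr' fun hM => ?_
  have hE : ∀ x y, Function.update (Function.update (Function.update E 1 M) 2 x) 3 y =
      ![E 0, M, x, y, E 4, E 5] := by
    intro x y
    funext i
    fin_cases i <;> rfl
  have e1 : ∀ φ : Fm, ∀ E, (Fm.not φ).eval w al E = true ↔ ¬ φ.eval w al E = true := by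
    simp [Fm.eval]
  have e2 : ∀ φ ψ : Fm, ∀ E, (Fm.and φ ψ).eval w al E = true ↔
      φ.eval w al E = true ∧ ψ.eval w al E = true := by
    simp [Fm.eval]
  have e3 : ∀ i E, (Fm.tab i).eval w al E = al (E i) := fun _ _ => rfl
  simp only [e1, e2, e3, eval_all, eval_nodes hw, hE, List.all_eq_true]
  constructor
  · rintro h ⟨n, hn, h1, h2, h3⟩
    by_contra hc
    apply h
    refine ⟨fun hh => ?_, fun x hx y hy hh => hc ⟨x, y, hh.1.1, hh.1.2, _, rfl, hh.2.1, ?_⟩⟩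
    · have := hh n hn
      simp only [Node.map, Env.bits, Function.update_self, ne_eq, Function.update_of_ne,
        Fin.reduceEq, not_false_eq_true, h1, h2, h3] at this
      simp at this
    · obtain ⟨n, hn⟩ := not_forall.1 hh.2.2
      obtain ⟨hn, hn'⟩ := Classical.not_imp.1 hn
      simp only [Bool.not_eq_true', Bool.not_eq_false, Bool.and_eq_true, beq_iff_eq] at hn'
      exact ⟨n, hn, hn'.1.1.1, hn'.1.1.2, hn'.1.2, hn'.2⟩
  · rintro h ⟨h1, h2⟩
    apply h1
    intro n hn
    by_contra hc
    simp only [Bool.not_eq_true', Bool.not_eq_false, Bool.and_eq_true, beq_iff_eq] at hc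
    obtain ⟨x, y, hx, hy, E', rfl, h3, n', h4, h5, h6, h7, h8⟩ := h ⟨n, hn, hc.1.1, hc.1.2, hc.2⟩
    refine h2 x (hal x hx) y (hal y hy) ⟨⟨hx, hy⟩, h3, fun hh => ?_⟩
    have := hh n' h4
    simp only [Bool.not_eq_true', Bool.and_eq_false_iff, beq_eq_false_iff_ne] at this
    simp only [Node.map, Env.bits] at this h8
    simp [h5, h6, h7, h8] at this

theorem eq_of_own {w : List Token} (hw : (parse w).ok = true) {n n' : Node (ℕ × Formula)}
    (hn : n ∈ (parse w).nodes) (hn' : n' ∈ (parse w).nodes) (h : n.own.1 = n'.own.1) : n = n' := by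
  have h1 : ((parse w).nodes.map fun n => n.own.1).Nodup := by
    rw [(parse_sound w hw).own]; exact nodup_countdown _
  exact List.inj_on_of_nodup_map h1 hn hn' h

theorem own_bounds {w : List Token} (hw : (parse w).ok = true) {n : Node (ℕ × Formula)}
    (hn : n ∈ (parse w).nodes) : 1 ≤ n.own.1 ∧ n.own.1 ≤ w.length := by
  rw [← mem_countdown, ← (parse_sound w hw).own]
  exact List.mem_map_of_mem hn

theorem exists_marks (m k : ℕ) : ∃ M : List Bool, M.length = m ∧
    ∀ p, bit M p = true ↔ p = k ∧ p < m := by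
  refine ⟨(List.range m).map fun p => decide (p = k), by simp, fun p => ?_⟩
  unfold bit
  by_cases hp : p < m
  · rw [List.getD_eq_getElem _ _ (by simpa using hp)]
    simp [hp]
  · rw [List.getD_eq_default _ _ (by simpa using hp)]
    simp [hp]

theorem eval_keep {w : List Token} (hw : (parse w).accepts = true) {al : List Bool → Bool}
    (hal : ∀ X, al X = true → X.length = w.length + 1) {E : Env} :
    keep.eval w al E = true ↔ Kept w al (E 0) := by
  have hok : (parse w).ok = true := by
    simp only [PState.accepts, Bool.and_eq_true] at hw; exact hw.1.1
  have e2 : ∀ φ ψ : Fm, ∀ E, (Fm.and φ ψ).eval w al E = true ↔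
      φ.eval w al E = true ∧ ψ.eval w al E = true := by
    simp [Fm.eval]
  have e3 : ∀ i E, (Fm.tab i).eval w al E = al (E i) := fun _ _ => rfl
  -- The unit bit `U 2` is tested along with the nodes, so without a node it would not be tested at
  -- all.
  have hne : ∃ n, n ∈ (parse w).nodes := by
    have h1 := (parse_sound w hok).own
    rcases hN : (parse w).nodes with _ | ⟨n, N⟩
    · rw [hN] at h1
      rcases w with _ | ⟨t, w⟩
      · simp [parse, PState.init, PState.accepts] at hw
      · simp [countdown] at h1
    · exact ⟨n, by simp⟩
  have hunit : ∀ (a b : Fin 6) (E : Env), ((parse w).nodes.all fun n => (fun (U : Bits) n => U 2 &&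
      related 0 a b U n) (E.bits 0) (n.map fun c => E.bits c.1)) = true ↔ bit (E 2) 0 = true ∧
        Related (parse w).nodes (E 0) (E a) (E b) := by
    intro a b E
    rw [← all_related]
    simp only [List.all_eq_true, Bool.and_eq_true]
    constructor
    · intro h
      obtain ⟨n, hn⟩ := hne
      exact ⟨(h n hn).1, fun n hn => (h n hn).2⟩
    · exact fun h n hn => ⟨h.1, h.2 n hn⟩
  have hcoh : ((parse w).nodes.all fun n => coherent (E.bits 0) (n.map fun a => E.bits a.1)) = true ↔
      ∀ n ∈ (parse w).nodes, coherent (fun _ => bit (E 0) 0)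
        (n.map fun a _ => bit (E 0) a.1) = true := by
    rw [List.all_eq_true]
    rfl
  have hnames : (∀ M : List Bool, M.length = w.length + 1 → ∀ M' : List Bool,
      M'.length = w.length + 1 →
        (extract M (E 0) w).agree (extract M' (E 0) w) = true) ↔
      ∀ k k' l, Occ w k l → Occ w k' l → bit (E 0) k = bit (E 0) k' := by
    constructor
    · intro h k k' l hk hk'
      obtain ⟨M, h1, h2, h3, h4⟩ := exists_extract (E 0) hk
      obtain ⟨M', h1', h2', h3', h4'⟩ := exists_extract (E 0) hk'
      have := h M h1 M' h1'
      simpa [Extract.agree, h2, h2', h3, h3', h4, h4'] using this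
    · intro h M _ M' _
      unfold Extract.agree
      by_cases hs : (extract M (E 0) w).seen = true ∧ (extract M' (E 0) w).seen = true ∧
          (extract M (E 0) w).name = (extract M' (E 0) w).name
      · obtain ⟨k, h1, h2, -⟩ := (extract_occ M (E 0) w).2.2 hs.1
        obtain ⟨k', h1', h2', -⟩ := (extract_occ M' (E 0) w).2.2 hs.2.1
        rw [h2, h2', h k k' _ h1 (hs.2.2 ▸ h1')]
        simp
      · grind
  -- A quantifier over nodes is simulated by one over marks: positions of nodes are distinct, so a
  -- single mark picks out one node.
  have hwit : ∀ (k : Token → Bool) (b : Bool) (a b' c' : Fin 6) (c : Cond)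
      (P : Node (ℕ × Formula) → List Bool → List Bool → Prop) (R : List Bool → List Bool → Prop),
      (∀ (E : Env) n, c (E.bits 0) (n.map fun a => E.bits a.1) = true ↔ P n (E 2) (E 3)) →
      (∀ M x y, Related (parse w).nodes ((![E 0, M, x, y, E 4, E 5] : Env) a)
            ((![E 0, M, x, y, E 4, E 5] : Env) b') ((![E 0, M, x, y, E 4, E 5] : Env) c') ↔
            R x y) →
      ((witness k b (related a b' c') c).eval w al E = true ↔ ∀ n ∈ (parse w).nodes,
        k n.kind = true → bit (E 0) n.own.1 = b → ∃ x y, al x = true ∧ al y = true ∧ R x y ∧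
          P n x y) := by
    intro k b a b' c' c P R hP hR
    rw [eval_witness hw hal]
    have hr : ∀ E' : Env, (∀ n ∈ (parse w).nodes, related a b' c' (E'.bits 0)
        (n.map fun a => E'.bits a.1) = true) ↔ Related (parse w).nodes (E' a) (E' b') (E' c') := by
      intro E'
      rw [← all_related, List.all_eq_true]
    constructor
    · intro h n hn h1 h2
      obtain ⟨M, hM, hM'⟩ := exists_marks (w.length + 1) n.own.1
      obtain ⟨x, y, hx, hy, E', rfl, h3, n', hn', h4, h5, h6, h7⟩ := h M hM
        ⟨n, hn, (hM' _).2 ⟨rfl, by have := own_bounds hok hn; omega⟩, h1, h2⟩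
      obtain rfl := eq_of_own hok hn' hn ((hM' _).1 h4).1
      exact ⟨x, y, hx, hy, (hR _ _ _).1 ((hr _).1 h3), (hP _ _).1 h7⟩
    · rintro h M hM ⟨n, hn, h1, h2, h3⟩
      obtain ⟨x, y, hx, hy, h4, h5⟩ := h n hn h2 h3
      exact ⟨x, y, hx, hy, _, rfl, (hr _).2 ((hR _ _ _).2 h4), n, hn, h1, h2, h3, (hP _ _).2 h5⟩
  unfold keep
  simp only [e2, e3, eval_all, eval_ex, eval_nodes hw, hunit]
  rw [hwit _ _ _ _ _ _ (fun n x y => bit x n.fst.1 = true ∧ bit y n.snd.1 = true)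
      (fun x y => Related (parse w).nodes (E 0) x y)
      (fun E n => by simp [Node.map, Env.bits]) (fun M x y => Iff.rfl),
    hwit _ _ _ _ _ _ (fun n x y => bit x n.fst.1 = true ∧ bit y n.snd.1 = false)
      (fun x y => Related (parse w).nodes y x (E 0))
      (fun E n => by simp [Node.map, Env.bits]) (fun M x y => Iff.rfl),
    hwit _ _ _ _ _ _ (fun n x y => bit x n.snd.1 = true ∧ bit y n.fst.1 = false)
      (fun x y => Related (parse w).nodes y (E 0) x)
      (fun E n => by simp [Node.map, Env.bits]) (fun M x y => Iff.rfl), hcoh]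
  have hupd : ∀ (M : List Bool) (M' : List Bool), (Fm.names.eval w al
      (Function.update (Function.update E 1 M) 2 M') = true) ↔
        (extract M (E 0) w).agree (extract M' (E 0) w) = true := fun _ _ => Iff.rfl
  simp only [hupd, hnames, decide_eq_true_eq]
  have hx2 : ∀ X, Function.update E 2 X 2 = X ∧ Function.update E 2 X 0 = E 0 :=
    fun X => ⟨rfl, rfl⟩
  simp only [hx2]
  constructor
  · rintro ⟨⟨⟨h1, h2⟩, h3⟩, ⟨⟨x, hx, h4, h5, h6⟩, y, hy, h4', h5', h6'⟩, h7, h8, h9⟩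
    exact ⟨h1, h2, h3, ⟨x, h4, h5, h6⟩, ⟨y, h4', h5', h6'⟩, h7, h8, h9⟩
  · rintro ⟨h1, h2, h3, ⟨x, h4, h5, h6⟩, ⟨y, h4', h5', h6'⟩, h7, h8, h9⟩
    exact ⟨⟨⟨h1, h2⟩, h3⟩, ⟨⟨x, hal _ h4, h4, h5, h6⟩, y, hal _ h4', h4', h5', h6'⟩, h7, h8, h9⟩

theorem eval_final {w : List Token} (hw : (parse w).accepts = true) {al : List Bool → Bool}
    (hal : ∀ X, al X = true → X.length = w.length + 1) {E : Env} :
    final.eval w al E = true ↔ ∀ X, al X = true → ∀ n ∈ (parse w).nodes, n.kind = .sequent →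
      n.past = false → bit X n.fst.1 = true → bit X n.snd.1 = true := by
  have e1 : ∀ φ : Fm, ∀ E, (Fm.not φ).eval w al E = true ↔ ¬ φ.eval w al E = true := by
    simp [Fm.eval]
  have e2 : ∀ φ ψ : Fm, ∀ E, (Fm.and φ ψ).eval w al E = true ↔
      φ.eval w al E = true ∧ ψ.eval w al E = true := by
    simp [Fm.eval]
  have e3 : ∀ i E, (Fm.tab i).eval w al E = al (E i) := fun _ _ => rfl
  unfold final
  simp only [e1, e2, e3, eval_all, eval_nodes hw, List.all_eq_true, Function.update_self, Node.map,
    Env.bits, implies_true, true_and, not_and, not_not, Bool.not_eq_true', Bool.and_eq_false_iff]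
  constructor
  · intro h X hX n hn h1 h2 h3
    have := h X (hal X hX) hX n hn
    simpa [h1, h2, h3] using this
  · intro h X _ hX n hn
    have := h X hX n hn
    grind

theorem bit_ext {m : ℕ} {X Y : List Bool} (hX : X.length = m) (hY : Y.length = m)
    (h : ∀ k < m, bit X k = bit Y k) : X = Y := by
  refine List.ext_getElem (hX.trans hY.symm) fun k h1 h2 => ?_
  have := h k (hX ▸ h1)
  rwa [bit, bit, List.getD_eq_getElem _ _ h1, List.getD_eq_getElem _ _ h2] at this

theorem exists_own {w : List Token} (hw : (parse w).ok = true) {k : ℕ} (h1 : 1 ≤ k)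
    (h2 : k ≤ w.length) : ∃ n ∈ (parse w).nodes, n.own.1 = k := by
  have : k ∈ (parse w).nodes.map fun n => n.own.1 := by
    rw [(parse_sound w hw).own]; exact mem_countdown.2 ⟨h1, h2⟩
  exact List.mem_map.1 this

theorem ok_of_accepts {α : Type} {s : PState α} (h : s.accepts = true) : s.ok = true := by
  simp only [PState.accepts, Bool.and_eq_true] at h; exact h.1.1

/-! ### The frame of surviving types. -/

/-- The types that survive the elimination form a frame. -/
def typeFrame {w : List Token} (hw : (parse w).accepts = true) {al : List Bool → Bool}
    (hal : ∀ X, al X = true → X.length = w.length + 1) (hk : ∀ X, al X = true → Kept w al X) :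
    Frame {X // al X = true} where
  rel z x y := Related (parse w).nodes z.1 x.1 y.1
  unit := {X | bit X.1 0 = true}
  unit_left := by
    intro e x z he h
    refine Subtype.ext (bit_ext (hal _ z.2) (hal _ x.2) fun k hk => ?_)
    have hok := ok_of_accepts hw
    rcases Nat.eq_zero_or_pos k with rfl | h0
    -- Bit `0` belongs to no node, but `Related` compares it along with every node; there is one,
    -- since the empty word is not accepted.
    · rcases Nat.eq_zero_or_pos w.length with hl | hl
      · rw [List.eq_nil_of_length_eq_zero hl] at hw
        simp [parse, PState.init, PState.accepts] at hw
      · obtain ⟨n, hn, -⟩ := exists_own hok le_rfl hl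
        exact (h.left he n hn).2
    · obtain ⟨n, hn, rfl⟩ := exists_own hok h0 (by omega)
      exact (h.left he n hn).1
  unit_right := by
    intro e x z he h
    refine Subtype.ext (bit_ext (hal _ z.2) (hal _ x.2) fun k hk => ?_)
    have hok := ok_of_accepts hw
    rcases Nat.eq_zero_or_pos k with rfl | h0
    · rcases Nat.eq_zero_or_pos w.length with hl | hl
      · rw [List.eq_nil_of_length_eq_zero hl] at hw
        simp [parse, PState.init, PState.accepts] at hw
      · obtain ⟨n, hn, -⟩ := exists_own hok le_rfl hl
        exact (h.right he n hn).2
    · obtain ⟨n, hn, rfl⟩ := exists_own hok h0 (by omega)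
      exact (h.right he n hn).1
  exists_left x := by
    obtain ⟨e, h1, h2, h3⟩ := (hk _ x.2).unit_left
    exact ⟨⟨e, h1⟩, h2, h3⟩
  exists_right x := by
    obtain ⟨e, h1, h2, h3⟩ := (hk _ x.2).unit_right
    exact ⟨⟨e, h1⟩, h2, h3⟩

/-- The truth lemma, by induction on positions: arguments stand further right and so have smaller
positions. For `⊗` and the residuals one direction is built into `Related`, and the other is the
witness guaranteed by `Kept`. -/
theorem mem_eval_typeFrame {w : List Token} (hw : (parse w).accepts = true)
    {al : List Bool → Bool} (hal : ∀ X, al X = true → X.length = w.length + 1)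
    (hk : ∀ X, al X = true → Kept w al X) : ∀ (k : ℕ), ∀ n ∈ (parse w).nodes, n.own.1 = k →
    ∀ u : {X // al X = true}, u ∈ (typeFrame hw hal hk).eval
      (fun i => {u | ∃ k, Occ w k (Computability.encodeNat i) ∧ bit u.1 k = true}) n.own.2 ↔
        bit u.1 k = true := by
  intro k
  induction k using Nat.strong_induction_on with
  | _ k ih =>
    intro n hn hnk u
    set F := typeFrame hw hal hk
    set val : ℕ → Set {X // al X = true} :=
      fun i => {u | ∃ k, Occ w k (Computability.encodeNat i) ∧ bit u.1 k = true}
    have hs := (parse_sound w (ok_of_accepts hw)).sound n hn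
    have h1 : 1 ≤ n.kind.arity → ∀ u : {X // al X = true},
        u ∈ F.eval val n.fst.2 ↔ bit u.1 n.fst.1 = true := by
      intro ha u
      obtain ⟨hlt, n', hn', e⟩ := hs.fst ha
      have := ih n.fst.1 (hnk ▸ hlt) n' hn' (by rw [e]) u
      rwa [e] at this
    have h2 : 2 ≤ n.kind.arity → ∀ u : {X // al X = true},
        u ∈ F.eval val n.snd.2 ↔ bit u.1 n.snd.1 = true := by
      intro ha u
      obtain ⟨hlt, n', hn', e⟩ := hs.snd ha
      have := ih n.snd.1 (hnk ▸ hlt) n' hn' (by rw [e]) u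
      rwa [e] at this
    have hK := hk _ u.2
    have hc := hK.coherent n hn
    -- Every suffix of a numeral is itself a variable, so nodes for bits are covered too. The
    -- valuation asks for a true bit at some occurrence, and `names` makes all occurrences agree.
    have hvar : (n.kind = .var ∨ ∃ b, n.kind = .bit b) →
        (u ∈ F.eval val n.own.2 ↔ bit u.1 k = true) := by
      intro h
      obtain ⟨i, e1, e2⟩ := hs.numeral h
      rw [e1, ← hnk]
      exact ⟨fun ⟨k, hk1, hk2⟩ => hK.names _ _ _ hk1 e2 ▸ hk2, fun h => ⟨_, e2, h⟩⟩
    have htensor : n.kind.isTensor = true → n.own.2 = .tensor n.fst.2 n.snd.2 →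
        2 ≤ n.kind.arity → (u ∈ F.eval val n.own.2 ↔ bit u.1 k = true) := by
      intro ht e ha
      rw [e, ← hnk]
      constructor
      · rintro ⟨x, hx, y, hy, h⟩
        exact h.tensor n hn ht ((h1 (by omega) x).1 hx) ((h2 ha y).1 hy)
      · intro h
        obtain ⟨x, y, hx, hy, h3, h4, h5⟩ := hK.tensor n hn ht h
        exact ⟨⟨x, hx⟩, (h1 (by omega) _).2 h4, ⟨y, hy⟩, (h2 ha _).2 h5, h3⟩
    have hand : n.own.2 = .and n.fst.2 n.snd.2 → 2 ≤ n.kind.arity →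
        (bit u.1 n.own.1 == (bit u.1 n.fst.1 && bit u.1 n.snd.1)) = true →
        (u ∈ F.eval val n.own.2 ↔ bit u.1 k = true) := by
      intro e ha hc
      rw [e, ← hnk, eq_of_beq hc, Bool.and_eq_true, ← h1 (by omega), ← h2 ha]
      rfl
    have hover : n.kind = .over → (u ∈ F.eval val n.own.2 ↔ bit u.1 k = true) := by
      intro hkind
      have hform := hs.formula
      rw [hkind] at hform h1 h2
      rw [hform, ← hnk]
      constructor
      · intro h
        by_contra hb
        obtain ⟨y, z, hy, hz, h3, h4, h5⟩ := hK.over_imp n hn hkind (by simpa using hb)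
        have := (h1 (by simp [Token.arity]) _).1 (h ⟨y, hy⟩ ⟨z, hz⟩ ((h2 le_rfl _).2 h4) h3)
        simp [h5] at this
      · intro h y z hy hz
        exact (h1 (by simp [Token.arity]) _).2 (hz.over_imp n hn hkind h ((h2 le_rfl _).1 hy))
    have hform := hs.formula
    rcases hkind : n.kind with b | _ | _ | _ | _ | _ | _ | _ | _ | _ | _ | _ | _ | _ | _ | _ | _ <;>
      simp only [coherent, Node.map, hkind] at hc <;> rw [hkind] at hform h1 h2
    case bit => exact hvar (Or.inr ⟨_, hkind⟩)
    case var => exact hvar (Or.inl hkind)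
    case tensor => exact htensor (by rw [hkind]; rfl) hform (by rw [hkind]; rfl)
    case comma => exact htensor (by rw [hkind]; rfl) hform (by rw [hkind]; rfl)
    case and => exact hand hform (by rw [hkind]; rfl) hc
    case semi => exact hand hform (by rw [hkind]; rfl) hc
    case one => rw [hform, ← hnk, eq_of_beq hc]; rfl
    case eps => rw [hform, ← hnk, eq_of_beq hc]; rfl
    case bot => rw [hform, ← hnk]; simpa [dn, Frame.eval] using hc
    case neg =>
      rw [hform, ← hnk, eq_of_beq hc, Bool.not_eq_true', ← Bool.not_eq_true, ← h1 le_rfl]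
      rfl
    case or =>
      rw [hform, ← hnk, eq_of_beq hc, Bool.or_eq_true, ← h1 (by simp [Token.arity]), ← h2 le_rfl]
      rfl
    case under =>
      rw [hform, ← hnk]
      constructor
      · intro h
        by_contra hb
        obtain ⟨x, z, hx, hz, h3, h4, h5⟩ := hK.under_imp n hn hkind (by simpa using hb)
        have := (h2 le_rfl _).1 (h ⟨x, hx⟩ ⟨z, hz⟩ ((h1 (by simp [Token.arity]) _).2 h4) h3)
        simp [h5] at this
      · intro h x z hx hz
        exact (h2 le_rfl _).2 (hz.under_imp n hn hkind ((h1 (by simp [Token.arity]) _).1 hx) h)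
    case top => rw [hform, ← hnk, hc]; simp [dn, Frame.eval]
    case delta => rw [hform, ← hnk, hc]; simp [dn, Frame.eval]
    case turnstile => rw [hform, ← hnk, hc]; simp [dn, Frame.eval]
    case sequent => rw [hform, ← hnk, (Bool.and_eq_true_iff.1 hc).1]; simp [dn, Frame.eval]
    exact hover hkind

/-- `coherent` forces each hypothesis to hold at every survivor, hence in the frame; soundness then
carries validity over to the goal. -/
theorem goal_of_derivable {Φ : List Sequent} {s : Sequent} {w : List Token}
    (hw : w = encodeInstance Φ s) {al : List Bool → Bool}
    (hal : ∀ X, al X = true → X.length = w.length + 1)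
    (hk : ∀ X, al X = true → Kept w al X) (h : Derivable {t | t ∈ Φ} s)
    {X : List Bool} (hX : al X = true) {n : Node (ℕ × Formula)} (hn : n ∈ (parse w).nodes)
    (h1 : n.kind = .sequent) (h2 : n.past = false) (h3 : bit X n.fst.1 = true) :
    bit X n.snd.1 = true := by
  have hI : (parse w).IsInstance Φ s := hw ▸ parse_encodeInstance s Φ
  have hacc : (parse w).accepts = true := by simp [PState.accepts, hI.ok, hI.past, hI.stack]
  have key := mem_eval_typeFrame hacc hal hk
  set F := typeFrame hacc hal hk
  set val : ℕ → Set {X // al X = true} :=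
    fun i => {u | ∃ k, Occ w k (Computability.encodeNat i) ∧ bit u.1 k = true}
  have args : ∀ n ∈ (parse w).nodes, n.kind = .sequent → ∀ u : {X // al X = true},
      (u ∈ F.eval val n.fst.2 ↔ bit u.1 n.fst.1 = true) ∧
      (u ∈ F.eval val n.snd.2 ↔ bit u.1 n.snd.1 = true) := by
    intro n hn h1 u
    have hs := (parse_sound w hI.ok).sound n hn
    obtain ⟨-, n', hn', e⟩ := hs.fst (by rw [h1]; simp [Token.arity])
    obtain ⟨-, n'', hn'', e'⟩ := hs.snd (by rw [h1]; simp [Token.arity])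
    have := key _ n' hn' rfl u
    have := key _ n'' hn'' rfl u
    simp_all
  have hval : ∀ t ∈ {t | t ∈ Φ}, F.Valid val t := by
    intro t ht u hu
    obtain ⟨n, hn, h1, h2, h3, h4⟩ := hI.hyp t ht
    have hc := (hk _ u.2).coherent n hn
    simp only [coherent, Node.map, h1, h2, Bool.and_eq_true, Bool.or_eq_true] at hc
    rw [← h4, (args n hn h1 u).2]
    rw [Frame.evalBunch, ← h3, (args n hn h1 u).1] at hu
    simpa [hu] using hc.2
  have hs := F.valid_of_derivable val hval h
  obtain ⟨-, -, e1, e2⟩ := hI.goal' n hn h1 h2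
  have := @hs ⟨X, hX⟩ (by
    rw [Frame.evalBunch, ← e1]
    exact (args n hn h1 ⟨X, hX⟩).1.2 h3)
  rw [← e2] at this
  exact (args n hn h1 ⟨X, hX⟩).2.1 this

/-! ### Types survive the elimination -/

/-- The formula at a position. -/
noncomputable def formulaAt (w : List Token) (k : ℕ) : Formula :=
  open Classical in
  if h : ∃ n ∈ (parse w).nodes, n.own.1 = k then h.choose.own.2 else .one

/-- The formulas at all positions. -/
noncomputable def closureList (w : List Token) : List Formula :=
  (List.range (w.length + 1)).map (formulaAt w)

/-- The word of bits that describes a type. -/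
noncomputable def typeWord (Φ : Set Sequent) (w : List Token) (X : Formula) : List Bool :=
  open Classical in (List.range (w.length + 1)).map fun k => decide (Le Φ X (formulaAt w k))

theorem bit_typeWord {Φ : Set Sequent} {w : List Token} {X : Formula} {k : ℕ}
    (hk : k < w.length + 1) : bit (typeWord Φ w X) k = true ↔ Le Φ X (formulaAt w k) := by
  classical
  unfold bit typeWord
  rw [List.getD_eq_getElem _ _ (by simpa using hk)]
  simp

section

variable {Φ : Set Sequent} {w : List Token}

theorem formulaAt_own (hw : (parse w).ok = true) {n : Node (ℕ × Formula)}
    (hn : n ∈ (parse w).nodes) : formulaAt w n.own.1 = n.own.2 := by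
  have h : ∃ n' ∈ (parse w).nodes, n'.own.1 = n.own.1 := ⟨n, hn, rfl⟩
  unfold formulaAt
  rw [dif_pos h, eq_of_own hw h.choose_spec.1 hn h.choose_spec.2]

/-- Positions of nodes begin at `1`, so `0` receives the default `.one`. This is why bit `0` of a
type tells whether it is a unit. -/
theorem formulaAt_zero (hw : (parse w).ok = true) : formulaAt w 0 = .one := by
  unfold formulaAt
  rw [dif_neg]
  rintro ⟨n, hn, h⟩
  have := own_bounds hw hn
  omega

theorem formulaAt_mem {k : ℕ} (hk : k < w.length + 1) : formulaAt w k ∈ closureList w :=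
  List.mem_map_of_mem (List.mem_range.2 hk)

/-- What is known about the bits of `typeWord Φ w X` at a node. -/
theorem bit_node (hw : (parse w).ok = true) {n : Node (ℕ × Formula)} (hn : n ∈ (parse w).nodes)
    (X : Formula) : (n.own.2 ∈ closureList w ∧
      (bit (typeWord Φ w X) n.own.1 = true ↔ Le Φ X n.own.2)) ∧
    (1 ≤ n.kind.arity → n.fst.2 ∈ closureList w ∧
      (bit (typeWord Φ w X) n.fst.1 = true ↔ Le Φ X n.fst.2)) ∧
    (2 ≤ n.kind.arity → n.snd.2 ∈ closureList w ∧
      (bit (typeWord Φ w X) n.snd.1 = true ↔ Le Φ X n.snd.2)) := by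
  have key : ∀ n ∈ (parse w).nodes, n.own.2 ∈ closureList w ∧
      (bit (typeWord Φ w X) n.own.1 = true ↔ Le Φ X n.own.2) := by
    intro n hn
    have := own_bounds hw hn
    rw [← formulaAt_own hw hn]
    exact ⟨formulaAt_mem (by omega), bit_typeWord (by omega)⟩
  have hs := (parse_sound w hw).sound n hn
  refine ⟨key n hn, fun ha => ?_, fun ha => ?_⟩
  · obtain ⟨-, n', hn', e⟩ := hs.fst ha
    exact e ▸ key n' hn'
  · obtain ⟨-, n', hn', e⟩ := hs.snd ha
    exact e ▸ key n' hn'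

theorem bit_zero (hw : (parse w).ok = true) (X : Formula) :
    bit (typeWord Φ w X) 0 = true ↔ Le Φ X .one := by
  rw [bit_typeWord (Nat.succ_pos _), formulaAt_zero hw]

theorem one_mem_closureList (hw : (parse w).ok = true) : .one ∈ closureList w :=
  formulaAt_zero hw ▸ formulaAt_mem (Nat.succ_pos _)

/-- The first three clauses are `TypeRel.le` after monotonicity of `⊗` and residuation; the clauses
for units are `TypeRel.le_iff`. -/
theorem TypeRel.related (hw : (parse w).ok = true) {Z X Y : Formula} (h : TypeRel Φ Z X Y)
    (hZ : IsType Φ (closureList w) Z) (hX : IsType Φ (closureList w) X)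
    (hY : IsType Φ (closureList w) Y) :
    Related (parse w).nodes (typeWord Φ w Z) (typeWord Φ w X) (typeWord Φ w Y) := by
  have hform := fun n hn => ((parse_sound w hw).sound n hn).formula
  refine ⟨fun n hn ht hx hy => ?_, fun n hn ht hx hy => ?_, fun n hn ht hx hy => ?_,
    fun hx n hn => ?_, fun hx n hn => ?_⟩
  · have ha : n.kind.arity = 2 ∧ n.own.2 = .tensor n.fst.2 n.snd.2 := by
      have := hform n hn
      rcases hkind : n.kind <;> simp [hkind, Token.isTensor] at ht <;> rw [hkind] at this <;>
        exact ⟨rfl, this⟩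
    have hx := ((bit_node hw hn X).2.1 (by omega)).2.1 hx
    have hy := ((bit_node hw hn Y).2.2 (by omega)).2.1 hy
    refine (bit_node hw hn Z).1.2.2 (h.le hZ (bit_node (Φ := Φ) hw hn Z).1.1 ?_)
    rw [ha.2]
    exact .tensor_mono hx hy
  · have ha : n.kind.arity = 2 := by rw [ht]; rfl
    have hf := hform n hn
    rw [ht] at hf
    have hx := ((bit_node hw hn X).2.1 (by omega)).2.1 hx
    have hy := (bit_node hw hn Y).1.2.1 hy
    have hz := (bit_node (Φ := Φ) hw hn Z).2.2 (by omega)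
    rw [hf] at hy
    exact hz.2.2 (h.le hZ hz.1 ((Le.tensor_mono hx hy).trans .tensor_under))
  · have ha : n.kind.arity = 2 := by rw [ht]; rfl
    have hf := hform n hn
    rw [ht] at hf
    have hx := (bit_node hw hn X).1.2.1 hx
    have hy := ((bit_node hw hn Y).2.2 (by omega)).2.1 hy
    have hz := (bit_node (Φ := Φ) hw hn Z).2.1 (by omega)
    rw [hf] at hx
    exact hz.2.2 (h.le hZ hz.1 ((Le.tensor_mono hx hy).trans .tensor_over))
  · have hx := (bit_zero hw X).1 hx
    have hXY : Le Φ (.tensor X Y) Y := (Le.tensor_mono hx .refl).trans .one_tensor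
    refine ⟨Bool.eq_iff_iff.2 ?_, Bool.eq_iff_iff.2 ?_⟩
    · rw [(bit_node hw hn Z).1.2, (bit_node hw hn Y).1.2]
      exact h.le_iff hZ hY hXY (bit_node (Φ := Φ) hw hn Z).1.1
    · rw [bit_zero hw, bit_zero hw]
      exact h.le_iff hZ hY hXY (one_mem_closureList hw)
  · have hx := (bit_zero hw Y).1 hx
    have hXY : Le Φ (.tensor X Y) X := (Le.tensor_mono .refl hx).trans .tensor_one
    refine ⟨Bool.eq_iff_iff.2 ?_, Bool.eq_iff_iff.2 ?_⟩
    · rw [(bit_node hw hn Z).1.2, (bit_node hw hn X).1.2]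
      exact h.le_iff hZ hX hXY (bit_node (Φ := Φ) hw hn Z).1.1
    · rw [bit_zero hw, bit_zero hw]
      exact h.le_iff hZ hX hXY (one_mem_closureList hw)

/-- The table is only assumed to contain the words of all canonical types, so the lemma applies in
every round. Each witness arises by refining the places of a consistent product to types. -/
theorem kept_typeWord {L : List Sequent} {s : Sequent} (hw : w = encodeInstance L s)
    {al : List Bool → Bool}
    (hal : ∀ X, IsType {t | t ∈ L} (closureList w) X → al (typeWord {t | t ∈ L} w X) = true)
    {X : Formula} (hX : IsType {t | t ∈ L} (closureList w) X) :
    Kept w al (typeWord {t | t ∈ L} w X) := by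
  set Φ : Set Sequent := {t | t ∈ L}
  have hI : (parse w).IsInstance L s := hw ▸ parse_encodeInstance s L
  have hok := hI.ok
  have hsound := (parse_sound w hok).sound
  refine ⟨hal X hX, fun n hn => ?_, fun k k' l hk hk' => ?_, ?_, ?_, fun n hn ht hb => ?_,
    fun n hn ht hb => ?_, fun n hn ht hb => ?_⟩
  · obtain ⟨⟨hm, h0⟩, h1, h2⟩ := bit_node (Φ := Φ) hok hn X
    have hf := (hsound n hn).formula
    have hz := bit_zero (Φ := Φ) hok X
    have hand : n.own.2 = .and n.fst.2 n.snd.2 → 2 ≤ n.kind.arity →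
        (bit (typeWord Φ w X) n.own.1 ==
          (bit (typeWord Φ w X) n.fst.1 && bit (typeWord Φ w X) n.snd.1)) = true := by
      intro e ha
      rw [beq_iff_eq, Bool.eq_iff_iff, Bool.and_eq_true, h0, (h1 (by omega)).2, (h2 ha).2, e]
      exact ⟨fun h => ⟨h.trans .and_left, h.trans .and_right⟩, fun h => .le_and h.1 h.2⟩
    have htop : n.own.2 = .top → bit (typeWord Φ w X) n.own.1 = true := fun e => by
      rw [h0, e]; exact .le_top
    have hone : n.own.2 = .one →
        (bit (typeWord Φ w X) n.own.1 == bit (typeWord Φ w X) 0) = true := fun e => by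
      rw [beq_iff_eq, Bool.eq_iff_iff, h0, e, hz]
    rcases hkind : n.kind with b | _ | _ | _ | _ | _ | _ | _ | _ | _ | _ | _ | _ | _ | _ | _ | _ <;>
      simp only [coherent, Node.map, hkind] <;> rw [hkind] at hf h1 h2 hand
    case one => exact hone hf
    case eps => exact hone hf
    case top => exact htop hf
    case delta => exact htop hf
    case turnstile => exact htop hf
    case and => exact hand hf le_rfl
    case semi => exact hand hf le_rfl
    case bot =>
      rw [Bool.not_eq_true', ← Bool.not_eq_true, h0, hf]
      exact hX.consistent
    case neg =>
      rw [beq_iff_eq, Bool.eq_iff_iff, Bool.not_eq_true', ← Bool.not_eq_true, h0,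
        (h1 le_rfl).2, hf]
      exact hX.le_iff (h1 le_rfl).1
    case or =>
      have h1 := h1 (by simp [Token.arity])
      have h2 := h2 le_rfl
      rw [beq_iff_eq, Bool.eq_iff_iff, Bool.or_eq_true, h0, h1.2, h2.2, hf]
      constructor
      · intro h
        by_contra hn
        rw [not_or, ← hX.le_iff h1.1, ← hX.le_iff h2.1] at hn
        refine hX.consistent ((Le.le_and .refl h).trans (.and_or ?_ ?_))
        · exact .bot_of_neg .and_right (Le.and_left.trans hn.1)
        · exact .bot_of_neg .and_right (Le.and_left.trans hn.2)
      · rintro (h | h)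
        · exact h.trans .le_or_left
        · exact h.trans .le_or_right
    case sequent =>
      rw [Bool.and_eq_true]
      refine ⟨htop hf, ?_⟩
      by_contra hc
      simp only [Bool.or_eq_true, Bool.not_eq_true', not_or, Bool.not_eq_false] at hc
      obtain ⟨t, ht, -, -, e1, e2⟩ := hI.hyp' n hn hkind hc.1.1
      have h3 := (h1 (by simp [Token.arity])).2.1 hc.1.2
      rw [(h2 le_rfl).2] at hc
      refine hc.2 (h3.trans ?_)
      rw [e1, e2]
      exact derivable_iff_le.1 (.hyp ht)
  -- The token `var` ends a numeral, so at most one numeral begins at a position. Equal numerals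
  -- thus belong to the same variable and to the same entailment.
  · have key : ∀ k, Occ w k l → ∃ i, l = Computability.encodeNat i ∧
        (bit (typeWord Φ w X) k = true ↔ Le Φ X (.var i)) := by
      rintro k hk
      have hk' := hk
      obtain ⟨u, v, e1, e2⟩ := hk'
      obtain ⟨n, hn, hnk⟩ := exists_own hok (show 1 ≤ k by omega) (by rw [e1]; simp; omega)
      obtain ⟨u', v', e3, e4⟩ := (hsound n hn).token
      have e5 := (List.append_inj' (e1.symm.trans e3) (by simp; omega)).2
      have hnum : n.kind = .var ∨ ∃ b, n.kind = .bit b := by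
        rcases l with _ | ⟨b, l⟩
        · simp at e5; exact Or.inl e5.1.symm
        · simp at e5; exact Or.inr ⟨b, e5.1.symm⟩
      obtain ⟨i, e6, u'', v'', e7, e8⟩ := (hsound n hn).numeral hnum
      have e9 := (List.append_inj' (e1.symm.trans e7) (by simp; omega)).2
      refine ⟨i, (encodeVar_prefix _ _ _ _ e9).1, ?_⟩
      rw [← hnk, (bit_node hok hn X).1.2, e6]
    obtain ⟨i, e1, e2⟩ := key k hk
    obtain ⟨i', e1', e2'⟩ := key k' hk'
    obtain rfl := encodeNat_injective (e1.symm.trans e1')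
    exact Bool.eq_iff_iff.2 (e2.trans e2'.symm)
  -- `X` is below `1 ⊗ X`, so the two are consistent; refining the factor `1` yields a unit type.
  · have : TypeRel Φ X .one X := fun h =>
      hX.consistent ((Le.le_and .refl .le_one_tensor).trans h)
    obtain ⟨e, he, h1, h2⟩ := exists_type_left (closureList w) this
    exact ⟨_, hal e he, (bit_zero hok e).2 h1, h2.related hok hX he hX⟩
  · have : TypeRel Φ X X .one := fun h =>
      hX.consistent ((Le.le_and .refl .le_tensor_one).trans h)
    obtain ⟨e, he, h1, h2⟩ := exists_type_right (closureList w) this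
    exact ⟨_, hal e he, (bit_zero hok e).2 h1, h2.related hok hX hX he⟩
  · have ha : n.kind.arity = 2 ∧ n.own.2 = .tensor n.fst.2 n.snd.2 := by
      have := (hsound n hn).formula
      rcases hkind : n.kind <;> simp [hkind, Token.isTensor] at ht <;> rw [hkind] at this <;>
        exact ⟨rfl, this⟩
    rw [(bit_node hok hn X).1.2, ha.2] at hb
    have : TypeRel Φ X n.fst.2 n.snd.2 := fun h => hX.consistent ((Le.le_and .refl hb).trans h)
    obtain ⟨x, hx, h1, h2⟩ := exists_type_left (closureList w) this
    obtain ⟨y, hy, h3, h4⟩ := exists_type_right (closureList w) h2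
    exact ⟨_, _, hal x hx, hal y hy, h4.related hok hX hx hy,
      ((bit_node hok hn x).2.1 (by omega)).2.2 h1, ((bit_node hok hn y).2.2 (by omega)).2.2 h3⟩
  · have ha : n.kind.arity = 2 := by rw [ht]; rfl
    have hf := (hsound n hn).formula
    rw [ht] at hf
    rw [← Bool.not_eq_true, (bit_node hok hn X).1.2, hf] at hb
    -- If `A ⊗ X` were inconsistent with `¬B`, it would be below `B`, and `X` would be below `A ⊸
    -- B`. Refining `A` and then `¬B` gives the counterexample.
    have : TypeRel Φ (.neg n.snd.2) n.fst.2 X := fun h => hb (.le_under (.le_of_neg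
      ((Le.le_and .and_right .and_left).trans h)))
    obtain ⟨x, hx, h1, h2⟩ := exists_type_left (closureList w) this
    obtain ⟨z, hz, h3, h4⟩ := exists_type_result (closureList w) h2
    have hm := (bit_node (Φ := Φ) hok hn z).2.2 (by omega)
    refine ⟨_, _, hal x hx, hal z hz, h4.related hok hz hx hX,
      ((bit_node hok hn x).2.1 (by omega)).2.2 h1, ?_⟩
    rw [← Bool.not_eq_true, hm.2]
    exact (hz.le_iff hm.1).1 h3
  · have ha : n.kind.arity = 2 := by rw [ht]; rfl
    have hf := (hsound n hn).formula
    rw [ht] at hf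
    rw [← Bool.not_eq_true, (bit_node hok hn X).1.2, hf] at hb
    have : TypeRel Φ (.neg n.fst.2) X n.snd.2 := fun h => hb (.le_over (.le_of_neg
      ((Le.le_and .and_right .and_left).trans h)))
    obtain ⟨y, hy, h1, h2⟩ := exists_type_right (closureList w) this
    obtain ⟨z, hz, h3, h4⟩ := exists_type_result (closureList w) h2
    have hm := (bit_node (Φ := Φ) hok hn z).2.1 (by omega)
    refine ⟨_, _, hal y hy, hal z hz, h4.related hok hz hX hy,
      ((bit_node hok hn y).2.2 (by omega)).2.2 h1, ?_⟩
    rw [← Bool.not_eq_true, hm.2]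
    exact (hz.le_iff hm.1).1 h3

end

theorem decideConsequence_iff (w : List Token) :
    decideConsequence w = true ↔ w ∈ finitaryConsequence := by
  constructor
  · intro h
    have hacc : (parse w).accepts = true := by
      simp only [decideConsequence, final, Fm.eval, Bool.and_eq_true] at h
      exact h.1.1
    obtain ⟨Φ, s, hw⟩ := exists_eq_encodeInstance hacc
    refine ⟨Φ, s, hw, ?_⟩
    by_contra hd
    have hI : (parse w).IsInstance Φ s := hw ▸ parse_encodeInstance s Φ
    -- Canonical types are present at the start and support each other in every round.
    have htab : ∀ k X, IsType {t | t ∈ Φ} (closureList w) X →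
        table w k (typeWord {t | t ∈ Φ} w X) = true := by
      intro k
      induction k with
      | zero => intro X _; simp [table, typeWord]
      | succ k ih =>
        intro X hX
        simp only [table, Bool.and_eq_true, decide_eq_true_eq]
        refine ⟨by simp [typeWord], (eval_keep hacc fun _ => table_length).2 ?_⟩
        exact kept_typeWord hw ih hX
    rw [derivable_iff_le] at hd
    obtain ⟨X, hX, h1, h2⟩ := exists_type (closureList w) hd
    obtain ⟨n, hn, e1, e2, e3, e4⟩ := hI.goal
    have := (eval_final hacc fun _ => table_length).1 h _ (htab _ X hX) n hn e1 e2
    rw [((bit_node hI.ok hn X).2.1 (by rw [e1]; simp [Token.arity])).2,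
      ((bit_node hI.ok hn X).2.2 (by rw [e1]; simp [Token.arity])).2, e3, e4] at this
    exact h2 (this h1)
  · rintro ⟨Φ, s, hw, hd⟩
    have hI : (parse w).IsInstance Φ s := hw ▸ parse_encodeInstance s Φ
    have hacc : (parse w).accepts = true := by simp [PState.accepts, hI.ok, hI.past, hI.stack]
    refine (eval_final hacc fun _ => table_length).2 fun X hX n hn h1 h2 h3 => ?_
    refine goal_of_derivable hw (fun _ => table_length) (fun Y hY => ?_) hd hX hn h1 h2 h3
    -- At the fixed point the survivors are kept with respect to the very table they form, as the
    -- frame construction requires.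
    rw [← table_stable] at hY
    simp only [table, Bool.and_eq_true] at hY
    exact (eval_keep hacc fun _ => table_length).1 hY.2

/-! ### The stack machine -/

/-- The stacks of the machine. -/
inductive Stk : Type
  | inp | main | back | items | name₁ | name₂ | tab | tabBack | next | out
  deriving DecidableEq

instance : Fintype Stk :=
  ⟨{.inp, .main, .back, .items, .name₁, .name₂, .tab, .tabBack, .next, .out},
    fun x => by cases x <;> simp⟩

/-- A token (`none` for position `0`) together with the bits of the variables at its position. -/
abbrev Cell : Type := Option Token × Bits

/-- The stack alphabets. -/
abbrev Stk.Alphabet : Stk → Type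
  | .inp => Token
  | .main => Cell
  | .back => Cell
  | .items => Srt × Bits
  | _ => Bool

/-- The register of the machine. -/
structure Reg : Type where
  flag : Bool := false
  carry : Bool := false
  res : Bits := fun _ => true
  cell : Option Cell := none
  unit : Bits := fun _ => false
  ok : Bool := false
  past : Bool := false
  good : Bool := false
  empty : Bool := false
  item₁ : Option (Srt × Bits) := none
  item₂ : Option (Srt × Bits) := none
  new : Option (Srt × Bits) := none
  ext₁ : Bool × Bool × Bool := (false, false, false)
  ext₂ : Bool × Bool × Bool := (false, false, false)
  bit₁ : Option Bool := none
  bit₂ : Option Bool := none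

instance : Finite Reg :=
  Finite.of_injective (fun r : Reg => (r.flag, r.carry, r.res, r.cell, r.unit, r.ok, r.past,
    r.good, r.empty, r.item₁, r.item₂, r.new, r.ext₁, r.ext₂, r.bit₁, r.bit₂)) fun r s h => by
      cases r; cases s; simpa using h

/-- Programs of the machine. -/
abbrev Prog : Type := StackProg Stk.Alphabet Reg

/-- The states of the machine. -/
structure St : Type where
  reg : Reg := {}
  inp : List Token := []
  main : List Cell := []
  back : List Cell := []
  items : List (Srt × Bits) := []
  name₁ : List Bool := []
  name₂ : List Bool := []
  tab : List Bool := []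
  tabBack : List Bool := []
  next : List Bool := []
  out : List Bool := []

/-- The contents of a stack. -/
def St.stk (a : St) : ∀ k : Stk, List k.Alphabet
  | .inp => a.inp
  | .main => a.main
  | .back => a.back
  | .items => a.items
  | .name₁ => a.name₁
  | .name₂ => a.name₂
  | .tab => a.tab
  | .tabBack => a.tabBack
  | .next => a.next
  | .out => a.out

/-- Replace the contents of a stack. -/
def St.set (a : St) : ∀ k : Stk, List k.Alphabet → St
  | .inp, l => { a with inp := l }
  | .main, l => { a with main := l }
  | .back, l => { a with back := l }
  | .items, l => { a with items := l }
  | .name₁, l => { a with name₁ := l }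
  | .name₂, l => { a with name₂ := l }
  | .tab, l => { a with tab := l }
  | .tabBack, l => { a with tabBack := l }
  | .next, l => { a with next := l }
  | .out, l => { a with out := l }

theorem St.stk_set (a : St) (k : Stk) (l : List k.Alphabet) :
    (a.set k l).stk = Function.update a.stk k l := by
  funext k'
  cases k <;> cases k' <;> rfl

theorem St.reg_set (a : St) (k : Stk) (l : List k.Alphabet) : (a.set k l).reg = a.reg := by
  cases k <;> rfl

theorem St.stk_reg (a : St) (r : Reg) : ({ a with reg := r } : St).stk = a.stk := by
  funext k
  cases k <;> rfl

/-! ### Running times of programs. -/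

/-- The program `c` leads from state `a` to state `b` in at most `T` steps. -/
def Runs (c : Prog) (a b : St) (T : ℕ) : Prop := ∃ t ≤ T, c.Exec a.reg a.stk b.reg b.stk t

/-- The effect of a program without loops. -/
def run : Prog → St → St
  | .pop k f, a => { a.set k (a.stk k).tail with reg := f a.reg (a.stk k).head? }
  | .peek k f, a => { a with reg := f a.reg (a.stk k).head? }
  | .push k f, a => a.set k (f a.reg :: a.stk k)
  | .load f, a => { a with reg := f a.reg }
  | .seq c d, a => run d (run c a)
  | .ite p c d, a => if p a.reg then run c a else run d a
  | .loop _ _, a => a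

/-- A program without loops. -/
def Straight : Prog → Bool
  | .seq c d => Straight c && Straight d
  | .ite _ c d => Straight c && Straight d
  | .loop _ _ => false
  | _ => true

/-- A bound for the number of steps of a program without loops. -/
def cost : Prog → ℕ
  | .seq c d => cost c + cost d
  | .ite _ c d => cost c + cost d + 1
  | _ => 1

theorem Runs.mono {c : Prog} {a b : St} {T T' : ℕ} (h : Runs c a b T) (hT : T ≤ T') :
    Runs c a b T' := by
  obtain ⟨t, ht, h⟩ := h
  exact ⟨t, ht.trans hT, h⟩

theorem Runs.seq {c d : Prog} {a b e : St} {T U : ℕ} (h₁ : Runs c a b T) (h₂ : Runs d b e U) :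
    Runs (.seq c d) a e (T + U) := by
  obtain ⟨t, ht, h₁⟩ := h₁
  obtain ⟨u, hu, h₂⟩ := h₂
  exact ⟨t + u, Nat.add_le_add ht hu, h₁.seq h₂⟩

theorem Runs.loop_true {p : Reg → Bool} {c : Prog} {a b e : St} {T U : ℕ} (hp : p a.reg = true)
    (h₁ : Runs c a b T) (h₂ : Runs (.loop p c) b e U) : Runs (.loop p c) a e (T + U + 1) := by
  obtain ⟨t, ht, h₁⟩ := h₁
  obtain ⟨u, hu, h₂⟩ := h₂
  exact ⟨t + u + 1, by omega, .loop_true hp h₁ h₂⟩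

theorem Runs.loop_false {p : Reg → Bool} {c : Prog} {a : St} (hp : p a.reg = false) :
    Runs (.loop p c) a a 1 := ⟨1, le_rfl, .loop_false hp⟩

theorem runs_run : ∀ (c : Prog), Straight c = true → ∀ a, Runs c a (run c a) (cost c)
  | .pop k f, _, a => ⟨1, le_rfl, by
      have := StackProg.Exec.pop k f a.reg a.stk
      simpa only [run, St.stk_reg, St.stk_set] using this⟩
  | .peek k f, _, a => ⟨1, le_rfl, by
      have := StackProg.Exec.peek k f a.reg a.stk
      simpa only [run, St.stk_reg] using this⟩
  | .push k f, _, a => ⟨1, le_rfl, by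
      have := StackProg.Exec.push k f a.reg a.stk
      simpa only [run, St.reg_set, St.stk_set] using this⟩
  | .load f, _, a => ⟨1, le_rfl, by
      have := StackProg.Exec.load f a.reg a.stk
      simpa only [run, St.stk_reg] using this⟩
  | .seq c d, h, a => by
    simp only [Straight, Bool.and_eq_true] at h
    exact (runs_run c h.1 a).seq (runs_run d h.2 _)
  | .ite p c d, h, a => by
    simp only [Straight, Bool.and_eq_true] at h
    by_cases hp : p a.reg = true
    · obtain ⟨t, ht, h'⟩ := runs_run c h.1 a
      refine ⟨t + 1, by simp only [cost]; omega, ?_⟩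
      simp only [run, hp, if_true]
      exact .ite_true hp h'
    · obtain ⟨t, ht, h'⟩ := runs_run d h.2 a
      refine ⟨t + 1, by simp only [cost]; omega, ?_⟩
      simp only [run, hp]
      exact .ite_false (by simpa using hp) h'

/-- `Runs` with a bound that is a multiple of `2 ^ m`. -/
def Quick (m C : ℕ) (c : Prog) (a b : St) : Prop := Runs c a b (C * 2 ^ m)

theorem Quick.seq {m C D : ℕ} {c d : Prog} {a b e : St} (h₁ : Quick m C c a b)
    (h₂ : Quick m D d b e) : Quick m (C + D) (.seq c d) a e := by
  unfold Quick at *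
  rw [Nat.add_mul]
  exact Runs.seq h₁ h₂

theorem Quick.of_run {m : ℕ} {c : Prog} (hc : Straight c = true) {a b : St} (h : run c a = b) :
    Quick m (cost c) c a b :=
  h ▸ (runs_run c hc a).mono (Nat.le_mul_of_pos_right _ (by positivity))

/-- A loop without inner loops that reads a list. -/
theorem Quick.scan {m : ℕ} {p : Reg → Bool} {c : Prog} (hc : Straight c = true) {α β : Type}
    (F : β → List α → St) (g : β → α → β) (h₁ : ∀ b x l, p (F b (x :: l)).reg = true)
    (h₂ : ∀ b, p (F b []).reg = false) (h₃ : ∀ b x l, run c (F b (x :: l)) = F (g b x) l)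
    (b : β) (l : List α) (hl : l.length ≤ 2 ^ m) {s s' : St} (hs : s = F b l)
    (hs' : F (l.foldl g b) [] = s') : Quick m (cost c + 2) (.loop p c) s s' := by
  subst hs hs'
  have key : ∀ (l : List α) (b : β), Runs (.loop p c) (F b l) (F (l.foldl g b) [])
      (l.length * (cost c + 1) + 1) := by
    intro l
    induction l with
    | nil => exact fun b => (Runs.loop_false (h₂ b)).mono (by simp)
    | cons x l ih =>
      intro b
      refine (Runs.loop_true (h₁ b x l) ((h₃ b x l) ▸ runs_run c hc _) (ih (g b x))).mono ?_
      simp only [List.length_cons]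
      linarith
  refine (key l b).mono ?_
  have := Nat.mul_le_mul_right (cost c + 1) hl
  have : 0 < 2 ^ m := by positivity
  linarith

/-! ### States between the subprograms -/

/-- The tokens of a word from right to left, after a dummy for position `0`. -/
def toks (w : List Token) : List (Option Token) := none :: w.reverse.map some

/-- The cells for a list of tokens. -/
def cells (E : Env) : List (Option Token) → List Cell
  | [] => []
  | t :: ts => (t, E.bits 0) :: cells (fun i => (E i).tail) ts

theorem length_cells (ts : List (Option Token)) : ∀ E : Env, (cells E ts).length = ts.length := by
  induction ts with
  | nil => exact fun _ => rfl
  | cons t ts ih => exact fun E => by simp [cells, ih]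

theorem cells_drop_cons (E : Env) (k : ℕ) (t : Option Token) (ts : List (Option Token)) :
    cells (fun i => (E i).drop k) (t :: ts) =
      (t, E.bits k) :: cells (fun i => (E i).drop (k + 1)) ts := by
  simp only [cells, List.tail_drop]
  congr 2
  funext i
  simp [Env.bits, bit]

theorem cells_append (ts ts' : List (Option Token)) : ∀ E : Env,
    cells E (ts ++ ts') = cells E ts ++ cells (fun i => (E i).drop ts.length) ts' := by
  induction ts with
  | nil => simp [cells]
  | cons t ts ih => simp [cells, ih]

/-- The stack `back` holds the cells already read, latest on top; reading `t` in front of `w` adds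
the cell for position `w.length + 1`. -/
theorem reverse_cells_cons (E : Env) (w : List Token) (t : Token) :
    (cells E (toks (t :: w))).reverse =
      (some t, E.bits (w.length + 1)) :: (cells E (toks w)).reverse := by
  have : toks (t :: w) = toks w ++ [some t] := by simp [toks]
  have h : Env.bits (fun i => (E i).drop (w.length + 1)) 0 = E.bits (w.length + 1) := by
    funext i
    simp [Env.bits, bit]
  rw [this, cells_append]
  simp [toks, cells, h]

/-- What the machine stores between the subprograms. -/
structure View : Type where
  env : Env
  flag : Bool
  carry : Bool
  res : Bits
  tab : List Bool
  tabBack : List Bool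
  next : List Bool

/-- The state of the machine. -/
def View.st (w : List Token) (v : View) : St where
  reg := { flag := v.flag, carry := v.carry, res := v.res }
  main := cells v.env (toks w)
  tab := v.tab
  tabBack := v.tabBack
  next := v.next

/-- The program `c` realizes the relation `R`, in exponential time. -/
def Spec (c : Prog) (R : List Token → View → View → Prop) : Prop :=
  ∃ p : Polynomial ℕ, ∀ w v v', R w v v' → Runs c (v.st w) (v'.st w) (2 ^ p.eval w.length)

theorem Spec.mono {c : Prog} {R R' : List Token → View → View → Prop} (h : Spec c R)
    (hR : ∀ w v v', R' w v v' → R w v v') : Spec c R' := by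
  obtain ⟨p, h⟩ := h
  exact ⟨p, fun w v v' h' => h w v v' (hR w v v' h')⟩

theorem Spec.of_quick {c : Prog} {R : List Token → View → View → Prop} {C : ℕ}
    (h : ∀ w v v', R w v v' → Quick (w.length + 1) C c (v.st w) (v'.st w)) : Spec c R := by
  -- The constant factor goes into the exponent, as `C < 2 ^ C`.
  refine ⟨.X + .C (C + 1), fun w v v' h' => (h w v v' h').mono ?_⟩
  simp only [Polynomial.eval_add, Polynomial.eval_X, Polynomial.eval_C]
  rw [show w.length + (C + 1) = C + (w.length + 1) by ring, pow_add 2 C]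
  exact Nat.mul_le_mul_right _ Nat.lt_two_pow_self.le

theorem Spec.of_run {c : Prog} (hc : Straight c = true) :
    Spec c fun w v v' => run c (v.st w) = v'.st w :=
  .of_quick fun _ _ _ h => .of_run hc h

theorem two_pow_add_le (a b : ℕ) : 2 ^ a + 2 ^ b + 1 ≤ 2 ^ (a + b + 2) := by
  have h1 : 1 ≤ 2 ^ a := Nat.one_le_two_pow
  have h2 : 1 ≤ 2 ^ b := Nat.one_le_two_pow
  rw [pow_add, pow_add]
  nlinarith

theorem Spec.seq {c d : Prog} {R R' : List Token → View → View → Prop} (h : Spec c R)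
    (h' : Spec d R') : Spec (.seq c d) fun w v v'' => ∃ v', R w v v' ∧ R' w v' v'' := by
  obtain ⟨p, h⟩ := h
  obtain ⟨q, h'⟩ := h'
  refine ⟨p + q + 2, fun w v v'' ⟨v', h₁, h₂⟩ => ((h w v v' h₁).seq (h' w v' v'' h₂)).mono ?_⟩
  have := two_pow_add_le (p.eval w.length) (q.eval w.length)
  simp only [Polynomial.eval_add, Polynomial.eval_ofNat]
  omega

theorem Spec.ite {p : Reg → Bool} {c d : Prog} {R R' : List Token → View → View → Prop}
    (h : Spec c R) (h' : Spec d R') : Spec (.ite p c d) fun w v v' =>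
      (p (v.st w).reg = true → R w v v') ∧ (p (v.st w).reg = false → R' w v v') := by
  obtain ⟨P, h⟩ := h
  obtain ⟨Q, h'⟩ := h'
  refine ⟨P + Q + 2, fun w v v' ⟨h₁, h₂⟩ => ?_⟩
  have := two_pow_add_le (P.eval w.length) (Q.eval w.length)
  simp only [Polynomial.eval_add, Polynomial.eval_ofNat]
  rcases hp : p (v.st w).reg
  · obtain ⟨t, ht, h⟩ := h' w v v' (h₂ hp)
    exact ⟨t + 1, by have := Nat.two_pow_pos (P.eval w.length); have := Nat.two_pow_pos (Q.eval w.length); omega, .ite_false hp h⟩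
  · obtain ⟨t, ht, h⟩ := h w v v' (h₁ hp)
    exact ⟨t + 1, by have := Nat.two_pow_pos (P.eval w.length); have := Nat.two_pow_pos (Q.eval w.length); omega, .ite_true hp h⟩

/-! ### Reading the main stack -/

/-- Put the cell in the register on the stack `back` and take the next one. -/
def advance : Prog :=
  .seq (.push .back fun r => r.cell.getD (none, fun _ => false))
    (.pop .main fun r x => { r with cell := x })

/-- Move the cells from the stack `back` to the main stack. -/
def rewind : Prog :=
  .seq (.pop .back fun r x => { r with cell := x })
    (.loop (fun r => r.cell.isSome) (.seq
      (.push .main fun r => r.cell.getD (none, fun _ => false))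
      (.pop .back fun r x => { r with cell := x })))

theorem length_toks (w : List Token) : (toks w).length = w.length + 1 := by simp [toks]

theorem quick_rewind {m : ℕ} {a b : St} {l : List Cell} (hl : l.length ≤ 2 ^ m)
    (ha : a.reg.cell = none) (ha' : a.main = []) (hb : a.back = l.reverse)
    (h : b = { a with main := l, back := [] }) :
    Quick m (1 + (2 + 2)) rewind a b := by
  refine .seq (.of_run rfl rfl) (.scan rfl (fun s l => ({ a with
    reg := { a.reg with cell := l.head? }, main := s, back := l.tail } : St)) (fun s x => x :: s)
    (fun _ _ _ => rfl) (fun _ => rfl) (fun _ _ _ => rfl) [] l.reverse (by simpa using hl) ?_ ?_)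
  · simp [run, St.stk, St.set, hb, ha']
  · subst h
    simp [← ha]

/-- Does the word in variable `4` agree with that in variable `i`? -/
def compare (i : Fin 6) : Prog :=
  .seq (.seq (.load fun r => { r with carry := true }) (.pop .main fun r x => { r with cell := x }))
    (.seq (.loop (fun r => r.cell.isSome) (.seq (.load fun r => { r with
      carry := r.carry && (r.cell.map fun x => x.2 4 == x.2 i).getD false }) advance)) rewind)

theorem foldl_compare (i : Fin 6) (ts : List (Option Token)) : ∀ (E : Env) (b : Bool × List Cell),
    (E 4).length = ts.length → (E i).length = ts.length →
    (cells E ts).foldl (fun b x => (b.1 && x.2 4 == x.2 i, x :: b.2)) b =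
      (b.1 && decide (E 4 = E i), (cells E ts).reverse ++ b.2) := by
  induction ts with
  | nil =>
    intro E b h h'
    simp only [List.length_nil, List.length_eq_zero_iff] at h h'
    simp [cells, h, h']
  | cons t ts ih =>
    intro E b h h'
    obtain ⟨x, l, hx⟩ := List.exists_cons_of_length_eq_add_one h
    obtain ⟨y, l', hy⟩ := List.exists_cons_of_length_eq_add_one h'
    simp only [cells, List.foldl_cons]
    rw [ih _ _ (by simp [h]) (by simp [h'])]
    cases x <;> cases y <;> simp [hx, hy, Env.bits, bit]

theorem spec_compare (i : Fin 6) : Spec (compare i) fun w v v' =>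
    (v.env 4).length = w.length + 1 ∧ (v.env i).length = w.length + 1 ∧
      v' = { v with carry := decide (v.env 4 = v.env i) } := by
  apply Spec.of_quick
  rintro w v v' ⟨h, h', hv⟩
  subst hv
  have hm : (cells v.env (toks w)).length ≤ 2 ^ (w.length + 1) := by
    rw [length_cells, length_toks]; exact Nat.lt_two_pow_self.le
  refine .seq (.of_run rfl rfl) (.seq (.scan rfl (fun (b : Bool × List Cell) l => ({ v.st w with
    reg := { (v.st w).reg with cell := l.head?, carry := b.1 }, main := l.tail, back := b.2 } : St))
    (fun b x => (b.1 && x.2 4 == x.2 i, x :: b.2))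
    (fun _ _ _ => rfl) (fun _ => rfl) (fun _ _ _ => rfl) (true, []) (cells v.env (toks w)) hm rfl rfl)
    (quick_rewind hm rfl rfl ?_ ?_))
  all_goals rw [foldl_compare i _ _ _ (by rw [h, length_toks]) (by rw [h', length_toks])]
  · simp
  · simp [View.st]

/-- Increase a binary number. -/
def incr : List Bool → Bool → List Bool × Bool
  | [], c => ([], c)
  | b :: l, c => ((b != c) :: (incr l (b && c)).1, (incr l (b && c)).2)

/-- Increase the word in variable `i`. -/
def increase (i : Fin 6) : Prog :=
  .seq (.seq (.load fun r => { r with carry := true }) (.pop .main fun r x => { r with cell := x }))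
    (.seq (.loop (fun r => r.cell.isSome) (.seq (.load fun r => { r with
      carry := (r.cell.map fun x => x.2 i).getD false && r.carry
      cell := r.cell.map fun x => (x.1, Function.update x.2 i (x.2 i != r.carry)) }) advance)) rewind)

/-- Addition with ripple carry: the main stack shows position `0`, the least significant bit, first.
-/
theorem foldl_increase (i : Fin 6) (ts : List (Option Token)) : ∀ (E : Env) (b : Bool × List Cell),
    (E i).length = ts.length →
    (cells E ts).foldl (fun b x => (x.2 i && b.1,
      (x.1, Function.update x.2 i (x.2 i != b.1)) :: b.2)) b =
      ((incr (E i) b.1).2, (cells (Function.update E i (incr (E i) b.1).1) ts).reverse ++ b.2) := by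
  induction ts with
  | nil =>
    intro E b h
    simp only [List.length_nil, List.length_eq_zero_iff] at h
    simp [cells, h, incr]
  | cons t ts ih =>
    intro E b h
    obtain ⟨x, l, hx⟩ := List.exists_cons_of_length_eq_add_one h
    simp only [cells, List.foldl_cons]
    rw [ih _ _ (by simp [h])]
    have e₁ : (fun j => (Function.update E i (incr (E i) b.1).1 j).tail) =
        Function.update (fun j => (E j).tail) i (incr (E i).tail (E.bits 0 i && b.1)).1 := by
      funext j
      by_cases hj : j = i
      · subst hj
        simp [hx, incr, Env.bits, bit]
      · simp [Function.update_of_ne hj]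
    have e₂ : Env.bits (Function.update E i (incr (E i) b.1).1) 0 =
        Function.update (E.bits 0) i (E.bits 0 i != b.1) := by
      funext j
      by_cases hj : j = i
      · subst hj
        simp [hx, incr, Env.bits, bit]
      · simp [Env.bits, Function.update_of_ne hj]
    rw [e₁, e₂]
    simp [hx, incr, Env.bits, bit]

theorem spec_increase (i : Fin 6) : Spec (increase i) fun w v v' =>
    (v.env i).length = w.length + 1 ∧
      v' = { v with env := Function.update v.env i (incr (v.env i) true).1,
                    carry := (incr (v.env i) true).2 } := by
  apply Spec.of_quick
  rintro w v v' ⟨h, hv⟩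
  subst hv
  have hm : ∀ E : Env, (cells E (toks w)).length ≤ 2 ^ (w.length + 1) := fun E => by
    rw [length_cells, length_toks]; exact Nat.lt_two_pow_self.le
  refine .seq (.of_run rfl rfl) (.seq (.scan rfl (fun (b : Bool × List Cell) l => ({ v.st w with
    reg := { (v.st w).reg with cell := l.head?, carry := b.1 }, main := l.tail, back := b.2 } : St))
    (fun b x => (x.2 i && b.1, (x.1, Function.update x.2 i (x.2 i != b.1)) :: b.2))
    (fun _ _ _ => rfl) (fun _ => rfl) (fun _ _ _ => rfl) (true, []) (cells v.env (toks w)) (hm _)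
    rfl rfl)
    (quick_rewind (hm (Function.update v.env i (incr (v.env i) true).1)) rfl rfl ?_ ?_))
  all_goals rw [foldl_increase i _ _ _ (by rw [h, length_toks])]
  · simp
  · simp [View.st]

/-! ### Enumerating the words of bits -/

theorem incr_false (l : List Bool) : incr l false = (l, false) := by
  induction l with
  | nil => rfl
  | cons b l ih => simp [incr, ih]

/-- Every word is the successor of the previous one, and the last one overflows to `z`. -/
def Linked (z : List Bool) : List (List Bool) → Prop
  | [] => True
  | [X] => incr X true = (z, true)
  | X :: Y :: L => incr X true = (Y, false) ∧ Linked z (Y :: L)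

/-- From `0l` to `1l` no carry leaves the lowest bit; from `1l` to the next word the carry increases
`l`. -/
theorem Linked.flatMap {z : List Bool} : ∀ {L : List (List Bool)}, Linked z L →
    Linked (false :: z) (L.flatMap fun l => [false :: l, true :: l])
  | [], _ => trivial
  | [X], h => by
    simp only [Linked] at h
    simp [Linked, incr, incr_false, h]
  | X :: Y :: L, h => by
    have ih := h.2.flatMap
    simp only [List.flatMap_cons, List.cons_append, List.nil_append] at ih ⊢
    exact ⟨by simp [incr, incr_false], by simp [incr, h.1], ih⟩

theorem linked_enum (m : ℕ) : Linked (List.replicate m false) (enum m) := by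
  induction m with
  | zero => rfl
  | succ m ih => exact ih.flatMap

theorem enum_eq_cons (m : ℕ) : ∃ L, enum m = List.replicate m false :: L := by
  induction m with
  | zero => exact ⟨[], rfl⟩
  | succ m ih =>
    obtain ⟨L, h⟩ := ih
    exact ⟨_, by rw [enum, h]; rfl⟩

/-- Change the word in variable `i`. -/
def View.at (v : View) (i : Fin 6) (X : List Bool) : View :=
  { v with env := Function.update v.env i X }

/-- Run `body` with all words in variable `i`. -/
def each (i : Fin 6) (body : Prog) : Prog :=
  .seq (.loop (fun r => !r.carry) (.seq body (increase i)))
    (.load fun r => { r with carry := false })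

/-- `V` is the loop invariant, as a function of the words already treated. The carry is the stopping
flag: only the last word overflows, and the counter is then back at `0 … 0`. There are `2 ^ (|w| +
1)` passes, which the exponent absorbs. -/
theorem Spec.each {i : Fin 6} {body : Prog} {R : List Token → View → View → Prop}
    (h : Spec body R) : Spec (each i body) fun w v v' => ∃ V : List (List Bool) → View,
      (∀ done, (V done).carry = false) ∧
      (∀ done X todo, enum (w.length + 1) = done ++ X :: todo →
        R w ((V done).at i X) ((V (done ++ [X])).at i X)) ∧
      v = (V []).at i (List.replicate (w.length + 1) false) ∧
      v' = (V (enum (w.length + 1))).at i (List.replicate (w.length + 1) false) := by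
  obtain ⟨p, h⟩ := h
  obtain ⟨q, hq⟩ := spec_increase i
  refine ⟨.X + p + q + 5, fun w v v' ⟨V, hV, hR, hv, hv'⟩ => ?_⟩
  set m := w.length + 1
  have loop : ∀ (todo done : List (List Bool)) (X : List Bool), enum m = done ++ X :: todo →
      Linked (List.replicate m false) (X :: todo) →
      Runs (.loop (fun r => !r.carry) (.seq body (increase i))) (((V done).at i X).st w)
        (({ V (enum m) with carry := true } : View).at i (List.replicate m false) |>.st w)
        ((todo.length + 1) * (2 ^ p.eval w.length + 2 ^ q.eval w.length + 1) + 1) := by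
    intro todo
    induction todo with
    | nil =>
      intro done X hX hL
      have h₁ := h w _ _ (hR done X [] hX)
      have h₂ := hq w ((V (done ++ [X])).at i X)
        (({ V (enum m) with carry := true } : View).at i (List.replicate m false)) ⟨by
          simpa [View.at] using mem_enum.1 (hX ▸ by simp : X ∈ enum m), by
          rw [← hX]
          have hL : incr X true = _ := hL
          simp [View.at, hL]⟩
      refine (Runs.loop_true (by simp [View.st, View.at, hV]) (h₁.seq h₂)
        (Runs.loop_false (by simp [View.st, View.at]))).mono ?_
      simp
    | cons Y todo ih =>
      intro done X hX hL
      have h₁ := h w _ _ (hR done X _ hX)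
      have h₂ := hq w ((V (done ++ [X])).at i X) ((V (done ++ [X])).at i Y) ⟨by
          simpa [View.at] using mem_enum.1 (hX ▸ by simp : X ∈ enum m), by
          have := hL.1
          have := hV (done ++ [X])
          cases hV' : V (done ++ [X])
          simp_all [View.at]⟩
      refine (Runs.loop_true (by simp [View.st, View.at, hV]) (h₁.seq h₂)
        (ih (done ++ [X]) Y (by simp [hX]) hL.2)).mono ?_
      simp only [List.length_cons]
      linarith
  obtain ⟨L, hL⟩ := enum_eq_cons m
  have h₁ := loop L [] _ hL (hL ▸ linked_enum m)
  have h₂ := runs_run (.load fun r => { r with carry := false }) rfl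
    (({ V (enum m) with carry := true } : View).at i (List.replicate m false) |>.st w)
  have he : run (.load fun r => { r with carry := false })
      (({ V (enum m) with carry := true } : View).at i (List.replicate m false) |>.st w) =
      v'.st w := by
    have := hV (enum m)
    subst hv'
    simp [run, View.st, View.at, this]
  rw [he] at h₂
  subst hv
  refine (h₁.seq h₂).mono ?_
  have hl : L.length + 1 = 2 ^ m := by
    rw [← length_enum, hL, List.length_cons]
  rw [hl]
  simp only [Polynomial.eval_add, Polynomial.eval_ofNat, Polynomial.eval_X]
  rw [show w.length + p.eval w.length + q.eval w.length + 5 =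
    m + (p.eval w.length + q.eval w.length + 2) + 2 by omega, pow_add 2 _ 2, pow_add 2 m]
  have h3 := Nat.mul_le_mul_left (2 ^ m)
    (two_pow_add_le (p.eval w.length) (q.eval w.length))
  have h4 : 1 ≤ 2 ^ m * 2 ^ (p.eval w.length + q.eval w.length + 2) := by
    rw [← pow_add]; exact Nat.one_le_two_pow
  simp only [cost]
  omega

/-! ### The table of types as a stack of bits. -/

/-- Is the word in variable `i` in the table? -/
def lookup (i : Fin 6) : Prog :=
  .seq (.load fun r => { r with flag := false }) (each 4 (.seq (compare i)
    (.seq (.pop .tab fun r x => { r with bit₁ := x })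
    (.seq (.push .tabBack fun r => r.bit₁.getD false) (.load fun r => { r with
      flag := r.flag || (r.carry && r.bit₁.getD false), carry := false, bit₁ := none })))))

/-- Move the contents of a stack to the stack `tab`. -/
def restore (k : Stk) (hk : k.Alphabet = Bool) : Prog :=
  .seq (.pop k fun r x => { r with bit₁ := hk ▸ x })
    (.loop (fun r => r.bit₁.isSome) (.seq (.push .tab fun r => r.bit₁.getD false)
      (.pop k fun r x => { r with bit₁ := hk ▸ x })))

/-- Delete the contents of the stack `tab`. -/
def clear : Prog :=
  .seq (.pop .tab fun r x => { r with bit₁ := x })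
    (.loop (fun r => r.bit₁.isSome) (.pop .tab fun r x => { r with bit₁ := x }))

theorem spec_restore_tabBack : Spec (restore .tabBack rfl) fun w v v' =>
    v.tabBack.length ≤ 2 ^ (w.length + 1) ∧
      v' = { v with tab := v.tabBack.reverse ++ v.tab, tabBack := [] } := by
  apply Spec.of_quick
  rintro w v v' ⟨h, hv⟩
  subst hv
  exact .seq (.of_run rfl rfl) (.scan rfl (fun s l => ({ v.st w with
    reg := { (v.st w).reg with bit₁ := l.head? }, tab := s, tabBack := l.tail } : St))
    (fun s x => x :: s) (fun _ _ _ => rfl) (fun _ => rfl) (fun _ _ _ => rfl) v.tab v.tabBack h rfl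
    (by simp [View.st]))

theorem spec_restore_next : Spec (restore .next rfl) fun w v v' =>
    v.next.length ≤ 2 ^ (w.length + 1) ∧
      v' = { v with tab := v.next.reverse ++ v.tab, next := [] } := by
  apply Spec.of_quick
  rintro w v v' ⟨h, hv⟩
  subst hv
  exact .seq (.of_run rfl rfl) (.scan rfl (fun s l => ({ v.st w with
    reg := { (v.st w).reg with bit₁ := l.head? }, tab := s, next := l.tail } : St))
    (fun s x => x :: s) (fun _ _ _ => rfl) (fun _ => rfl) (fun _ _ _ => rfl) v.tab v.next h rfl
    (by simp [View.st]))

theorem spec_clear : Spec clear fun w v v' =>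
    v.tab.length ≤ 2 ^ (w.length + 1) ∧ v' = { v with tab := [] } := by
  apply Spec.of_quick
  rintro w v v' ⟨h, hv⟩
  subst hv
  exact .seq (.of_run rfl rfl) (.scan rfl (fun (_ : Unit) l => ({ v.st w with
    reg := { (v.st w).reg with bit₁ := l.head? }, tab := l.tail } : St))
    (fun s _ => s) (fun _ _ _ => rfl) (fun _ => rfl) (fun _ _ _ => rfl) () v.tab h rfl
    (by simp [View.st]))

/-- The counter in variable `4` runs in step with the stack `tab`, so the bit on top always belongs
to the current word. Only the pass at which the counter equals the word sought can set the flag;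
`restore` then rebuilds the table. -/
theorem spec_lookup {i : Fin 6} (hi : i ≠ 4) : Spec (.seq (lookup i) (restore .tabBack rfl))
    fun w v v' => v.carry = false ∧ v.tabBack = [] ∧ (v.env i).length = w.length + 1 ∧
      v.env 4 = List.replicate (w.length + 1) false ∧ ∃ al : List Bool → Bool,
      v.tab = (enum (w.length + 1)).map al ∧ v' = { v with flag := al (v.env i) } := by
  refine ((Spec.of_run rfl).seq ((spec_compare i).seq (.of_run rfl)).each |>.seq
    spec_restore_tabBack).mono ?_
  rintro w v v' ⟨hc, hb, hl, h4, al, ht, hv⟩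
  set m := w.length + 1 with hm
  let V : List (List Bool) → View := fun done => { v with
    flag := done.any fun X => decide (X = v.env i) && al X
    tab := ((enum m).drop done.length).map al
    tabBack := (done.map al).reverse }
  have hz : ∀ u : View, u.env = v.env → u.at 4 (List.replicate m false) = u := by
    intro u hu
    rw [View.at, hu, ← h4, Function.update_eq_self, ← hu]
  refine ⟨V (enum m), ⟨V [], ?_, V, fun _ => hc, fun done X todo h => ?_, ?_, ?_⟩, ?_, ?_⟩
  · simp [run, View.st, V, hb, ht]
  · refine ⟨_, ⟨?_, ?_, rfl⟩, ?_⟩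
    · simpa [View.at] using mem_enum.1 (h ▸ by simp : X ∈ enum m)
    · simpa [View.at, V, hi] using hl
    · simp [run, View.st, View.at, V, h, St.stk, St.set, hi, hc]
  · exact (hz (V []) rfl).symm
  · exact (hz (V (enum m)) rfl).symm
  · simp [V, length_enum, hm]
  · subst hv
    have : ((enum m).any fun X => decide (X = v.env i) && al X) = al (v.env i) := by
      rw [Bool.eq_iff_iff, List.any_eq_true]
      constructor
      · rintro ⟨X, -, h⟩
        simp at h
        exact h.1 ▸ h.2
      · exact fun h => ⟨v.env i, mem_enum.2 hl, by simp [h]⟩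
    simp [V, this, ht, hb, ← List.map_reverse]

/-! ### Conditions on nodes -/

/-- The token in the cell in the register. -/
def Reg.token (r : Reg) : Token := ((r.cell.bind Prod.fst).getD .eps)

/-- The bits in the cell in the register. -/
def Reg.bits (r : Reg) : Bits := (r.cell.map Prod.snd).getD fun _ => false

/-- One step of the parser, in the register. The condition `c` is checked at the new node. -/
def Reg.parse (c : Cond) (r : Reg) : Reg :=
  match rule r.token r.past (r.item₁.map Prod.fst) (r.item₂.map Prod.fst) r.empty with
  | none => { r with ok := false }
  | some (ph, z) => { r with
      past := ph
      new := z.map fun z => (z, r.bits)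
      good := c r.unit ⟨r.token, r.past, r.bits, (r.item₁.map Prod.snd).getD r.bits,
        (r.item₂.map Prod.snd).getD r.bits⟩ && r.good }

/-- One step of the parser. -/
def parseStep (c : Cond) : Prog :=
  .seq (.seq (.ite (fun r => decide (1 ≤ r.token.arity))
      (.pop .items fun r x => { r with item₁ := x }) (.load id))
    (.seq (.ite (fun r => decide (2 ≤ r.token.arity))
      (.pop .items fun r x => { r with item₂ := x }) (.load id))
    (.seq (.peek .items fun r x => { r with empty := x.isNone })
    (.seq (.load (Reg.parse c))
    (.seq (.ite (fun r => r.new.isSome) (.push .items fun r => r.new.getD (.form, fun _ => false))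
      (.load id))
    (.load fun r => { r with item₁ := none, item₂ := none, new := none, empty := false }))))))
  advance

/-- Does the parser accept, and does `c` hold at all nodes? -/
def nodesProg (c : Cond) : Prog :=
  .seq (.seq (.pop .main fun r x => { r with cell := x })
    (.seq (.load fun r => { r with unit := r.bits, ok := true, past := false, good := true })
      advance))
  (.seq (.loop (fun r => r.cell.isSome) (parseStep c))
  (.seq (.seq (.peek .items fun r x => { r with
      flag := (r.ok && r.past && x.isNone) && r.good
      unit := fun _ => false, ok := false, past := false, good := false })
    (.pop .items fun r x => { r with item₁ := x }))
  (.seq (.loop (fun r => r.item₁.isSome) (.pop .items fun r x => { r with item₁ := x }))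
  rewind)))

/-- The state of the machine in which the parser is in the state `S`. -/
def nodesState (c : Cond) (U : Bits) (v : View) (S : PState Bits) (back rest : List Cell) : St where
  reg := { flag := v.flag, carry := v.carry, res := v.res, unit := U, ok := S.ok, past := S.past,
           good := S.nodes.all (c U), cell := rest.head? }
  main := rest.tail
  back := back
  items := S.stack
  tab := v.tab
  tabBack := v.tabBack
  next := v.next

/-- The machine does not store the nodes: the register only keeps the conjunction of `c` over the
nodes produced so far. -/
theorem run_parseStep (c : Cond) (U : Bits) (v : View) (S : PState Bits) (back rest : List Cell)
    (t : Token) (u : Bits) :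
    run (parseStep c) (nodesState c U v S back ((some t, u) :: rest)) =
      nodesState c U v (S.step t u) ((some t, u) :: back) rest := by
  have e : ∀ l : List (Srt × Bits), l.head?.isNone = l.isEmpty := fun l => by cases l <;> rfl
  unfold PState.step
  rcases h : t.arity with _ | _ | n
  · simp only [PState.reduce, Option.map_none]
    rcases hr : rule t S.past none none S.stack.isEmpty with _ | ⟨ph, _ | z⟩ <;>
    simp [parseStep, run, nodesState, St.set, St.stk, advance, Reg.token, Reg.bits, h, Reg.parse, e,
      hr, -List.head?_tail]
  · simp only [PState.reduce, Option.map_none]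
    rcases hr : rule t S.past (Option.map Prod.fst S.stack.head?) none S.stack.tail.isEmpty
      with _ | ⟨ph, _ | z⟩ <;>
    simp [parseStep, run, nodesState, St.set, St.stk, advance, Reg.token, Reg.bits, h, Reg.parse, e,
      hr, -List.head?_tail]
  · simp only [PState.reduce]
    rcases hr : rule t S.past (Option.map Prod.fst S.stack.head?)
      (Option.map Prod.fst S.stack.tail.head?) S.stack.tail.tail.isEmpty
      with _ | ⟨ph, _ | z⟩ <;>
    simp [parseStep, run, nodesState, St.set, St.stk, advance, Reg.token, Reg.bits, h, Reg.parse, e,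
      hr, -List.head?_tail]

theorem length_stack_le (w : List Token) : (parse w).stack.length ≤ w.length := by
  induction w with
  | nil => simp [parse, PState.init]
  | cons t w ih =>
    have key : ∀ (o : ℕ × Formula) (x y : Option (Srt × (ℕ × Formula)))
        (st : List (Srt × (ℕ × Formula))), st.length ≤ w.length →
        ((parse w).reduce t o x y st).stack.length ≤ w.length + 1 := by
      intro o x y st h
      unfold PState.reduce
      split
      · exact h.trans (Nat.le_succ _)
      · rename_i ph r _
        cases r <;> simp <;> omega
    simp only [parse, PState.step, List.length_cons]
    split
    · exact key _ _ _ _ ih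
    · exact key _ _ _ _ (by simp; omega)
    · exact key _ _ _ _ (by simp; omega)

theorem spec_nodesProg (c : Cond) : Spec (nodesProg c) fun w v v' => v' = { v with
    flag := (parse w).accepts &&
      (parse w).nodes.all fun n => c (v.env.bits 0) (n.map fun a => v.env.bits a.1) } := by
  apply Spec.of_quick
  rintro w v v' hv
  subst hv
  set E := v.env with hE
  let g : ℕ × Formula → Bits := fun a => E.bits a.1
  -- After the suffix `b` has been read, the parser is in the state for `b`, with every position
  -- replaced by the bits found there.
  let F : List Token → List Token → St := fun b l => nodesState c (E.bits 0) v ((parse b).map g)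
    (cells E (toks b)).reverse (cells (fun i => (E i).drop (b.length + 1)) (l.map some))
  have hm : (cells E (toks w)).length ≤ 2 ^ (w.length + 1) := by
    rw [length_cells, length_toks]; exact Nat.lt_two_pow_self.le
  have hF : ∀ b t l, run (parseStep c) (F b (t :: l)) = F (t :: b) l := by
    intro b t l
    simp only [F, List.map_cons]
    rw [cells_drop_cons, run_parseStep, reverse_cells_cons]
    congr 1
    -- Replacing annotations commutes with a parser step.
    exact PState.step_map g t (b.length + 1, dn t (itemFormula (parse b).stack 0)
      (itemFormula (parse b).stack 1)) (parse b)
  have hw : w.reverse.foldl (fun (b : List Token) t => t :: b) [] = w := by simp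
  have e : ∀ l : List (Srt × (ℕ × Formula)), l.head?.isNone = l.isEmpty := fun l => by cases l <;> rfl
  let f : Bool := (parse w).accepts && (parse w).nodes.all fun n => c (v.env.bits 0) (n.map g)
  let a : St := { F w [] with reg := { (v.st w).reg with flag := f } }
  refine .seq (.of_run rfl rfl) (.seq (.scan rfl F (fun b t => t :: b) (fun _ _ _ => rfl)
    (fun _ => rfl) hF [] w.reverse ?_ ?_ rfl) (.seq (.of_run rfl rfl) (.seq (.scan rfl
    (fun (_ : Unit) l => ({ a with reg := { a.reg with item₁ := l.head? }, items := l.tail } : St))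
    (fun s _ => s) (fun _ _ _ => rfl) (fun _ => rfl) (fun _ _ _ => rfl) ()
    (((parse w).map g).stack) ?_ ?_ rfl) (quick_rewind hm rfl rfl rfl ?_))))
  · simpa using (Nat.lt_two_pow_self.le.trans (Nat.pow_le_pow_right (by simp) (Nat.le_succ _)))
  · simp [run, St.set, St.stk, View.st, F, nodesState, toks, cells, advance, parse, PState.init,
      PState.map, Reg.bits, ← hE]
  · simpa [PState.map] using (length_stack_le w).trans
      (Nat.lt_two_pow_self.le.trans (Nat.pow_le_pow_right (by simp) (Nat.le_succ _)))
  · rw [hw]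
    simp [run, St.set, St.stk, View.st, F, nodesState, cells, a, f, PState.map, e, PState.accepts, ← hE,
      Function.comp_def]
  · simp [a, f, F, nodesState, View.st, cells, g, ← hE]

/-! ### Comparing names -/

/-- One step of the automaton that extracts a numeral. -/
def Reg.extract (r : Reg) (i : Fin 6) (x : Bool × Bool × Bool) : Extract :=
  Extract.step r.token (r.bits i) (r.bits 0) ⟨x.1, x.2.1, x.2.2, []⟩

/-- One step of the two automata that extract numerals. -/
def extractStep : Prog :=
  .seq (.seq (.ite (fun r => (r.extract 1 r.ext₁).name.head?.isSome)
      (.push .name₁ fun r => ((r.extract 1 r.ext₁).name.head?).getD false) (.load id))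
    (.seq (.ite (fun r => (r.extract 2 r.ext₂).name.head?.isSome)
      (.push .name₂ fun r => ((r.extract 2 r.ext₂).name.head?).getD false) (.load id))
    (.load fun r => { r with
      ext₁ := ((r.extract 1 r.ext₁).seen, (r.extract 1 r.ext₁).active, (r.extract 1 r.ext₁).val)
      ext₂ := ((r.extract 2 r.ext₂).seen, (r.extract 2 r.ext₂).active,
        (r.extract 2 r.ext₂).val) })))
  advance

/-- Do the numerals that are marked in the variables `1` and `2` agree? -/
def namesProg : Prog :=
  .seq (.seq (.pop .main fun r x => { r with cell := x }) advance)
  (.seq (.loop (fun r => r.cell.isSome) extractStep)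
  (.seq (.seq (.load fun r => { r with carry := true })
    (.seq (.pop .name₁ fun r x => { r with bit₁ := x })
      (.pop .name₂ fun r x => { r with bit₂ := x })))
  (.seq (.loop (fun r => r.bit₁.isSome)
    (.seq (.load fun r => { r with carry := r.carry && r.bit₂ == r.bit₁ })
    (.seq (.pop .name₁ fun r x => { r with bit₁ := x })
      (.pop .name₂ fun r x => { r with bit₂ := x }))))
  (.seq (.loop (fun r => r.bit₂.isSome)
    (.seq (.load fun r => { r with carry := false })
      (.pop .name₂ fun r x => { r with bit₂ := x })))
  (.seq (.load fun r => { r with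
    flag := !(r.ext₁.1 && r.ext₂.1 && r.carry) || r.ext₁.2.2 == r.ext₂.2.2
    carry := false, ext₁ := (false, false, false), ext₂ := (false, false, false) })
  rewind)))))

/-- The state of the machine in which the extracting automata are in the states `h₁` and `h₂`. -/
def namesState (v : View) (h₁ h₂ : Extract) (back rest : List Cell) : St where
  reg := { flag := v.flag, carry := v.carry, res := v.res, ext₁ := (h₁.seen, h₁.active, h₁.val),
           ext₂ := (h₂.seen, h₂.active, h₂.val), cell := rest.head? }
  main := rest.tail
  back := back
  name₁ := h₁.name
  name₂ := h₂.name
  tab := v.tab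
  tabBack := v.tabBack
  next := v.next

/-- A step puts at most one letter in front of the name and does not look at the name. The name can
therefore be kept on a stack, while the finite register runs the step with the empty name. -/
theorem Extract.step_name (t : Token) (m u : Bool) (h : Extract) :
    ∃ s : Extract, Extract.step t m u ⟨h.seen, h.active, h.val, []⟩ = s ∧
      (s.name = [] ∧ h.step t m u = ⟨s.seen, s.active, s.val, h.name⟩ ∨
      ∃ b, s.name = [b] ∧ h.step t m u = ⟨s.seen, s.active, s.val, b :: h.name⟩) := by
  refine ⟨_, rfl, ?_⟩
  unfold Extract.step
  cases t
  case var => simp only; split_ifs <;> simp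
  case bit b => simp only; split_ifs <;> simp
  all_goals simp

theorem run_extractStep (v : View) (h₁ h₂ : Extract) (back rest : List Cell) (t : Token)
    (u : Bits) : run extractStep (namesState v h₁ h₂ back ((some t, u) :: rest)) =
      namesState v (h₁.step t (u 1) (u 0)) (h₂.step t (u 2) (u 0)) ((some t, u) :: back) rest := by
  obtain ⟨s₁, e₁, ⟨n₁, k₁⟩ | ⟨b₁, n₁, k₁⟩⟩ := h₁.step_name t (u 1) (u 0) <;>
  obtain ⟨s₂, e₂, ⟨n₂, k₂⟩ | ⟨b₂, n₂, k₂⟩⟩ := h₂.step_name t (u 2) (u 0) <;>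
  simp [extractStep, run, namesState, St.set, St.stk, advance, Reg.extract, Reg.token, Reg.bits, e₁,
    e₂, n₁, n₂, k₁, k₂]

/-- The first loop follows the first name and consumes the second alongside, failing if that runs
out; the second loop fails if letters of the second name are left over. -/
theorem foldl_compareNames (l₁ : List Bool) : ∀ (l₂ : List Bool) (b : Bool),
    (l₁.foldl (fun (p : Bool × List Bool) x => (p.1 && p.2.head? == some x, p.2.tail)) (b, l₂)).2.foldl
      (fun _ _ => false)
      (l₁.foldl (fun (p : Bool × List Bool) x => (p.1 && p.2.head? == some x, p.2.tail)) (b, l₂)).1 =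
    (b && decide (l₁ = l₂)) := by
  induction l₁ with
  | nil =>
    intro l₂ b
    have : ∀ l : List Bool, l.foldl (fun _ _ => false) false = false := fun l => by
      induction l with
      | nil => rfl
      | cons x l ih => simpa using ih
    cases l₂ <;> simp [this]
  | cons x l₁ ih =>
    intro l₂ b
    rw [List.foldl_cons, ih]
    rcases l₂ with _ | ⟨y, l₂⟩
    · simp
    · cases x <;> cases y <;> simp <;> congr

theorem length_extract_le (M X : List Bool) (w : List Token) :
    (extract M X w).name.length ≤ w.length := by
  induction w with
  | nil => simp [extract]
  | cons t w ih =>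
    obtain ⟨s, -, ⟨-, h⟩ | ⟨b, -, h⟩⟩ :=
      (extract M X w).step_name t (bit M (w.length + 1)) (bit X (w.length + 1)) <;>
    simp only [extract, h, List.length_cons] <;> omega

theorem length_foldl_compareNames (l₁ : List Bool) : ∀ p : Bool × List Bool,
    (l₁.foldl (fun (p : Bool × List Bool) x => (p.1 && p.2.head? == some x, p.2.tail)) p).2.length ≤
      p.2.length := by
  induction l₁ with
  | nil => simp
  | cons x l₁ ih => exact fun p => (ih _).trans (by simp)

theorem spec_namesProg : Spec namesProg fun w v v' => v.carry = false ∧ v' = { v with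
    flag := (extract (v.env 1) (v.env 0) w).agree (extract (v.env 2) (v.env 0) w) } := by
  apply Spec.of_quick
  rintro w v v' ⟨hc, hv⟩
  subst hv
  set E := v.env with hE
  let F : List Token → List Token → St := fun b l => namesState v (extract (E 1) (E 0) b)
    (extract (E 2) (E 0) b)
    (cells E (toks b)).reverse (cells (fun i => (E i).drop (b.length + 1)) (l.map some))
  have hle : w.length ≤ 2 ^ (w.length + 1) :=
    Nat.lt_two_pow_self.le.trans (Nat.pow_le_pow_right (by simp) (Nat.le_succ _))
  have hm : (cells E (toks w)).length ≤ 2 ^ (w.length + 1) := by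
    rw [length_cells, length_toks]; exact Nat.lt_two_pow_self.le
  have hF : ∀ b t l, run extractStep (F b (t :: l)) = F (t :: b) l := by
    intro b t l
    simp only [F, List.map_cons]
    rw [cells_drop_cons, run_extractStep, reverse_cells_cons]
    rfl
  have hw : w.reverse.foldl (fun (b : List Token) t => t :: b) [] = w := by simp
  set h₁ := extract (E 1) (E 0) w with hh₁
  set h₂ := extract (E 2) (E 0) w with hh₂
  refine .seq (.of_run rfl rfl) (.seq (.scan rfl F (fun b t => t :: b) (fun _ _ _ => rfl)
    (fun _ => rfl) hF [] w.reverse (by simpa using hle) ?_ rfl) (.seq (.of_run rfl rfl) (.seq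
    (.scan rfl (fun (p : Bool × List Bool) l => ({ F w [] with
      reg := { (F w []).reg with carry := p.1, bit₁ := l.head?, bit₂ := p.2.head? }
      name₁ := l.tail, name₂ := p.2.tail } : St))
      (fun p x => (p.1 && p.2.head? == some x, p.2.tail)) (fun _ _ _ => rfl) (fun _ => rfl)
      (fun _ _ _ => rfl) (true, h₂.name) h₁.name ((length_extract_le _ _ _).trans hle) ?_ rfl) (.seq
    (.scan rfl (fun (b : Bool) l => ({ F w [] with
      reg := { (F w []).reg with carry := b, bit₂ := l.head? }
      name₁ := [], name₂ := l.tail } : St))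
      (fun _ _ => false) (fun _ _ _ => rfl) (fun _ => rfl)
      (fun _ _ _ => rfl) _ _ (((length_foldl_compareNames _ _).trans
        (length_extract_le _ _ _)).trans hle) rfl rfl)
    (.seq (.of_run rfl rfl) (quick_rewind hm rfl rfl rfl ?_))))))
  · simp [run, St.set, St.stk, View.st, F, namesState, toks, cells, advance, extract, ← hE]
  · rw [hw]
    rfl
  · simp only [foldl_compareNames]
    simp [run, F, namesState, View.st, cells, hc, Extract.agree, ← hh₁, ← hh₂]

/-! ### Evaluation of formulas -/

/-- The variable `i` is quantified in the formula. -/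
def Fm.binds (i : Fin 6) : Fm → Bool
  | .not φ => φ.binds i
  | .and φ ψ => φ.binds i || ψ.binds i
  | .all j φ => decide (i = j) || φ.binds i
  | _ => false

/-- The formula can be evaluated by a machine that stores one word for every variable and uses the
variables `4` and `5` for other purposes. -/
def Fm.fits : Fm → Bool
  | .tab i => decide (i ≠ 4) && decide (i ≠ 5)
  | .not φ => φ.fits
  | .and φ ψ => φ.fits && ψ.fits
  | .all i φ => decide (i ≠ 4) && decide (i ≠ 5) && !φ.binds i && φ.fits
  | _ => true

/-- Ignore the variable `5`. -/
def mask (U : Bits) : Bits := Function.update U 5 false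

/-- The program that evaluates a formula. -/
def compile : Fm → Prog
  | .nodes c => nodesProg fun U n => c (mask U) (n.map mask)
  | .names => namesProg
  | .tab i => .seq (lookup i) (restore .tabBack rfl)
  | .not φ => .seq (compile φ) (.load fun r => { r with flag := !r.flag })
  | .and φ ψ => .seq (compile φ) (.ite Reg.flag (compile ψ) (.load id))
  | .all i φ => .seq (.load fun r => { r with flag := false }) (.seq
      (each i (.seq (compile φ) (.load fun r => { r with
        res := Function.update r.res i (r.res i && r.flag), flag := false })))
      (.load fun r => { r with flag := r.res i, res := Function.update r.res i true }))

/-- The state of the machine is ready for the evaluation of a formula. -/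
structure View.Ready (v : View) (w : List Token) (al : List Bool → Bool) (φ : Fm) : Prop where
  carry : v.carry = false
  tabBack : v.tabBack = []
  length : ∀ i, (v.env i).length = w.length + 1
  env : v.env 4 = List.replicate (w.length + 1) false
  tab : v.tab = (enum (w.length + 1)).map al
  bound : ∀ i, φ.binds i = true →
    v.env i = List.replicate (w.length + 1) false ∧ v.res i = true

/-- The words in the variables, apart from variable `5`. -/
def View.words (v : View) (w : List Token) : Env :=
  Function.update v.env 5 (List.replicate (w.length + 1) false)

/-- Variable `5` counts rounds, whereas `table` evaluates its conditions with `0 … 0` there. Masking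
makes the counter invisible. -/
theorem bits_words (v : View) (w : List Token) (k : ℕ) :
    Env.bits (v.words w) k = mask (v.env.bits k) := by
  funext i
  by_cases hi : i = 5
  · subst hi
    simp only [Env.bits, View.words, mask, Function.update_self, bit, List.getD_eq_getElem?_getD,
      List.getElem?_replicate]
    split <;> rfl
  · simp [Env.bits, View.words, mask, Function.update_of_ne hi]

/-- Induction on the formula. By `Fm.fits` no variable is quantified again inside its own scope, so
one counter word and one accumulator bit `res i` per variable suffice; each quantifier returns them
as `0 … 0` and `true`. -/
theorem spec_compile : ∀ φ : Fm, φ.fits = true → Spec (compile φ) fun w v v' =>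
    ∃ al, v.Ready w al φ ∧ v' = { v with flag := φ.eval w al (v.words w) }
  | .nodes c, _ => by
    refine (spec_nodesProg _).mono ?_
    rintro w v v' ⟨al, hv, rfl⟩
    simp only [Fm.eval, bits_words, Node.map]
  | .names, _ => by
    refine spec_namesProg.mono ?_
    rintro w v v' ⟨al, hv, rfl⟩
    exact ⟨hv.carry, by simp [Fm.eval, View.words]⟩
  | .tab i, h => by
    simp only [Fm.fits, Bool.and_eq_true, decide_eq_true_eq] at h
    refine (spec_lookup h.1).mono ?_
    rintro w v v' ⟨al, hv, rfl⟩
    exact ⟨hv.carry, hv.tabBack, hv.length i, hv.env, al, hv.tab, by simp [Fm.eval, View.words, h.2]⟩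
  | .not φ, h => by
    refine ((spec_compile φ h).seq (.of_run rfl)).mono ?_
    rintro w v v' ⟨al, hv, rfl⟩
    exact ⟨_, ⟨al, ⟨hv.1, hv.2, hv.3, hv.4, hv.5, hv.6⟩, rfl⟩, rfl⟩
  | .and φ ψ, h => by
    simp only [Fm.fits, Bool.and_eq_true] at h
    refine ((spec_compile φ h.1).seq ((spec_compile ψ h.2).ite (.of_run rfl))).mono ?_
    rintro w v v' ⟨al, hv, rfl⟩
    refine ⟨_, ⟨al, ⟨hv.1, hv.2, hv.3, hv.4, hv.5, fun i hi => hv.6 i (by simp [Fm.binds, hi])⟩,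
      rfl⟩, fun hf => ⟨al, ⟨hv.1, hv.2, hv.3, hv.4, hv.5,
        fun i hi => hv.6 i (by simp [Fm.binds, hi])⟩, ?_⟩, fun hf => ?_⟩
    · have hf : φ.eval w al (v.words w) = true := hf
      simp only [Fm.eval, hf, Bool.true_and]
      rfl
    · have hf : φ.eval w al (v.words w) = false := hf
      simp [Fm.eval, hf, run, View.st]
  | .all i φ, h => by
    simp only [Fm.fits, Bool.and_eq_true, decide_eq_true_eq, Bool.not_eq_true'] at h
    obtain ⟨⟨⟨h4, h5⟩, hb⟩, hφ⟩ := h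
    refine ((Spec.of_run rfl).seq ((((spec_compile φ hφ).seq (.of_run rfl)).each).seq
      (.of_run rfl))).mono ?_
    rintro w v v' ⟨al, hv, rfl⟩
    set m := w.length + 1 with hm
    obtain ⟨hi, hr⟩ := hv.bound i (by simp [Fm.binds])
    let V : List (List Bool) → View := fun done => { v with
      flag := false
      res := Function.update v.res i
        (done.all fun X => φ.eval w al (Function.update (v.words w) i X)) }
    have hz : ∀ u : View, u.env = v.env → u.at i (List.replicate m false) = u := by
      intro u hu
      rw [View.at, hu, ← hi, Function.update_eq_self, ← hu]
    refine ⟨V [], ?_, V (enum m), ⟨V, fun _ => hv.carry, fun done X todo hX => ?_, ?_, ?_⟩, ?_⟩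
    · simp [run, View.st, V, ← hr]
    · refine ⟨_, ⟨al, ⟨hv.1, hv.2, fun j => ?_, ?_, hv.5, fun j hj => ?_⟩, rfl⟩, ?_⟩
      · by_cases hj : j = i
        · subst hj
          simpa [View.at] using mem_enum.1 (hX ▸ by simp : X ∈ enum m)
        · simpa [View.at, hj, V] using hv.length j
      · simpa [View.at, V, h4.symm] using hv.env
      -- The inner bound variables are still reset although variable `i` is not: `i` is not bound in
      -- `φ`.
      · have hj' : j ≠ i := by
          rintro rfl
          simp [hb] at hj
        simpa [View.at, V, hj'] using hv.bound j (by simp [Fm.binds, hj])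
      · simp only [run, View.st, View.at, V, View.words, Function.update_self,
          Function.update_idem, List.all_append, Function.update_comm h5]
        simp
    · exact (hz (V []) rfl).symm
    · exact (hz (V (enum m)) rfl).symm
    · simp only [run, View.st, V, Function.update_self, Function.update_idem, Fm.eval, ← hm]
      rw [← hr, Function.update_eq_self]

/-! ### The main program -/

/-- One round of the elimination of types. -/
def round : Prog :=
  .seq (each 0 (.seq (compile keep)
    (.seq (.push .next Reg.flag) (.load fun r => { r with flag := false }))))
    (.seq clear (restore .next rfl))

/-- The view of a state between the rounds. -/
def View.init (w : List Token) (al : List Bool → Bool) : View where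
  env := Env.zero (w.length + 1)
  flag := false
  carry := false
  res := fun _ => true
  tab := (enum (w.length + 1)).map al
  tabBack := []
  next := []

/-- All words are tested against the old table, while the verdicts gather on `next` in reverse
order; after `tab` has been cleared, `restore` reverses them again. The word in variable `5` is
arbitrary because it is masked. -/
theorem spec_round : Spec round fun w v v' => ∃ (k : ℕ) (X : List Bool),
    X.length = w.length + 1 ∧
    v = (View.init w (table w k)).at 5 X ∧ v' = (View.init w (table w (k + 1))).at 5 X := by
  refine (((spec_compile keep rfl).seq ((Spec.of_run rfl))).each.seq
    (spec_clear.seq spec_restore_next)).mono ?_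
  rintro w v v' ⟨k, X, hX, rfl, rfl⟩
  set m := w.length + 1 with hm
  let V : List (List Bool) → View := fun done => { (View.init w (table w k)).at 5 X with
    next := (done.map (table w (k + 1))).reverse }
  have hz : ∀ u : View, u.env = Function.update (Env.zero m) 5 X →
      u.at 0 (List.replicate m false) = u := by
    intro u hu
    rw [View.at, hu, ← show Function.update (Env.zero m) 5 X 0 = List.replicate m false from rfl,
      Function.update_eq_self, ← hu]
  refine ⟨V (enum m), ⟨V, fun _ => rfl, fun done Y todo hY => ?_, (hz (V []) rfl).symm,
    (hz (V (enum m)) rfl).symm⟩, { V (enum m) with tab := [] }, ⟨?_, rfl⟩, ?_, ?_⟩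
  · have hl : Y.length = m := mem_enum.1 (hY ▸ by simp)
    refine ⟨_, ⟨table w k, ⟨rfl, rfl, fun j => ?_, rfl, rfl, fun j hj => ?_⟩, rfl⟩, ?_⟩
    · fin_cases j <;> simp [View.at, V, View.init, Env.zero, hl, hX, hm]
    · have : j = 1 ∨ j = 2 ∨ j = 3 := by
        revert j
        decide
      rcases this with rfl | rfl | rfl <;> exact ⟨rfl, rfl⟩
    · have he : View.words ((V done).at 0 Y) w = Function.update (Env.zero m) 0 Y := by
        funext j
        fin_cases j <;> rfl
      simp only [he]
      simp [run, View.st, V, View.at, View.init, St.set, St.stk, table, hl, ← hm]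
  · simp [V, View.at, View.init, length_enum, ← hm]
  · simp [V, length_enum]
  · simp [V, View.at, View.init, ← hm]

/-- All rounds of the elimination of types, and the final test. -/
def decideProg : Prog :=
  .seq (each 5 (.push .tab fun _ => true)) (.seq (each 5 round) (.seq (compile final) clear))

/-- The counter in variable `5` serves twice: it writes `2 ^ (|w| + 1)` entries of the first table
and then counts as many rounds. -/
theorem spec_decideProg : Spec decideProg fun w v v' =>
    v = { View.init w (table w 0) with tab := [] } ∧
    v' = { View.init w (table w 0) with tab := [], flag := decideConsequence w } := by
  refine ((Spec.of_run rfl).each.seq (spec_round.each.seq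
    ((spec_compile final rfl).seq spec_clear))).mono ?_
  rintro w v v' ⟨rfl, rfl⟩
  set m := w.length + 1 with hm
  have hz : ∀ u : View, u.env = Env.zero m → u.at 5 (List.replicate m false) = u := by
    intro u hu
    rw [View.at, hu, ← show Env.zero m 5 = List.replicate m false from rfl,
      Function.update_eq_self, ← hu]
  -- All words of the right length are in the first table, so its stack is a row of `true`.
  let V : List (List Bool) → View := fun done => { View.init w (table w 0) with
    tab := List.replicate done.length true }
  refine ⟨V (enum m), ⟨V, fun _ => rfl, fun done X todo hX => ?_, (hz (V []) rfl).symm,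
    (hz (V (enum m)) rfl).symm⟩, View.init w (table w (enum m).length),
    ⟨fun done => View.init w (table w done.length), fun _ => rfl, fun done X todo hX => ?_, ?_,
      (hz (View.init w (table w (enum m).length)) rfl).symm⟩, _,
    ⟨table w (enum m).length, ⟨rfl, rfl, fun i => ?_, rfl, rfl, fun _ _ => ⟨rfl, rfl⟩⟩, rfl⟩, ?_, ?_⟩
  · simp [run, View.st, View.at, V, View.init, St.set, St.stk, List.replicate_succ]
  · exact ⟨done.length, X, mem_enum.1 (hX ▸ by simp), rfl, by simp⟩
  · refine Eq.trans ?_ (hz (View.init w (table w 0)) rfl).symm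
    simp only [V, View.init, ← hm]
    congr 1
    symm
    rw [List.eq_replicate_iff]
    simp [table, mem_enum, hm]
  · simp [View.init, Env.zero]
  · simp [View.init, length_enum, ← hm]
  · have he : View.words (View.init w (table w (enum m).length)) w = Env.zero m := by
      funext i
      fin_cases i <;> rfl
    simp only [he]
    simp [View.init, decideConsequence, length_enum, ← hm]

/-- Delete the contents of the main stack. -/
def erase : Prog :=
  .seq (.pop .main fun r x => { r with cell := x })
    (.loop (fun r => r.cell.isSome) (.pop .main fun r x => { r with cell := x }))

/-- Move the input to the main stack. -/
def readInput : Prog :=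
  .seq (.pop .inp fun r x => { r with cell := x.map fun t => (some t, fun _ => false) })
    (.seq (.loop (fun r => r.cell.isSome)
      (.seq (.push .main fun r => r.cell.getD (none, fun _ => false))
        (.pop .inp fun r x => { r with cell := x.map fun t => (some t, fun _ => false) })))
    (.push .main fun _ => (none, fun _ => false)))

/-- The decision procedure as a program. -/
def prog : Prog :=
  .seq readInput (.seq decideProg (.seq (.seq (.push .out Reg.flag)
    (.load fun r => { r with flag := false })) erase))

theorem cells_zero (m : ℕ) (ts : List (Option Token)) :
    cells (Env.zero m) ts = ts.map fun t => (t, fun _ => false) := by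
  have hb : ∀ m, Env.bits (Env.zero m) 0 = fun _ => false := by
    intro m
    funext i
    cases m <;> rfl
  induction ts generalizing m with
  | nil => rfl
  | cons t ts ih =>
    have : (fun i => (Env.zero m i).tail) = Env.zero (m - 1) := by
      funext i
      simp [Env.zero]
    simp only [cells, this, ih, List.map_cons, hb]

theorem quick_readInput : ∃ C, ∀ w : List Token, Quick (w.length + 1) C readInput { inp := w }
    (View.st w { View.init w (table w 0) with tab := [] }) := by
  refine ⟨_, fun w => .seq (.of_run rfl rfl) (.seq (.scan rfl (fun s l => ({
    reg := { cell := l.head?.map fun t => (some t, fun _ => false) }, inp := l.tail, main := s } : St))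
    (fun s t => (some t, fun _ => false) :: s) (fun _ _ _ => rfl) (fun _ => rfl)
    (fun _ _ _ => rfl) [] w ?_ rfl rfl) (.of_run rfl ?_))⟩
  · exact Nat.lt_two_pow_self.le.trans (Nat.pow_le_pow_right (by simp) (Nat.le_succ _))
  · have : ∀ s, w.foldl (fun (s : List Cell) t => (some t, fun _ => false) :: s) s =
        (w.map fun t => (some t, fun _ => false)).reverse ++ s := by
      intro s
      induction w generalizing s with
      | nil => rfl
      | cons t w ih => simp [ih]
    simp [run, St.set, St.stk, this, View.st, View.init, cells_zero, toks, Function.comp_def]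

/-- A halting configuration has the initial register and empty stacks except for the output, so the
flag and the main stack have to be cleaned up. -/
theorem quick_erase : ∃ C, ∀ (w : List Token) (b : Bool), Quick (w.length + 1) C
    (.seq (.seq (.push .out Reg.flag) (.load fun r => { r with flag := false })) erase)
    (View.st w { View.init w (table w 0) with tab := [], flag := b }) { out := [b] } := by
  refine ⟨_, fun w b => .seq (.of_run rfl rfl) (.seq (.of_run rfl rfl) (.scan rfl
    (fun (_ : Unit) l => ({ reg := { cell := l.head? }, main := l.tail, out := [b] } : St))
    (fun s _ => s) (fun _ _ _ => rfl) (fun _ => rfl) (fun _ _ _ => rfl) ()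
    (cells (Env.zero (w.length + 1)) (toks w)) ?_ rfl rfl))⟩
  rw [length_cells, length_toks]
  exact Nat.lt_two_pow_self.le

theorem exists_runs_prog : ∃ p : Polynomial ℕ, ∀ w : List Token,
    Runs prog { inp := w } { out := [decideConsequence w] } (2 ^ p.eval w.length) := by
  obtain ⟨C, hC⟩ := quick_readInput
  obtain ⟨D, hD⟩ := quick_erase
  obtain ⟨p, hp⟩ := spec_decideProg
  refine ⟨.X + p + .C (C + D + 3), fun w => (Runs.seq (hC w) ((hp w _ _ ⟨rfl, rfl⟩).seq
    (hD w _))).mono ?_⟩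
  simp only [Polynomial.eval_add, Polynomial.eval_X, Polynomial.eval_C]
  have h := two_pow_add_le (C + D + (w.length + 1)) (p.eval w.length)
  have h' : (C + D) * 2 ^ (w.length + 1) ≤ 2 ^ (C + D + (w.length + 1)) := by
    rw [pow_add 2 (C + D)]
    exact Nat.mul_le_mul_right _ Nat.lt_two_pow_self.le
  rw [show w.length + p.eval w.length + (C + D + 3) =
    C + D + (w.length + 1) + p.eval w.length + 2 by omega]
  linarith

theorem inEXPTIME_finitaryConsequence : InEXPTIME finitaryConsequence := by
  obtain ⟨p, hp⟩ := exists_runs_prog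
  let : Fintype Reg := Fintype.ofFinite _
  let : Fintype (Stk.Alphabet .inp) := inferInstanceAs (Fintype Token)
  have hs : ∀ w : List Token, StackProg.single (Γ := Stk.Alphabet) .inp w = ({ inp := w } : St).stk :=
    fun w => by funext k; cases k <;> rfl
  have hs' : ∀ b : Bool, StackProg.single (Γ := Stk.Alphabet) .out [b] = ({ out := [b] } : St).stk :=
    fun w => by funext k; cases k <;> rfl
  refine StackProg.inEXPTIME (Γ := Stk.Alphabet) _ .inp .out (.refl _) (.refl _) {} prog
    decideConsequence decideConsequence_iff p fun w => ?_
  obtain ⟨t, ht, h⟩ := hp w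
  refine ⟨t, ht, ?_⟩
  simpa [hs, hs'] using h

end BFNL

theorem mainTheorem1 : InEXPTIME BFNL.finitaryConsequence :=
  BFNL.inEXPTIME_finitaryConsequence
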